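/- Let $\mathbb K$ be an algebraically closed field of characteristic zero, $n\ge 1$, $m=\lceil n/2\rceil$, $\sigma=(\sigma_1,\dots,\sigma_n)\in\{\pm1\}^n$, and $z\in\mathbb K$ with $2z\notin\mathbb Z$. Fix $\sqrt{-1}\in\mathbb K$ and, for every $i\in\mathbb Z$, a square root $\sqrt{z+i}$; put $\sqrt{-(z+i)}:=(-1)^i\sqrt{-1}\sqrt{z+i}$. In $\mathfrak{gl}_{2m|2m}(\mathbb K)$, with natural supermodule with even basis $u_1,\dots,u_{2m}$, odd basis $u'_1,\dots,u'_{2m}$ and matrix units $x_{r,s}$, set $e_{r,s}=x_{r,s}+x_{2m+r,2m+s}$, $e'_{r,s}=x_{r,2m+s}+x_{2m+r,s}$, $f_{r,s}=x_{r,s}-x_{2m+r,2m+s}$, $f'_{r,s}=x_{r,2m+s}-x_{2m+r,s}$, $d_r=e_{r,r}$, $d'_r=e'_{r,r}$. Let $\mathfrak g$ be the Lie subsuperalgebra spanned by the $e_{r,s},e'_{r,s}$ with $1\le r,s\le n$ together with, if $n$ is odd, $d_{2m},d'_{2m}$ (so $\mathfrak g=\mathfrak q_n$ for even $n$, and $\mathfrak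 g=\mathfrak q_n\oplus\mathfrak q_1$ for odd $n$). Let $\mathfrak b\subseteq\mathfrak g$ be spanned by the $e_{r,s},e'_{r,s}$ in $\mathfrak g$ with $r\le s$, and $\mathfrak h$ by $d_1,d_1',\dots,d_{2m},d'_{2m}$. Let $U$ be the $\mathfrak g$-supermodule with basis $u_1,\dots,u_n,u_1',\dots,u_n'$ and $U^*$ its dual. For $b\in\mathbb Z^n$ let $\lambda_{b,r}=\sigma_r(z+b_r)$ for $1\le r\le n$, and $\lambda_{b,2m}=\sqrt{\lambda_{b,2m}}=1$ if $n$ is odd. Let $V$ be the superspace with even basis vector $v$ and odd basis vector $v'$, with odd operators $c_1v=v'$, $c_1v'=v$, $c_2v=\sqrt{-1}\,v'$, $c_2v'=-\sqrt{-1}\,v$. Let $V(b)=V^{\otimes m}$ be the $\mathfrak h$-supermodule on which $d_r$ acts by $\lambda_{b,r}$ and $d_r'$ by $\sqrt{\lambda_{b,r}}\;\mathrm{id}^{\otimes(s-1)}\otimes c_{r+2-2s}\otimes\mathrm{id}^{\otimes(m-s)}$, where $s=\lceil r/2\rceil$, with the usual sign rule. Inflate it to $\mathfrak b$ through $\mathfrak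 b\twoheadrightarrow\mathfrak h$, and let $M(b)=U(\mathfrak g)\otimes_{U(\mathfrak b)}V(b)$ be the Verma supermodule. For a $\mathfrak g$-supermodule $M$ put $sF\,M=U\otimes M$ and $sE\,M=U^*\otimes M$, and let $x_M$ (resp. $x_M^*$) be left multiplication by $\omega$ on $U\otimes M$ (resp. by $-\omega$ on $U^*\otimes M$), where $\omega=\sum_{r,s=1}^n(f_{r,s}\otimes e_{s,r}-f'_{r,s}\otimes e'_{s,r})$. For $j\in\mathbb K$ let $sF_j\,M$ (resp. $sE_j\,M$) be the generalized $j$-eigenspace of $x_M$ (resp. $x_M^*$). Let $d_t\in\mathbb Z^n$ now also denote the tuple with $t$-th entry $1$ and all other entries $0$. For $i\in\mathbb Z$ let $i\text{-sig}_t(b)=\mathtt f$ if ($\sigma_t=+1$ and $b_t=i$) or ($\sigma_t=-1$ and $b_t=i+1$); $i\text{-sig}_t(b)=\mathtt e$ if ($\sigma_t=+1$ and $b_t=i+1$) or ($\sigma_t=-1$ and $b_t=i$); and $i\text{-sig}_t(b)=\bullet$ otherwise. **Theorem.** Let $b\in\mathbb Z^n$, $i\in\mathbb Z$ and $j:=\sqrt{z+i}\,\sqrt{z+i+1}$.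 (1) $sF_j\,M(b)$ is a $\mathfrak g$-subsupermodule of $sF\,M(b)$, and has a filtration by subsupermodules whose sections are evenly isomorphic (isomorphic by a parity-preserving isomorphism) to the Verma supermodules $M(b+\sigma_td_t)$ for $1\le t\le n$ with $i\text{-sig}_t(b)=\mathtt f$, each occurring exactly once, in order of increasing $t$ from bottom to top. (2) $sE_j\,M(b)$ is a $\mathfrak g$-subsupermodule of $sE\,M(b)$, and has a filtration by subsupermodules whose sections are evenly isomorphic to the Verma supermodules $M(b-\sigma_td_t)$ for $1\le t\le n$ with $i\text{-sig}_t(b)=\mathtt e$, each occurring exactly once, in order of increasing $t$ from top to bottom. In both cases the filtration is multiplicity-free: the Verma supermodules that occur are pairwise not evenly isomorphic. -/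

import Mathlib

open scoped TensorProduct

namespace QSuper

noncomputable section

/-! ### The general linear Lie superalgebra `gl(N|N)` and its graded subalgebras -/

/-- Indices of the standard basis `u_1, …, u_N, u_1', …, u_N'`
(`inl r` is `u_{r+1}`, `inr r` is `u_{r+1}'`). -/
abbrev Idx (N : ℕ) := Fin N ⊕ Fin N

/-- The underlying space of `gl(N|N)`. -/
abbrev Mat (K : Type*) (N : ℕ) := Matrix (Idx N) (Idx N) K

/-- Parity of a basis vector. -/
def par {N : ℕ} : Idx N → ZMod 2 := Sum.elim (fun _ => 0) (fun _ => 1)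

/-- Position of a basis vector, forgetting its parity. -/
def pos {N : ℕ} : Idx N → Fin N := Sum.elim id id

/-- The Koszul sign `(-1)^{pq}`. -/
def ksign (K : Type*) [Field K] (p q : ZMod 2) : K := (-1) ^ (p.val * q.val)

/-- The homogeneous component of degree `p` of a matrix. -/
def comp {K : Type*} [Field K] {N : ℕ} (p : ZMod 2) : Mat K N →ₗ[K] Mat K N where
  toFun x := Matrix.of fun i j => if par i + par j = p then x i j else 0
  map_add' x y := by ext i j; by_cases h : par i + par j = p <;> simp [h]
  map_smul' c x := by ext i j; by_cases h : par i + par j = p <;> simp [h]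

/-- `x` is homogeneous of degree `p`. -/
def Homog {K : Type*} [Field K] {N : ℕ} (p : ZMod 2) (x : Mat K N) : Prop :=
  ∀ i j, par i + par j ≠ p → x i j = 0

/-- The supercommutator: `[x,y] = xy - (-1)^{|x||y|} yx` on homogeneous elements, extended
bilinearly. -/
def sbr {K : Type*} [Field K] {N : ℕ} (x y : Mat K N) : Mat K N :=
  ∑ p : ZMod 2, ∑ q : ZMod 2,
    (comp p x * comp q y - ksign K p q • (comp q y * comp p x))

/-- A Lie subsuperalgebra of `gl(N|N)`. -/
structure SubSuperalgebra (K : Type*) [Field K] (N : ℕ) where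
  carrier : Submodule K (Mat K N)
  comp_mem : ∀ (p : ZMod 2) (x : Mat K N), x ∈ carrier → comp p x ∈ carrier
  sbr_mem : ∀ x y : Mat K N, x ∈ carrier → y ∈ carrier → sbr x y ∈ carrier

section basics
variable {K : Type*} [Field K] {N : ℕ}

theorem zmod2_cases (p : ZMod 2) : p = 0 ∨ p = 1 := by
  revert p; decide

theorem comp_apply (p : ZMod 2) (x : Mat K N) (i j : Idx N) :
    comp p x i j = if par i + par j = p then x i j else 0 := rfl

theorem homog_comp (p : ZMod 2) (x : Mat K N) : Homog p (comp p x) := by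
  intro i j h; simp [comp_apply, h]

theorem comp_of_homog {p : ZMod 2} {x : Mat K N} (h : Homog p x) : comp p x = x := by
  ext i j
  rw [comp_apply]
  split_ifs with h'
  · rfl
  · exact (h i j h').symm

theorem comp_of_homog_ne {p q : ZMod 2} {x : Mat K N} (h : Homog p x) (hq : q ≠ p) :
    comp q x = 0 := by
  ext i j
  rw [comp_apply]
  split_ifs with h'
  · exact h i j (by rw [h']; exact hq)
  · rfl

theorem comp_zero_add_comp_one (x : Mat K N) : comp 0 x + comp 1 x = x := by
  ext i j
  rw [Matrix.add_apply, comp_apply, comp_apply]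
  rcases zmod2_cases (par i + par j) with h | h <;> simp [h]

theorem sbr_of_homog {p q : ZMod 2} {x y : Mat K N} (hx : Homog p x) (hy : Homog q y) :
    sbr x y = x * y - ksign K p q • (y * x) := by
  unfold sbr
  rw [Finset.sum_eq_single p, Finset.sum_eq_single q, comp_of_homog hx, comp_of_homog hy]
  · intro b _ hb
    simp [comp_of_homog_ne hy hb]
  · simp
  · intro b _ hb
    simp [comp_of_homog_ne hx hb]
  · simp

theorem homog_mul {p q : ZMod 2} {x y : Mat K N} (hx : Homog p x) (hy : Homog q y) :
    Homog (p + q) (x * y) := by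
  intro i j h
  rw [Matrix.mul_apply]
  refine Finset.sum_eq_zero fun k _ => ?_
  by_cases h1 : par i + par k = p
  · by_cases h2 : par k + par j = q
    · exfalso
      apply h
      rw [← h1, ← h2]
      have : par k + par k = 0 := CharTwo.add_self_eq_zero _
      linear_combination -this
    · rw [hy k j h2, mul_zero]
  · rw [hx i k h1, zero_mul]

theorem homog_sbr {p q : ZMod 2} {x y : Mat K N} (hx : Homog p x) (hy : Homog q y) :
    Homog (p + q) (sbr x y) := by
  rw [sbr_of_homog hx hy]
  intro i j h
  have h1 := homog_mul hx hy i j h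
  have h2 := homog_mul hy hx i j (by rwa [add_comm q p])
  rw [Matrix.sub_apply, Matrix.smul_apply, h1, h2]
  simp

end basics

namespace SubSuperalgebra
variable {K : Type*} [Field K] {N : ℕ}

/-- The homogeneous component of degree `p`, as an endomorphism of a Lie subsuperalgebra. -/
def compL (L : SubSuperalgebra K N) (p : ZMod 2) : L.carrier →ₗ[K] L.carrier :=
  (comp p).restrict (L.comp_mem p)

/-- The bracket of a Lie subsuperalgebra. -/
def br (L : SubSuperalgebra K N) (x y : L.carrier) : L.carrier :=
  ⟨sbr x.1 y.1, L.sbr_mem _ _ x.2 y.2⟩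

theorem compL_of_homog (L : SubSuperalgebra K N) {p : ZMod 2} {x : L.carrier}
    (h : Homog p x.1) : L.compL p x = x := Subtype.ext (comp_of_homog h)

theorem compL_of_homog_ne (L : SubSuperalgebra K N) {p q : ZMod 2} {x : L.carrier}
    (h : Homog p x.1) (hq : q ≠ p) : L.compL q x = 0 := Subtype.ext (comp_of_homog_ne h hq)

theorem homog_br (L : SubSuperalgebra K N) {p q : ZMod 2} {x y : L.carrier}
    (hx : Homog p x.1) (hy : Homog q y.1) : Homog (p + q) (L.br x y).1 := homog_sbr hx hy

end SubSuperalgebra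

/-! ### Supermodules -/

/-- A supermodule structure over the Lie superalgebra `L` on a vector space `M`. The
`ℤ/2`-grading is recorded by the parity involution `v ↦ (-1)^{|v|} v`, so that the even (odd)
part of `M` is its `1`-eigenspace (`-1`-eigenspace); this is used in characteristic zero only. -/
structure SuperRep {K : Type*} [Field K] {N : ℕ} (L : SubSuperalgebra K N)
    (M : Type*) [AddCommGroup M] [Module K M] where
  parity : Module.End K M
  parity_sq : parity * parity = 1
  act : L.carrier →ₗ[K] Module.End K M
  /-- homogeneous elements of degree `p` act by homogeneous maps of degree `p` -/
  act_parity : ∀ (p : ZMod 2) (x : L.carrier), Homog p x.1 →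
    parity * act x = ((-1 : K) ^ p.val) • (act x * parity)
  act_br : ∀ (p q : ZMod 2) (x y : L.carrier), Homog p x.1 → Homog q y.1 →
    act (L.br x y) = act x * act y - ksign K p q • (act y * act x)

/-- Two supermodules are evenly isomorphic: there is a parity-preserving linear isomorphism
that commutes with the action. -/
def EvenlyIso {K : Type*} [Field K] {N : ℕ} {L : SubSuperalgebra K N}
    {M : Type*} [AddCommGroup M] [Module K M] {M' : Type*} [AddCommGroup M'] [Module K M']
    (ρ : SuperRep L M) (ρ' : SuperRep L M') : Prop :=
  ∃ φ : M ≃ₗ[K] M', (∀ v, φ (ρ.parity v) = ρ'.parity (φ v)) ∧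
    ∀ x v, φ (ρ.act x v) = ρ'.act x (φ v)

/-- A subsupermodule: a graded subspace stable under the action. -/
structure SubSuperRep {K : Type*} [Field K] {N : ℕ} {L : SubSuperalgebra K N}
    {M : Type*} [AddCommGroup M] [Module K M] (ρ : SuperRep L M) where
  carrier : Submodule K M
  parity_mem : ∀ v ∈ carrier, ρ.parity v ∈ carrier
  act_mem : ∀ x, ∀ v ∈ carrier, ρ.act x v ∈ carrier

/-- A subsupermodule as a supermodule. -/
def SubSuperRep.toRep {K : Type*} [Field K] {N : ℕ} {L : SubSuperalgebra K N}
    {M : Type*} [AddCommGroup M] [Module K M] {ρ : SuperRep L M} (P : SubSuperRep ρ) :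
    SuperRep L P.carrier where
  parity := ρ.parity.restrict P.parity_mem
  parity_sq := by
    ext v
    exact LinearMap.congr_fun ρ.parity_sq v.1
  act :=
    { toFun := fun x => (ρ.act x).restrict (P.act_mem x)
      map_add' := fun x y => by ext v; simp
      map_smul' := fun c x => by ext v; simp }
  act_parity p x hx := by
    ext v
    exact LinearMap.congr_fun (ρ.act_parity p x hx) v.1
  act_br p q x y hx hy := by
    ext v
    exact LinearMap.congr_fun (ρ.act_br p q x y hx hy) v.1

/-- The quotient of a supermodule by a subsupermodule. -/
def SuperRep.quot {K : Type*} [Field K] {N : ℕ} {L : SubSuperalgebra K N}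
    {M : Type*} [AddCommGroup M] [Module K M] (ρ : SuperRep L M) (P : SubSuperRep ρ) :
    SuperRep L (M ⧸ P.carrier) where
  parity := P.carrier.mapQ P.carrier ρ.parity P.parity_mem
  parity_sq := by
    ext v
    simpa using congrArg P.carrier.mkQ (LinearMap.congr_fun ρ.parity_sq v)
  act :=
    { toFun := fun x => P.carrier.mapQ P.carrier (ρ.act x) (P.act_mem x)
      map_add' := fun x y => by ext v; simp
      map_smul' := fun c x => by ext v; simp }
  act_parity p x hx := by
    ext v
    simpa using congrArg P.carrier.mkQ (LinearMap.congr_fun (ρ.act_parity p x hx) v)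
  act_br p q x y hx hy := by
    ext v
    simpa using congrArg P.carrier.mkQ (LinearMap.congr_fun (ρ.act_br p q x y hx hy) v)

/-- `P`, intersected with `Q`, as a subsupermodule of `Q`. -/
def SubSuperRep.within {K : Type*} [Field K] {N : ℕ} {L : SubSuperalgebra K N}
    {M : Type*} [AddCommGroup M] [Module K M] {ρ : SuperRep L M} (P Q : SubSuperRep ρ) :
    SubSuperRep Q.toRep where
  carrier := P.carrier.submoduleOf Q.carrier
  parity_mem v hv := P.parity_mem v.1 hv
  act_mem x v hv := P.act_mem x v.1 hv

/-- The section `Q / P` of a filtration, for subsupermodules `P ≤ Q`. -/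
def SubSuperRep.sec {K : Type*} [Field K] {N : ℕ} {L : SubSuperalgebra K N}
    {M : Type*} [AddCommGroup M] [Module K M] {ρ : SuperRep L M} (P Q : SubSuperRep ρ) :
    SuperRep L (Q.carrier ⧸ P.carrier.submoduleOf Q.carrier) :=
  Q.toRep.quot (P.within Q)

/-- The action of `x` on a tensor product of supermodules:
`x (w ⊗ m) = x w ⊗ m + (-1)^{|x||w|} w ⊗ x m`. -/
def tensorAct {K : Type*} [Field K] {N : ℕ} {L : SubSuperalgebra K N}
    {W : Type*} [AddCommGroup W] [Module K W] {M : Type*} [AddCommGroup M] [Module K M]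
    (ρ : SuperRep L W) (τ : SuperRep L M) : L.carrier →ₗ[K] Module.End K (W ⊗[K] M) where
  toFun x := TensorProduct.map (ρ.act x) 1
    + TensorProduct.map 1 (τ.act (L.compL 0 x))
    + TensorProduct.map ρ.parity (τ.act (L.compL 1 x))
  map_add' x y := by
    simp only [map_add, TensorProduct.map_add_left, TensorProduct.map_add_right]; abel
  map_smul' c x := by
    simp only [map_smul, TensorProduct.map_smul_left, TensorProduct.map_smul_right,
      smul_add, RingHom.id_apply]

theorem tensorAct_of_homog {K : Type*} [Field K] {N : ℕ} {L : SubSuperalgebra K N}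
    {W : Type*} [AddCommGroup W] [Module K W] {M : Type*} [AddCommGroup M] [Module K M]
    (ρ : SuperRep L W) (τ : SuperRep L M) {p : ZMod 2} {x : L.carrier} (hx : Homog p x.1) :
    tensorAct ρ τ x = TensorProduct.map (ρ.act x) 1
      + TensorProduct.map (ρ.parity ^ p.val) (τ.act x) := by
  change TensorProduct.map (ρ.act x) 1
    + TensorProduct.map 1 (τ.act (L.compL 0 x))
    + TensorProduct.map ρ.parity (τ.act (L.compL 1 x)) = _
  rcases zmod2_cases p with rfl | rfl
  · rw [L.compL_of_homog hx, L.compL_of_homog_ne hx (by decide), map_zero,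
      TensorProduct.map_zero_right, ZMod.val_zero, pow_zero, add_zero]
  · rw [L.compL_of_homog hx, L.compL_of_homog_ne hx (by decide), map_zero,
      TensorProduct.map_zero_right, ZMod.val_one, pow_one, add_zero]

section tmap
variable {K : Type*} [Field K] {W : Type*} [AddCommGroup W] [Module K W] {M : Type*}
  [AddCommGroup M] [Module K M]

theorem tmap_neg_left (f : Module.End K W) (f' : Module.End K M) :
    TensorProduct.map (-f) f' = -TensorProduct.map f f' := by
  refine TensorProduct.ext' fun w m => ?_
  simp [TensorProduct.neg_tmul]

theorem tmap_sub_left (f g : Module.End K W) (f' : Module.End K M) :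
    TensorProduct.map (f - g) f' = TensorProduct.map f f' - TensorProduct.map g f' := by
  rw [sub_eq_add_neg, TensorProduct.map_add_left, tmap_neg_left, sub_eq_add_neg]

theorem tmap_sub_right (f : Module.End K W) (f' g' : Module.End K M) :
    TensorProduct.map f (f' - g') = TensorProduct.map f f' - TensorProduct.map f g' := by
  refine TensorProduct.ext' fun w m => ?_
  simp [TensorProduct.tmul_sub]

theorem tneg_one_smul (f : Module.End K (W ⊗[K] M)) : (-1 : K) • f = -f := by
  refine TensorProduct.ext' fun w m => ?_
  change (-1 : K) • f (w ⊗ₜ[K] m) = -f (w ⊗ₜ[K] m)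
  exact neg_one_smul K _

end tmap

/-- The tensor product of two supermodules, with `|w ⊗ m| = |w| + |m|`. -/
def SuperRep.tensor {K : Type*} [Field K] {N : ℕ} {L : SubSuperalgebra K N}
    {W : Type*} [AddCommGroup W] [Module K W] {M : Type*} [AddCommGroup M] [Module K M]
    (ρ : SuperRep L W) (τ : SuperRep L M) : SuperRep L (W ⊗[K] M) where
  parity := TensorProduct.map ρ.parity τ.parity
  parity_sq := by
    rw [← TensorProduct.map_mul, ρ.parity_sq, τ.parity_sq, TensorProduct.map_one]
  act := tensorAct ρ τ
  act_parity p x hx := by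
    have h1 := ρ.act_parity p x hx
    have h2 := τ.act_parity p x hx
    rw [tensorAct_of_homog ρ τ hx, mul_add, add_mul, smul_add]
    simp only [← TensorProduct.map_mul, mul_one, one_mul, h1, h2,
      TensorProduct.map_smul_left, TensorProduct.map_smul_right, ← pow_succ, ← pow_succ']
  act_br p q x y hx hy := by
    have h1 := ρ.act_br p q x y hx hy
    have h2 := τ.act_br p q x y hx hy
    have h3 := ρ.act_parity p x hx
    have h4 := ρ.act_parity q y hy
    have hs := ρ.parity_sq
    rw [tensorAct_of_homog ρ τ hx, tensorAct_of_homog ρ τ hy,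
      tensorAct_of_homog ρ τ (L.homog_br hx hy), h1, h2]
    rcases zmod2_cases p with rfl | rfl <;> rcases zmod2_cases q with rfl | rfl <;>
    · simp only [ksign, ZMod.val_zero, ZMod.val_one, pow_zero, pow_one, mul_zero, mul_one,
        one_smul, neg_smul, tneg_one_smul, add_zero, zero_add, sub_neg_eq_add,
        show (1 : ZMod 2) + 1 = 0 from by decide] at h3 h4 ⊢
      simp only [mul_add, add_mul, ← TensorProduct.map_mul, mul_one, one_mul, h3, h4, hs,
        TensorProduct.map_add_left, TensorProduct.map_add_right, tmap_sub_left,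
        tmap_sub_right, tmap_neg_left]
      abel

/-! ### Enveloping superalgebras and induced supermodules -/

/-- The defining relations `xy - (-1)^{|x||y|} yx = [x,y]` of the enveloping superalgebra. -/
inductive EnvRel {K : Type*} [Field K] {N : ℕ} (L : SubSuperalgebra K N) :
    TensorAlgebra K L.carrier → TensorAlgebra K L.carrier → Prop
  | of (p q : ZMod 2) (x y : L.carrier) (hx : Homog p x.1) (hy : Homog q y.1) :
      EnvRel L
        (TensorAlgebra.ι K x * TensorAlgebra.ι K y
          - ksign K p q • (TensorAlgebra.ι K y * TensorAlgebra.ι K x))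
        (TensorAlgebra.ι K (L.br x y))

/-- The universal enveloping superalgebra `U(L)`. -/
def Env {K : Type*} [Field K] {N : ℕ} (L : SubSuperalgebra K N) := RingQuot (EnvRel L)

instance {K : Type*} [Field K] {N : ℕ} (L : SubSuperalgebra K N) : Ring (Env L) :=
  inferInstanceAs (Ring (RingQuot (EnvRel L)))

instance {K : Type*} [Field K] {N : ℕ} (L : SubSuperalgebra K N) : Algebra K (Env L) :=
  inferInstanceAs (Algebra K (RingQuot (EnvRel L)))

/-- The quotient map from the tensor algebra to `U(L)`. -/
def envMk {K : Type*} [Field K] {N : ℕ} (L : SubSuperalgebra K N) :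
    TensorAlgebra K L.carrier →ₐ[K] Env L :=
  RingQuot.mkAlgHom K (EnvRel L)

/-- The canonical map `L → U(L)`. -/
def envι {K : Type*} [Field K] {N : ℕ} (L : SubSuperalgebra K N) : L.carrier →ₗ[K] Env L :=
  (envMk L).toLinearMap ∘ₗ TensorAlgebra.ι K

theorem envι_br {K : Type*} [Field K] {N : ℕ} (L : SubSuperalgebra K N) (p q : ZMod 2)
    (x y : L.carrier) (hx : Homog p x.1) (hy : Homog q y.1) :
    envι L (L.br x y) = envι L x * envι L y - ksign K p q • (envι L y * envι L x) := by
  have h : envMk L _ = envMk L _ :=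
    RingQuot.mkAlgHom_rel K (EnvRel.of (L := L) p q x y hx hy)
  simp only [map_sub, map_mul, map_smul] at h
  exact h.symm

theorem neg_one_smulL {K : Type*} [Field K] {N : ℕ} {L : SubSuperalgebra K N} (x : L.carrier) :
    (-1 : K) • x = -x := Subtype.ext (neg_one_smul K x.1)

/-- The parity involution `x ↦ (-1)^{|x|} x` of `L`. -/
def parL {K : Type*} [Field K] {N : ℕ} (L : SubSuperalgebra K N) : L.carrier →ₗ[K] L.carrier :=
  L.compL 0 - L.compL 1

theorem parL_of_homog {K : Type*} [Field K] {N : ℕ} (L : SubSuperalgebra K N) {p : ZMod 2}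
    {x : L.carrier} (hx : Homog p x.1) : parL L x = ((-1 : K) ^ p.val) • x := by
  rcases zmod2_cases p with rfl | rfl
  · simp [parL, L.compL_of_homog hx, L.compL_of_homog_ne hx (show (1 : ZMod 2) ≠ 0 by decide)]
  · rw [ZMod.val_one, pow_one, neg_one_smulL]
    simp [parL, L.compL_of_homog hx, L.compL_of_homog_ne hx (show (0 : ZMod 2) ≠ 1 by decide)]

/-- The parity involution of `U(L)`: the algebra automorphism extending that of `L`. -/
def envParity {K : Type*} [Field K] {N : ℕ} (L : SubSuperalgebra K N) : Env L →ₐ[K] Env L :=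
  RingQuot.liftAlgHom K ⟨TensorAlgebra.lift K (envι L ∘ₗ parL L), by
    rintro _ _ ⟨p, q, x, y, hx, hy⟩
    simp only [map_sub, map_mul, map_smul, TensorAlgebra.lift_ι_apply, LinearMap.comp_apply,
      parL_of_homog L hx, parL_of_homog L hy, parL_of_homog L (L.homog_br hx hy),
      envι_br L p q x y hx hy]
    rcases zmod2_cases p with rfl | rfl <;> rcases zmod2_cases q with rfl | rfl <;>
      simp [ksign, ZMod.val_one, show (1 : ZMod 2) + 1 = 0 from by decide]
    all_goals abel⟩

theorem envParity_ι {K : Type*} [Field K] {N : ℕ} (L : SubSuperalgebra K N) (x : L.carrier) :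
    envParity L (envι L x) = envι L (parL L x) := by
  have h : envParity L (envι L x) = TensorAlgebra.lift K (envι L ∘ₗ parL L)
      (TensorAlgebra.ι K x) := RingQuot.liftAlgHom_mkAlgHom_apply _ _ _ _
  rw [h, TensorAlgebra.lift_ι_apply, LinearMap.comp_apply]

theorem envParity_sq {K : Type*} [Field K] {N : ℕ} (L : SubSuperalgebra K N) :
    (envParity L).comp (envParity L) = AlgHom.id K (Env L) := by
  apply RingQuot.ringQuot_ext'
  ext x
  change envParity L (envParity L (envι L x)) = envι L x
  rw [envParity_ι, envParity_ι]
  congr 1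
  have h0 : Homog 0 (L.compL 0 x).1 := homog_comp 0 x.1
  have h1 : Homog 1 (L.compL 1 x).1 := homog_comp 1 x.1
  have hx : L.compL 0 x + L.compL 1 x = x := Subtype.ext (comp_zero_add_comp_one x.1)
  have e : parL L x = L.compL 0 x - L.compL 1 x := rfl
  rw [e, map_sub, parL_of_homog L h0, parL_of_homog L h1]
  rw [ZMod.val_one, pow_one, neg_one_smulL, ZMod.val_zero, pow_zero, one_smul, sub_neg_eq_add, hx]

/-- The relations `uβ ⊗ v = u ⊗ βv` (`u ∈ U(g)`, `β ∈ b`, `v ∈ V`) that cut out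
`U(g) ⊗_{U(b)} V` from `U(g) ⊗_K V`; recall that `U(b)` is generated by `b`. -/
def indRel {K : Type*} [Field K] {N : ℕ} {g b : SubSuperalgebra K N}
    (h : b.carrier ≤ g.carrier) {V : Type*} [AddCommGroup V] [Module K V] (τ : SuperRep b V) :
    Submodule K (Env g ⊗[K] V) :=
  Submodule.span K {w | ∃ (u : Env g) (β : b.carrier) (v : V),
    w = (u * envι g (Submodule.inclusion h β)) ⊗ₜ[K] v - u ⊗ₜ[K] (τ.act β v)}

/-- The space `U(g) ⊗_{U(b)} V`. -/
abbrev Ind {K : Type*} [Field K] {N : ℕ} {g b : SubSuperalgebra K N}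
    (h : b.carrier ≤ g.carrier) {V : Type*} [AddCommGroup V] [Module K V] (τ : SuperRep b V) :=
  (Env g ⊗[K] V) ⧸ indRel h τ

/-- Left multiplication by an element of `U(g)` on `U(g) ⊗_{U(b)} V`. -/
def indMul {K : Type*} [Field K] {N : ℕ} {g b : SubSuperalgebra K N}
    (h : b.carrier ≤ g.carrier) {V : Type*} [AddCommGroup V] [Module K V] (τ : SuperRep b V)
    (a : Env g) : Module.End K (Ind h τ) :=
  (indRel h τ).mapQ (indRel h τ) (TensorProduct.map (LinearMap.mulLeft K a) LinearMap.id) (by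
    unfold indRel
    rw [Submodule.span_le]
    rintro _ ⟨u, β, v, rfl⟩
    refine Submodule.subset_span ⟨a * u, β, v, ?_⟩
    simp [mul_assoc])

theorem ind_ext {K : Type*} [Field K] {N : ℕ} {g b : SubSuperalgebra K N}
    {h : b.carrier ≤ g.carrier} {V : Type*} [AddCommGroup V] [Module K V] {τ : SuperRep b V}
    {f f' : Module.End K (Ind h τ)}
    (H : ∀ u v, f ((indRel h τ).mkQ (u ⊗ₜ[K] v)) = f' ((indRel h τ).mkQ (u ⊗ₜ[K] v))) :
    f = f' := by
  apply Submodule.linearMap_qext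
  apply TensorProduct.ext'
  exact H

theorem indMul_mk {K : Type*} [Field K] {N : ℕ} {g b : SubSuperalgebra K N}
    (h : b.carrier ≤ g.carrier) {V : Type*} [AddCommGroup V] [Module K V] (τ : SuperRep b V)
    (a u : Env g) (v : V) :
    indMul h τ a ((indRel h τ).mkQ (u ⊗ₜ[K] v)) = (indRel h τ).mkQ ((a * u) ⊗ₜ[K] v) := by
  simp [indMul]

/-- The parity involution of `U(g) ⊗_{U(b)} V`, given by `|u ⊗ v| = |u| + |v|`. -/
def indParity {K : Type*} [Field K] {N : ℕ} {g b : SubSuperalgebra K N}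
    (h : b.carrier ≤ g.carrier) {V : Type*} [AddCommGroup V] [Module K V] (τ : SuperRep b V) :
    Module.End K (Ind h τ) :=
  (indRel h τ).mapQ (indRel h τ) (TensorProduct.map (envParity g).toLinearMap τ.parity) (by
    conv_lhs => unfold indRel
    rw [Submodule.span_le]
    rintro _ ⟨u, β, v, rfl⟩
    have key : ∀ (p : ZMod 2) (γ : b.carrier), Homog p γ.1 →
        TensorProduct.map (envParity g).toLinearMap τ.parity
          ((u * envι g (Submodule.inclusion h γ)) ⊗ₜ[K] v - u ⊗ₜ[K] (τ.act γ v))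
          ∈ indRel h τ := by
      intro p γ hγ
      have h1 : Homog p (Submodule.inclusion h γ).1 := hγ
      have h2 : τ.parity (τ.act γ v) = ((-1 : K) ^ p.val) • τ.act γ (τ.parity v) :=
        LinearMap.congr_fun (τ.act_parity p γ hγ) v
      have : TensorProduct.map (envParity g).toLinearMap τ.parity
          ((u * envι g (Submodule.inclusion h γ)) ⊗ₜ[K] v - u ⊗ₜ[K] (τ.act γ v))
          = ((-1 : K) ^ p.val) • ((envParity g u * envι g (Submodule.inclusion h γ)) ⊗ₜ[K]
              τ.parity v - envParity g u ⊗ₜ[K] (τ.act γ (τ.parity v))) := by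
        simp only [map_sub, TensorProduct.map_tmul, AlgHom.toLinearMap_apply, map_mul,
          envParity_ι, parL_of_homog g h1, h2, map_smul, mul_smul_comm, smul_sub,
          TensorProduct.smul_tmul', TensorProduct.tmul_smul]
      rw [this]
      exact Submodule.smul_mem _ _ (Submodule.subset_span ⟨_, γ, _, rfl⟩)
    have hβ : β = b.compL 0 β + b.compL 1 β := (Subtype.ext (comp_zero_add_comp_one β.1)).symm
    have k0 := key 0 (b.compL 0 β) (homog_comp 0 β.1)
    have k1 := key 1 (b.compL 1 β) (homog_comp 1 β.1)
    have k := Submodule.add_mem _ k0 k1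
    rw [← map_add] at k
    change TensorProduct.map (envParity g).toLinearMap τ.parity
      ((u * envι g (Submodule.inclusion h β)) ⊗ₜ[K] v - u ⊗ₜ[K] (τ.act β v)) ∈ indRel h τ
    convert k using 2
    conv_lhs => rw [hβ]
    simp only [map_add, mul_add, TensorProduct.add_tmul, LinearMap.add_apply,
      TensorProduct.tmul_add]
    abel)

theorem indParity_mk {K : Type*} [Field K] {N : ℕ} {g b : SubSuperalgebra K N}
    (h : b.carrier ≤ g.carrier) {V : Type*} [AddCommGroup V] [Module K V] (τ : SuperRep b V)
    (u : Env g) (v : V) :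
    indParity h τ ((indRel h τ).mkQ (u ⊗ₜ[K] v))
      = (indRel h τ).mkQ (envParity g u ⊗ₜ[K] τ.parity v) := by
  simp [indParity]

/-- The induced supermodule `U(g) ⊗_{U(b)} V`. -/
def indRep {K : Type*} [Field K] {N : ℕ} {g b : SubSuperalgebra K N}
    (h : b.carrier ≤ g.carrier) {V : Type*} [AddCommGroup V] [Module K V] (τ : SuperRep b V) :
    SuperRep g (Ind h τ) where
  parity := indParity h τ
  parity_sq := by
    apply ind_ext
    intro u v
    rw [Module.End.mul_apply, indParity_mk, indParity_mk]
    have h1 : envParity g (envParity g u) = u := DFunLike.congr_fun (envParity_sq g) u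
    have h2 : τ.parity (τ.parity v) = v := LinearMap.congr_fun τ.parity_sq v
    rw [h1, h2, Module.End.one_apply]
  act :=
    { toFun := fun x => indMul h τ (envι g x)
      map_add' := fun x y => by
        apply ind_ext
        intro u v
        simp only [LinearMap.add_apply, indMul_mk, map_add, add_mul, TensorProduct.add_tmul]
      map_smul' := fun c x => by
        apply ind_ext
        intro u v
        simp only [LinearMap.smul_apply, indMul_mk, map_smul, smul_mul_assoc,
          ← TensorProduct.smul_tmul', RingHom.id_apply] }
  act_parity p x hx := by
    apply ind_ext
    intro u v
    simp only [LinearMap.coe_mk, AddHom.coe_mk, Module.End.mul_apply, LinearMap.smul_apply,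
      indMul_mk, indParity_mk, map_mul, envParity_ι, parL_of_homog g hx, map_smul,
      smul_mul_assoc, ← TensorProduct.smul_tmul']
  act_br p q x y hx hy := by
    apply ind_ext
    intro u v
    simp only [LinearMap.coe_mk, AddHom.coe_mk, Module.End.mul_apply, LinearMap.smul_apply,
      LinearMap.sub_apply, indMul_mk, envι_br g p q x y hx hy, sub_mul, smul_mul_assoc, mul_assoc,
      TensorProduct.sub_tmul, ← TensorProduct.smul_tmul', map_sub, map_smul]

/-! ### The Lie superalgebras `g`, `b` and `h` -/

/-- The matrices of block form `(A B; B A)` such that `A` and `B` are supported on the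
relation `R`: the span of the `e_{r,s}`, `e'_{r,s}` with `R r s`. -/
def blockSpace (K : Type*) [Field K] {N : ℕ} (R : Fin N → Fin N → Prop) :
    Submodule K (Mat K N) where
  carrier := {x | (∀ r s, x (.inr r) (.inr s) = x (.inl r) (.inl s)) ∧
    (∀ r s, x (.inr r) (.inl s) = x (.inl r) (.inr s)) ∧
    ∀ i j, ¬ R (pos i) (pos j) → x i j = 0}
  add_mem' := by
    rintro x y ⟨h1, h2, h3⟩ ⟨k1, k2, k3⟩
    refine ⟨fun r s => ?_, fun r s => ?_, fun i j h => ?_⟩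
    · simp [h1, k1]
    · simp [h2, k2]
    · simp [h3 i j h, k3 i j h]
  zero_mem' := by simp
  smul_mem' := by
    rintro c x ⟨h1, h2, h3⟩
    refine ⟨fun r s => ?_, fun r s => ?_, fun i j h => ?_⟩
    · simp [h1]
    · simp [h2]
    · simp [h3 i j h]

theorem blockSpace_mul {K : Type*} [Field K] {N : ℕ} (R : Fin N → Fin N → Prop)
    (hR : ∀ r s t, R r s → R s t → R r t) {x y : Mat K N} (hx : x ∈ blockSpace K R)
    (hy : y ∈ blockSpace K R) : x * y ∈ blockSpace K R := by
  obtain ⟨h1, h2, h3⟩ := hx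
  obtain ⟨k1, k2, k3⟩ := hy
  refine ⟨fun r s => ?_, fun r s => ?_, fun i j h => ?_⟩
  · simp only [Matrix.mul_apply, Fintype.sum_sum_type, h1, h2, k1, k2]
    rw [add_comm]
  · simp only [Matrix.mul_apply, Fintype.sum_sum_type, h1, h2, k1, k2]
    rw [add_comm]
  · rw [Matrix.mul_apply]
    refine Finset.sum_eq_zero fun k _ => ?_
    by_cases h4 : R (pos i) (pos k)
    · rw [k3 k j fun h5 => h (hR _ _ _ h4 h5), mul_zero]
    · rw [h3 i k h4, zero_mul]

theorem ofRel_comp_mem {K : Type*} [Field K] {N : ℕ} (R : Fin N → Fin N → Prop) (p : ZMod 2)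
    (x : Mat K N) (hx : x ∈ blockSpace K R) : comp p x ∈ blockSpace K R := by
  obtain ⟨h1, h2, h3⟩ := hx
  refine ⟨fun r s => ?_, fun r s => ?_, fun i j h => ?_⟩
  · simp [comp_apply, par, h1, show (1 : ZMod 2) + 1 = 0 from by decide]
  · simp [comp_apply, par, h2]
  · simp [comp_apply, h3 i j h]

/-- The Lie superalgebra spanned by the `e_{r,s}`, `e'_{r,s}` with `R r s`, for a transitive
relation `R`. -/
def ofRel (K : Type*) [Field K] {N : ℕ} (R : Fin N → Fin N → Prop)
    (hR : ∀ r s t, R r s → R s t → R r t) : SubSuperalgebra K N where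
  carrier := blockSpace K R
  comp_mem := ofRel_comp_mem R
  sbr_mem := fun x y hx hy => by
    unfold sbr
    refine Submodule.sum_mem _ fun p _ => Submodule.sum_mem _ fun q _ => ?_
    have hx' := ofRel_comp_mem R p x hx
    have hy' := ofRel_comp_mem R q y hy
    exact Submodule.sub_mem _ (blockSpace_mul R hR hx' hy')
      (Submodule.smul_mem _ _ (blockSpace_mul R hR hy' hx'))

/-- `m = ⌈n/2⌉`, so that `n = 2m` or `n = 2m - 1`. -/
def halfUp (n : ℕ) : ℕ := (n + 1) / 2

theorem le_two_halfUp (n : ℕ) : n ≤ 2 * halfUp n := by unfold halfUp; omega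

/-- Pairs `(r,s)` with `r, s ≤ n` or `r = s`. If `n` is odd, the only such pair with `r > n` or
`s > n` is `(2m, 2m)`. -/
def gRel (n : ℕ) (r s : Fin (2 * halfUp n)) : Prop := (r.1 < n ∧ s.1 < n) ∨ r = s

/-- The Lie superalgebra `g`: it is `q_n(K)` if `n` is even, and `q_n(K) ⊕ q_1(K)` if `n` is
odd, realized inside `gl(2m|2m)`. -/
def gAlg (K : Type*) [Field K] (n : ℕ) : SubSuperalgebra K (2 * halfUp n) :=
  ofRel K (gRel n) (by
    rintro r s t (⟨h1, h2⟩ | rfl) (⟨h3, h4⟩ | rfl)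
    · exact .inl ⟨h1, h4⟩
    · exact .inl ⟨h1, h2⟩
    · exact .inl ⟨h3, h4⟩
    · exact .inr rfl)

/-- The Borel subalgebra `b` of `g` (upper triangular matrices). -/
def bAlg (K : Type*) [Field K] (n : ℕ) : SubSuperalgebra K (2 * halfUp n) :=
  ofRel K (fun r s => gRel n r s ∧ r ≤ s) (by
    rintro r s t ⟨(⟨h1, h2⟩ | rfl), h5⟩ ⟨(⟨h3, h4⟩ | rfl), h6⟩
    · exact ⟨.inl ⟨h1, h4⟩, h5.trans h6⟩
    · exact ⟨.inl ⟨h1, h2⟩, h5⟩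
    · exact ⟨.inl ⟨h3, h4⟩, h6⟩
    · exact ⟨.inr rfl, le_rfl⟩)

/-- The Cartan subalgebra `h` of `g` (diagonal matrices). -/
def hAlg (K : Type*) [Field K] (n : ℕ) : SubSuperalgebra K (2 * halfUp n) :=
  ofRel K (fun r s => r = s) (fun _ _ _ h h' => h.trans h')

theorem bAlg_le (K : Type*) [Field K] (n : ℕ) : (bAlg K n).carrier ≤ (gAlg K n).carrier :=
  fun _ hx => ⟨hx.1, hx.2.1, fun i j h => hx.2.2 i j fun h' => h h'.1⟩

/-- A homomorphism of Lie superalgebras. -/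
structure SuperHom {K : Type*} [Field K] {N : ℕ} (L L' : SubSuperalgebra K N) where
  toLin : L.carrier →ₗ[K] L'.carrier
  homog : ∀ (p : ZMod 2) (x : L.carrier), Homog p x.1 → Homog p (toLin x).1
  map_br : ∀ x y : L.carrier, toLin (L.br x y) = L'.br (toLin x) (toLin y)

/-- Pulling back a supermodule along a homomorphism. -/
def SuperRep.comap {K : Type*} [Field K] {N : ℕ} {L L' : SubSuperalgebra K N} {M : Type*}
    [AddCommGroup M] [Module K M] (ρ : SuperRep L' M) (f : SuperHom L L') : SuperRep L M where
  parity := ρ.parity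
  parity_sq := ρ.parity_sq
  act := ρ.act ∘ₗ f.toLin
  act_parity p x hx := ρ.act_parity p (f.toLin x) (f.homog p x hx)
  act_br p q x y hx hy := by
    rw [LinearMap.comp_apply, f.map_br]
    exact ρ.act_br p q _ _ (f.homog p x hx) (f.homog q y hy)

/-- The entries of a matrix in positions `(r,r)` of each of the four blocks. -/
def diagMat {K : Type*} [Field K] {N : ℕ} : Mat K N →ₗ[K] Mat K N where
  toFun x := Matrix.of fun i j => if pos i = pos j then x i j else 0
  map_add' x y := by ext i j; by_cases h : pos i = pos j <;> simp [h]
  map_smul' c x := by ext i j; by_cases h : pos i = pos j <;> simp [h]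

theorem diagMat_apply {K : Type*} [Field K] {N : ℕ} (x : Mat K N) (i j : Idx N) :
    diagMat x i j = if pos i = pos j then x i j else 0 := rfl

theorem diagMat_comp {K : Type*} [Field K] {N : ℕ} (p : ZMod 2) (x : Mat K N) :
    diagMat (comp p x) = comp p (diagMat x) := by
  ext i j
  simp only [diagMat_apply, comp_apply]
  split_ifs <;> rfl

theorem diagMat_mem {K : Type*} [Field K] (n : ℕ) (x : Mat K (2 * halfUp n))
    (hx : x ∈ (bAlg K n).carrier) : diagMat x ∈ (hAlg K n).carrier := by
  obtain ⟨h1, h2, h3⟩ := hx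
  refine ⟨fun r s => ?_, fun r s => ?_, fun i j h => ?_⟩
  · rw [diagMat_apply, diagMat_apply, h1]; rfl
  · rw [diagMat_apply, diagMat_apply, h2]; rfl
  · simp [diagMat_apply, h]

theorem diagMat_mul {K : Type*} [Field K] (n : ℕ) {x y : Mat K (2 * halfUp n)}
    (hx : x ∈ (bAlg K n).carrier) (hy : y ∈ (bAlg K n).carrier) :
    diagMat (x * y) = diagMat x * diagMat y := by
  ext i j
  rw [diagMat_apply, Matrix.mul_apply, Matrix.mul_apply]
  by_cases h : pos i = pos j
  · rw [if_pos h]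
    refine Finset.sum_congr rfl fun k _ => ?_
    rw [diagMat_apply, diagMat_apply]
    by_cases h1 : pos i = pos k
    · rw [if_pos h1, if_pos (h1.symm.trans h)]
    · rw [if_neg h1, zero_mul]
      by_cases h2 : pos i ≤ pos k
      · rw [hy.2.2 k j fun h3 => h1 (le_antisymm h2 (h ▸ h3.2)), mul_zero]
      · rw [hx.2.2 i k fun h3 => h2 h3.2, zero_mul]
  · rw [if_neg h]
    refine (Finset.sum_eq_zero fun k _ => ?_).symm
    rw [diagMat_apply, diagMat_apply]
    by_cases h1 : pos i = pos k
    · rw [if_neg (fun h2 => h (h1.trans h2)), mul_zero]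
    · rw [if_neg h1, zero_mul]

/-- The projection of `b` onto `h`, killing all `e_{r,s}`, `e'_{r,s}` with `r < s`. -/
def bToH (K : Type*) [Field K] (n : ℕ) : SuperHom (bAlg K n) (hAlg K n) where
  toLin := diagMat.restrict (diagMat_mem n)
  homog p x hx i j h := by
    change (if pos i = pos j then x.1 i j else 0) = 0
    rw [hx i j h, ite_self]
  map_br x y := by
    refine Subtype.ext ?_
    change diagMat (sbr x.1 y.1) = sbr (diagMat x.1) (diagMat y.1)
    have hx : ∀ p, comp p x.1 ∈ (bAlg K n).carrier := fun p => (bAlg K n).comp_mem p x.1 x.2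
    have hy : ∀ p, comp p y.1 ∈ (bAlg K n).carrier := fun p => (bAlg K n).comp_mem p y.1 y.2
    simp only [sbr, map_sum, map_sub, map_smul, diagMat_mul n (hx _) (hy _),
      diagMat_mul n (hy _) (hx _), diagMat_comp]

/-! ### The `h`-supermodules `V(b)` and Verma supermodules -/

/-- The choices on which everything depends: a sign sequence `σ`, a scalar `z` with `2z ∉ ℤ`, a
square root of `-1`, and square roots of all `z + i`, `i ∈ ℤ`. -/
structure Choices (K : Type*) [Field K] (n : ℕ) where
  sigma : Fin n → ℤˣ
  z : K
  two_z : ∀ k : ℤ, 2 * z ≠ (k : K)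
  imag : K
  imag_sq : imag * imag = -1
  root : ℤ → K
  root_sq : ∀ i : ℤ, root i * root i = z + (i : K)

/-- The scalars `λ_{b,r} = σ_r (z + b_r)` for `1 ≤ r ≤ n`; moreover `λ_{b,2m} = 1` if `n` is
odd. -/
def Choices.wt {K : Type*} [Field K] {n : ℕ} (C : Choices K n) (b : Fin n → ℤ)
    (r : Fin (2 * halfUp n)) : K :=
  if h : r.1 < n then ((C.sigma ⟨r.1, h⟩ : ℤ) : K) * (C.z + (b ⟨r.1, h⟩ : K)) else 1

/-- The square roots `√λ_{b,r}`, where `√(-(z+i)) = (-1)^i √(-1) √(z+i)`, and `√1 = 1`. -/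
def Choices.wtRoot {K : Type*} [Field K] {n : ℕ} (C : Choices K n) (b : Fin n → ℤ)
    (r : Fin (2 * halfUp n)) : K :=
  if h : r.1 < n then
    if C.sigma ⟨r.1, h⟩ = 1 then C.root (b ⟨r.1, h⟩)
    else (-1 : K) ^ (b ⟨r.1, h⟩) * C.imag * C.root (b ⟨r.1, h⟩)
  else 1

theorem Choices.wtRoot_sq {K : Type*} [Field K] {n : ℕ} (C : Choices K n) (b : Fin n → ℤ)
    (r : Fin (2 * halfUp n)) : C.wtRoot b r * C.wtRoot b r = C.wt b r := by
  unfold wtRoot wt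
  split_ifs with h h'
  · simp [h', C.root_sq]
  · have h2 := (Int.units_eq_one_or (C.sigma ⟨r.1, h⟩)).resolve_left h'
    have h3 : (-1 : K) ^ (b ⟨r.1, h⟩) * (-1 : K) ^ (b ⟨r.1, h⟩) = 1 := by
      rw [← mul_zpow]; simp
    rw [h2]
    have h4 := C.root_sq (b ⟨r.1, h⟩)
    have h5 := C.imag_sq
    push_cast
    linear_combination (C.imag * C.imag * C.root (b ⟨r.1, h⟩) * C.root (b ⟨r.1, h⟩)) * h3
      + C.root (b ⟨r.1, h⟩) * C.root (b ⟨r.1, h⟩) * h5 - h4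
  · simp

/-- Parity involution of the irreducible `C_2`-supermodule with even basis vector `v` and odd
basis vector `v'`. -/
def cliffParity (K : Type*) [Field K] : Module.End K (Fin 2 → K) :=
  Matrix.toLin' !![1, 0; 0, -1]

/-- The Clifford generators `c_1` (index `0`) and `c_2` (index `1`) on that supermodule:
`c_1 v = v'`, `c_1 v' = v`, `c_2 v = √-1 v'`, `c_2 v' = -√-1 v`. -/
def cliffGen {K : Type*} [Field K] (imag : K) (k : ℕ) : Module.End K (Fin 2 → K) :=
  if k = 0 then Matrix.toLin' !![0, 1; 1, 0] else Matrix.toLin' !![0, -imag; imag, 0]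

/-- The underlying space `V ⊗ ⋯ ⊗ V` (`m` factors) of all the `V(b)`. -/
def VSpace (K : Type*) [Field K] (n : ℕ) :=
  PiTensorProduct K fun _ : Fin (halfUp n) => (Fin 2 → K)

instance (K : Type*) [Field K] (n : ℕ) : AddCommGroup (VSpace K n) :=
  inferInstanceAs (AddCommGroup (PiTensorProduct K fun _ : Fin (halfUp n) => (Fin 2 → K)))

instance (K : Type*) [Field K] (n : ℕ) : Module K (VSpace K n) :=
  inferInstanceAs (Module K (PiTensorProduct K fun _ : Fin (halfUp n) => (Fin 2 → K)))

/-- The operator `f_1 ⊗ ⋯ ⊗ f_m` on `V ⊗ ⋯ ⊗ V` (without signs). -/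
def piOp {K : Type*} [Field K] {n : ℕ} (f : Fin (halfUp n) → Module.End K (Fin 2 → K)) :
    Module.End K (VSpace K n) :=
  PiTensorProduct.map f

theorem piOp_mul {K : Type*} [Field K] {n : ℕ} (f g : Fin (halfUp n) → Module.End K (Fin 2 → K)) :
    (piOp (n := n) fun i => f i * g i) = piOp f * piOp g :=
  PiTensorProduct.map_mul f g

theorem piOp_one {K : Type*} [Field K] {n : ℕ} :
    (piOp (n := n) fun _ => (1 : Module.End K (Fin 2 → K))) = 1 :=
  PiTensorProduct.map_one

/-- The operator `id ⊗ ⋯ ⊗ c ⊗ ⋯ ⊗ id` on `V ⊗ ⋯ ⊗ V` with the odd operator `c` in position `s`;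
by the sign rule it involves the parity involution in all earlier positions. For `r` running
from `0`, the `r`th generator has `s = r / 2`, and `c = c_1` or `c_2` as `r` is even or odd. -/
def cliffOp {K : Type*} [Field K] {n : ℕ} (imag : K) (r : Fin (2 * halfUp n)) :
    Module.End K (VSpace K n) :=
  piOp fun i =>
    if i.1 < r.1 / 2 then cliffParity K
    else if i.1 = r.1 / 2 then cliffGen imag (r.1 % 2) else 1

/-- The action of `h` on `V(b)`: `d_r` acts by `λ_{b,r}`, and `d_r'` by `√λ_{b,r}` times the
`r`th Clifford generator. -/
def hAct {K : Type*} [Field K] {n : ℕ} (C : Choices K n) (b : Fin n → ℤ) :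
    (hAlg K n).carrier →ₗ[K] Module.End K (VSpace K n) where
  toFun x := ∑ r, (x.1 (.inl r) (.inl r) • C.wt b r • (1 : Module.End K (VSpace K n))
    + x.1 (.inl r) (.inr r) • C.wtRoot b r • cliffOp C.imag r)
  map_add' x y := by
    rw [← Finset.sum_add_distrib]
    refine Finset.sum_congr rfl fun r _ => ?_
    simp only [Submodule.coe_add, Matrix.add_apply, add_smul]
    abel
  map_smul' c x := by
    rw [Finset.smul_sum]
    refine Finset.sum_congr rfl fun r _ => ?_
    simp only [Submodule.coe_smul, Matrix.smul_apply, smul_eq_mul, mul_smul, smul_add,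
      RingHom.id_apply]

theorem toLin'_one_end {K : Type*} [Field K] {ι : Type*} [Fintype ι] [DecidableEq ι] :
    Matrix.toLin' (1 : Matrix ι ι K) = (1 : Module.End K (ι → K)) := Matrix.toLin'_one

theorem cliffParity_sq (K : Type*) [Field K] : cliffParity K * cliffParity K = 1 := by
  rw [cliffParity, Module.End.mul_eq_comp, ← Matrix.toLin'_mul, ← toLin'_one_end]
  congr 1
  ext i j; fin_cases i <;> fin_cases j <;> simp

theorem cliffParity_gen {K : Type*} [Field K] (imag : K) (k : ℕ) :
    cliffParity K * cliffGen imag k = (-1 : K) • (cliffGen imag k * cliffParity K) := by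
  unfold cliffParity cliffGen
  split_ifs <;>
  · rw [Module.End.mul_eq_comp, Module.End.mul_eq_comp, ← Matrix.toLin'_mul, ← Matrix.toLin'_mul,
      ← map_smul]
    congr 1
    ext i j; fin_cases i <;> fin_cases j <;> simp

theorem cliffGen_sq {K : Type*} [Field K] {imag : K} (h : imag * imag = -1) (k : ℕ) :
    cliffGen imag k * cliffGen imag k = 1 := by
  unfold cliffGen
  split_ifs <;>
  · rw [Module.End.mul_eq_comp, ← Matrix.toLin'_mul, ← toLin'_one_end]
    congr 1
    ext i j; fin_cases i <;> fin_cases j <;> simp [h]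

theorem cliffGen_anti {K : Type*} [Field K] (imag : K) :
    cliffGen imag 0 * cliffGen imag 1 = (-1 : K) • (cliffGen imag 1 * cliffGen imag 0) := by
  unfold cliffGen
  rw [if_pos rfl, if_neg one_ne_zero, Module.End.mul_eq_comp, Module.End.mul_eq_comp,
    ← Matrix.toLin'_mul, ← Matrix.toLin'_mul, ← map_smul]
  congr 1
  ext i j; fin_cases i <;> fin_cases j <;> simp

/-- Two tensor products of operators that differ by a sign in exactly one position. -/
theorem piOp_neg {K : Type*} [Field K] {n : ℕ} {f g : Fin (halfUp n) → Module.End K (Fin 2 → K)}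
    (k : Fin (halfUp n)) (hk : f k = (-1 : K) • g k) (h : ∀ i, i ≠ k → f i = g i) :
    piOp (n := n) f = (-1 : K) • piOp g := by
  have : f = Function.update g k ((-1 : K) • g k) := by
    funext i
    by_cases hi : i = k
    · subst hi; simp [hk]
    · simp [hi, h i hi]
  have h2 := PiTensorProduct.map_update_smul (R := K) g k (-1 : K) (g k)
  rw [Function.update_eq_self] at h2
  rw [this]
  exact h2

theorem cliffOp_sq {K : Type*} [Field K] {n : ℕ} {imag : K} (h : imag * imag = -1)
    (r : Fin (2 * halfUp n)) : cliffOp imag r * cliffOp (n := n) imag r = 1 := by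
  unfold cliffOp
  rw [← piOp_mul, ← piOp_one]
  congr 1
  funext i
  split_ifs
  · exact cliffParity_sq K
  · exact cliffGen_sq h _
  · exact one_mul 1

theorem cliffOp_parity {K : Type*} [Field K] {n : ℕ} (imag : K) (r : Fin (2 * halfUp n)) :
    (piOp fun _ => cliffParity K) * cliffOp (n := n) imag r
      = (-1 : K) • (cliffOp imag r * piOp fun _ => cliffParity K) := by
  unfold cliffOp
  rw [← piOp_mul, ← piOp_mul]
  refine piOp_neg ⟨r.1 / 2, by omega⟩ ?_ fun i hi => ?_
  · simpa using cliffParity_gen imag _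
  · have hi' : i.1 ≠ r.1 / 2 := fun h => hi (Fin.ext h)
    rw [if_neg hi']
    split_ifs
    · rfl
    · rw [mul_one, one_mul]

theorem cliffOp_anti {K : Type*} [Field K] {n : ℕ} (imag : K) {r s : Fin (2 * halfUp n)}
    (hrs : r < s) : cliffOp (n := n) imag r * cliffOp imag s
      = (-1 : K) • (cliffOp imag s * cliffOp imag r) := by
  have hrs' : r.1 < s.1 := hrs
  unfold cliffOp
  rw [← piOp_mul, ← piOp_mul]
  refine piOp_neg ⟨r.1 / 2, by omega⟩ ?_ fun i hi => ?_
  · by_cases h : r.1 / 2 < s.1 / 2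
    · simp only [lt_self_iff_false, if_false, if_true, h]
      rw [cliffParity_gen, smul_smul]
      simp
    · have h1 : s.1 / 2 = r.1 / 2 := by omega
      have h2 : r.1 % 2 = 0 := by omega
      have h3 : s.1 % 2 = 1 := by omega
      simp only [h1, h2, h3, lt_self_iff_false, if_false, if_true]
      exact cliffGen_anti imag
  · have hi' : i.1 ≠ r.1 / 2 := fun h => hi (Fin.ext h)
    rw [if_neg hi']
    by_cases h1 : i.1 < r.1 / 2
    · have h2 : i.1 < s.1 / 2 := by omega
      rw [if_pos h1, if_pos h2]
    · rw [if_neg h1, mul_one, one_mul]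

theorem hAct_apply {K : Type*} [Field K] {n : ℕ} (C : Choices K n) (b : Fin n → ℤ)
    (x : (hAlg K n).carrier) :
    hAct C b x = ∑ r, (x.1 (.inl r) (.inl r) • C.wt b r • (1 : Module.End K (VSpace K n))
      + x.1 (.inl r) (.inr r) • C.wtRoot b r • cliffOp C.imag r) := rfl

theorem hAct_even {K : Type*} [Field K] {n : ℕ} (C : Choices K n) (b : Fin n → ℤ)
    {x : (hAlg K n).carrier} (hx : Homog 0 x.1) :
    hAct C b x = (∑ r, x.1 (.inl r) (.inl r) * C.wt b r) • (1 : Module.End K (VSpace K n)) := by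
  rw [Finset.sum_smul, hAct_apply]
  refine Finset.sum_congr rfl fun r _ => ?_
  rw [hx (.inl r) (.inr r) (by simp [par]), zero_smul, add_zero, smul_smul]

theorem hAct_odd {K : Type*} [Field K] {n : ℕ} (C : Choices K n) (b : Fin n → ℤ)
    {x : (hAlg K n).carrier} (hx : Homog 1 x.1) :
    hAct C b x = ∑ r, (x.1 (.inl r) (.inr r) * C.wtRoot b r) • cliffOp C.imag r := by
  rw [hAct_apply]
  refine Finset.sum_congr rfl fun r _ => ?_
  rw [hx (.inl r) (.inl r) (by simp [par]), zero_smul, zero_add, smul_smul]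

theorem hAlg_off {K : Type*} [Field K] {n : ℕ} (x : (hAlg K n).carrier)
    {i j : Idx (2 * halfUp n)} (h : pos i ≠ pos j) : x.1 i j = 0 := x.2.2.2 i j h

theorem hAlg_mul {K : Type*} [Field K] {n : ℕ} (x y : (hAlg K n).carrier)
    (r : Fin (2 * halfUp n)) (j : Idx (2 * halfUp n)) : (x.1 * y.1) (.inl r) j
      = x.1 (.inl r) (.inl r) * y.1 (.inl r) j + x.1 (.inl r) (.inr r) * y.1 (.inr r) j := by
  rw [Matrix.mul_apply, Fintype.sum_sum_type]
  congr 1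
  · refine Finset.sum_eq_single _ (fun k _ hk => ?_) (by simp)
    rw [hAlg_off x (show pos (Sum.inl r) ≠ pos (Sum.inl k) from fun h => hk h.symm), zero_mul]
  · refine Finset.sum_eq_single _ (fun k _ hk => ?_) (by simp)
    rw [hAlg_off x (show pos (Sum.inl r) ≠ pos (Sum.inr k) from fun h => hk h.symm), zero_mul]

/-- The irreducible `h`-supermodule `V(b)`. -/
def hRep {K : Type*} [Field K] {n : ℕ} (C : Choices K n) (b : Fin n → ℤ) :
    SuperRep (hAlg K n) (VSpace K n) where
  parity := piOp fun _ => cliffParity K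
  parity_sq := by
    rw [← piOp_mul, ← piOp_one]
    congr 1
    funext i
    exact cliffParity_sq K
  act := hAct C b
  act_parity p x hx := by
    rcases zmod2_cases p with rfl | rfl
    · rw [hAct_even C b hx, ZMod.val_zero, pow_zero, one_smul, mul_smul_comm, smul_mul_assoc,
        one_mul, mul_one]
    · rw [hAct_odd C b hx, ZMod.val_one, pow_one, Finset.mul_sum, Finset.sum_mul, Finset.smul_sum]
      refine Finset.sum_congr rfl fun r _ => ?_
      rw [mul_smul_comm, cliffOp_parity, smul_mul_assoc, smul_comm]
  act_br p q x y hx hy := by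
    have hbr : ((hAlg K n).br x y).1 = _ := sbr_of_homog hx hy
    have hpq := (hAlg K n).homog_br hx hy
    rcases zmod2_cases p with rfl | rfl <;> rcases zmod2_cases q with rfl | rfl
    · rw [hAct_even C b hx, hAct_even C b hy, hAct_even C b hpq, hbr]
      simp only [smul_mul_smul_comm, one_mul, ksign, ZMod.val_zero, mul_zero, pow_zero, one_smul]
      rw [mul_comm (∑ r, y.1 (.inl r) (.inl r) * C.wt b r), sub_self]
      convert zero_smul K _
      refine Finset.sum_eq_zero fun r _ => ?_
      rw [Matrix.sub_apply, hAlg_mul x y, hAlg_mul y x, hx (.inl r) (.inr r) (by simp [par]),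
        hy (.inl r) (.inr r) (by simp [par])]
      ring
    · rw [hAct_even C b hx, hAct_odd C b hy, hAct_odd C b hpq, hbr]
      simp only [smul_mul_assoc, mul_smul_comm, one_mul, mul_one, ksign, ZMod.val_zero, zero_mul,
        pow_zero, one_smul, sub_self]
      refine Finset.sum_eq_zero fun r _ => ?_
      rw [Matrix.sub_apply, hAlg_mul x y, hAlg_mul y x, hx (.inl r) (.inr r) (by simp [par]),
        hy (.inl r) (.inl r) (by simp [par]), x.2.1]
      simp [mul_comm]
    · rw [hAct_odd C b hx, hAct_even C b hy, hAct_odd C b hpq, hbr]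
      simp only [smul_mul_assoc, mul_smul_comm, one_mul, mul_one, ksign, ZMod.val_zero, mul_zero,
        pow_zero, one_smul, sub_self]
      refine Finset.sum_eq_zero fun r _ => ?_
      rw [Matrix.sub_apply, hAlg_mul x y, hAlg_mul y x, hx (.inl r) (.inl r) (by simp [par]),
        hy (.inl r) (.inr r) (by simp [par]), y.2.1]
      simp [mul_comm]
    · have hk : ksign K 1 1 = -1 := by simp [ksign, ZMod.val_one]
      rw [hAct_odd C b hx, hAct_odd C b hy, hAct_even C b hpq, hbr, hk]
      rw [Finset.sum_mul_sum, Finset.sum_mul_sum, Finset.sum_comm (s := Finset.univ)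
        (f := fun i j => (y.1 (.inl i) (.inr i) * C.wtRoot b i) • cliffOp C.imag i *
          (x.1 (.inl j) (.inr j) * C.wtRoot b j) • cliffOp C.imag j), Finset.smul_sum,
        ← Finset.sum_sub_distrib, Finset.sum_smul]
      refine Finset.sum_congr rfl fun r _ => ?_
      rw [Finset.smul_sum, ← Finset.sum_sub_distrib, Finset.sum_eq_single r]
      · rw [Matrix.sub_apply, Matrix.smul_apply, hAlg_mul x y, hAlg_mul y x,
          hx (.inl r) (.inl r) (by simp [par]), hy (.inl r) (.inl r) (by simp [par]),
          x.2.2.1, y.2.2.1, smul_mul_smul_comm, smul_mul_smul_comm,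
          cliffOp_sq C.imag_sq, smul_smul, ← sub_smul, ← C.wtRoot_sq b r]
        congr 1
        rw [smul_eq_mul]
        ring
      · intro s _ hs
        rw [smul_mul_smul_comm, smul_mul_smul_comm, smul_smul]
        rcases lt_or_gt_of_ne hs with h | h
        · rw [cliffOp_anti C.imag h, smul_smul, ← sub_smul]
          convert zero_smul K _
          ring
        · rw [cliffOp_anti C.imag h, smul_smul, ← sub_smul]
          convert zero_smul K _
          ring
      · simp

/-- `V(b)` as a `b`-supermodule, by inflation along the projection of `b` onto `h`. -/
def bRep {K : Type*} [Field K] {n : ℕ} (C : Choices K n) (b : Fin n → ℤ) :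
    SuperRep (bAlg K n) (VSpace K n) :=
  (hRep C b).comap (bToH K n)

/-- The space of the Verma supermodule `M(b)`. -/
abbrev VermaSpace {K : Type*} [Field K] {n : ℕ} (C : Choices K n) (b : Fin n → ℤ) :=
  Ind (bAlg_le K n) (bRep C b)

/-- The Verma supermodule `M(b) = U(g) ⊗_{U(b)} V(b)`. -/
def verma {K : Type*} [Field K] {n : ℕ} (C : Choices K n) (b : Fin n → ℤ) :
    SuperRep (gAlg K n) (VermaSpace C b) :=
  indRep (bAlg_le K n) (bRep C b)

/-! ### The supermodules `U`, `U*` and the endomorphisms `x`, `x*` -/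

/-- The space `U` with basis `u_1, …, u_n, u_1', …, u_n'`. -/
abbrev USpace (K : Type*) [Field K] (n : ℕ) := Idx n → K

/-- The space `U*`, the dual of `U`. -/
def UDual (K : Type*) [Field K] (n : ℕ) := Module.Dual K (USpace K n)

instance (K : Type*) [Field K] (n : ℕ) : AddCommGroup (UDual K n) :=
  inferInstanceAs (AddCommGroup (Module.Dual K (USpace K n)))

instance (K : Type*) [Field K] (n : ℕ) : Module K (UDual K n) :=
  inferInstanceAs (Module K (Module.Dual K (USpace K n)))

/-- The endomorphism `φ ↦ φ ∘ f` of `U*`. -/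
def transU {K : Type*} [Field K] {n : ℕ} : Module.End K (USpace K n) →ₗ[K]
    Module.End K (UDual K n) where
  toFun f :=
    { toFun := fun φ => LinearMap.comp (φ : Module.Dual K (USpace K n)) f
      map_add' := fun _ _ => rfl
      map_smul' := fun _ _ => rfl }
  map_add' f g := LinearMap.ext fun φ =>
    LinearMap.comp_add f g (φ : Module.Dual K (USpace K n))
  map_smul' c f := LinearMap.ext fun φ =>
    LinearMap.comp_smul (φ : Module.Dual K (USpace K n)) c f

theorem transU_mul {K : Type*} [Field K] {n : ℕ} (f g : Module.End K (USpace K n)) :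
    transU (f * g) = transU g * transU f := rfl

theorem transU_one {K : Type*} [Field K] {n : ℕ} :
    transU (1 : Module.End K (USpace K n)) = 1 := rfl

/-- The inclusion of the basis of `U` into the basis `u_1, …, u_{2m}, u_1', …, u_{2m}'`. -/
def embU (n : ℕ) : Idx n → Idx (2 * halfUp n) :=
  Sum.map (Fin.castLE (le_two_halfUp n)) (Fin.castLE (le_two_halfUp n))

/-- Parity involution of `U`. -/
def parU (K : Type*) [Field K] (n : ℕ) : Module.End K (USpace K n) :=
  Matrix.toLin' (Matrix.diagonal fun i => (-1 : K) ^ (par i).val)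

/-- The action on `U` of the elements of `gl(2m|2m)` that preserve it
(in general, this is the compression to `U` of the action on the natural supermodule). -/
def actU (K : Type*) [Field K] (n : ℕ) : Mat K (2 * halfUp n) →ₗ[K] Module.End K (USpace K n) where
  toFun x := Matrix.toLin' (x.submatrix (embU n) (embU n))
  map_add' x y := by rw [Matrix.submatrix_add, Pi.add_apply, Pi.add_apply, map_add]
  map_smul' c x := by
    rw [Matrix.submatrix_smul, Pi.smul_apply, Pi.smul_apply, map_smul, RingHom.id_apply]

/-- Parity involution of `U*`. -/
def parUDual (K : Type*) [Field K] (n : ℕ) : Module.End K (UDual K n) := transU (parU K n)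

/-- The dual action: `(xφ)(u) = -(-1)^{|x||φ|} φ(xu)`. -/
def actUDual (K : Type*) [Field K] (n : ℕ) :
    Mat K (2 * halfUp n) →ₗ[K] Module.End K (UDual K n) where
  toFun x := -transU (actU K n (comp 0 x)) - transU (actU K n (comp 1 x)) * parUDual K n
  map_add' x y := by
    simp only [map_add, add_mul]
    abel
  map_smul' c x := by
    simp only [map_smul, smul_mul_assoc, smul_sub, smul_neg, RingHom.id_apply]

theorem parU_sq (K : Type*) [Field K] (n : ℕ) : parU K n * parU K n = 1 := by
  rw [parU, Module.End.mul_eq_comp, ← Matrix.toLin'_mul, Matrix.diagonal_mul_diagonal]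
  rw [← toLin'_one_end]
  congr 1
  rw [← Matrix.diagonal_one]
  congr 1
  funext i
  rw [← mul_pow]
  simp

theorem parUDual_sq (K : Type*) [Field K] (n : ℕ) : parUDual K n * parUDual K n = 1 := by
  rw [parUDual, ← transU_mul, parU_sq, transU_one]

theorem par_embU {n : ℕ} (i : Idx n) : par (embU n i) = par i := by
  rcases i with i | i <;> rfl

theorem parU_actU {K : Type*} [Field K] {n : ℕ} {p : ZMod 2} {x : Mat K (2 * halfUp n)}
    (hx : Homog p x) :
    parU K n * actU K n x = ((-1 : K) ^ p.val) • (actU K n x * parU K n) := by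
  change Matrix.toLin' _ ∘ₗ Matrix.toLin' _ = _ • (Matrix.toLin' _ ∘ₗ Matrix.toLin' _)
  rw [← Matrix.toLin'_mul, ← Matrix.toLin'_mul, ← map_smul]
  congr 1
  ext i j
  rw [Matrix.diagonal_mul, Matrix.smul_apply, Matrix.mul_diagonal, Matrix.submatrix_apply]
  by_cases h : par i + par j = p
  · subst h
    rcases zmod2_cases (par i) with h1 | h1 <;> rcases zmod2_cases (par j) with h2 | h2 <;>
      simp [h1, h2, ZMod.val_one, show (1 : ZMod 2) + 1 = 0 from by decide]
  · rw [hx _ _ (by rwa [par_embU, par_embU])]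
    simp

theorem embU_injective (n : ℕ) : Function.Injective (embU n) :=
  Function.Injective.sumMap (Fin.castLE_injective _) (Fin.castLE_injective _)

theorem mem_range_embU {n : ℕ} {k : Idx (2 * halfUp n)} (h : (pos k).1 < n) :
    k ∈ Set.range (embU n) := by
  rcases k with k | k
  · exact ⟨.inl ⟨k.1, h⟩, rfl⟩
  · exact ⟨.inr ⟨k.1, h⟩, rfl⟩

theorem pos_embU_lt {n : ℕ} (i : Idx n) : (pos (embU n i)).1 < n := by
  rcases i with i | i <;> exact i.2

theorem actU_mul {K : Type*} [Field K] {n : ℕ} {x : Mat K (2 * halfUp n)}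
    (hx : x ∈ (gAlg K n).carrier) (y : Mat K (2 * halfUp n)) :
    actU K n (x * y) = actU K n x * actU K n y := by
  change Matrix.toLin' _ = Matrix.toLin' _ ∘ₗ Matrix.toLin' _
  rw [← Matrix.toLin'_mul]
  congr 1
  ext i j
  rw [Matrix.submatrix_apply, Matrix.mul_apply, Matrix.mul_apply]
  refine (Fintype.sum_of_injective (embU n) (embU_injective n) _ _ (fun k hk => ?_)
    fun k => rfl).symm
  rw [hx.2.2 (embU n i) k, zero_mul]
  rintro (⟨-, h⟩ | h)
  · exact hk (mem_range_embU h)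
  · exact hk (mem_range_embU (h ▸ pos_embU_lt i))

theorem actU_br {K : Type*} [Field K] {n : ℕ} {p q : ZMod 2} (x y : (gAlg K n).carrier)
    (hx : Homog p x.1) (hy : Homog q y.1) :
    actU K n (sbr x.1 y.1) = actU K n x.1 * actU K n y.1
      - ksign K p q • (actU K n y.1 * actU K n x.1) := by
  rw [sbr_of_homog hx hy, map_sub, map_smul, actU_mul x.2, actU_mul y.2]

/-- The `g`-supermodule `U`. -/
def natRep (K : Type*) [Field K] (n : ℕ) : SuperRep (gAlg K n) (USpace K n) where
  parity := parU K n
  parity_sq := parU_sq K n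
  act := (actU K n) ∘ₗ (gAlg K n).carrier.subtype
  act_parity _ _ hx := parU_actU hx
  act_br _ _ x y hx hy := actU_br x y hx hy

theorem actUDual_of_homog {K : Type*} [Field K] {n : ℕ} {p : ZMod 2} {x : Mat K (2 * halfUp n)}
    (hx : Homog p x) : actUDual K n x = -(transU (actU K n x) * parUDual K n ^ p.val) := by
  change -transU (actU K n (comp 0 x)) - transU (actU K n (comp 1 x)) * parUDual K n = _
  rcases zmod2_cases p with rfl | rfl
  · rw [comp_of_homog hx, comp_of_homog_ne hx (by decide)]
    simp
  · rw [comp_of_homog hx, comp_of_homog_ne hx (by decide)]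
    simp [ZMod.val_one]

theorem parUDual_transU {K : Type*} [Field K] {n : ℕ} {p : ZMod 2} {x : Mat K (2 * halfUp n)}
    (hx : Homog p x) : parUDual K n * transU (actU K n x)
      = ((-1 : K) ^ p.val) • (transU (actU K n x) * parUDual K n) := by
  rw [parUDual, ← transU_mul, ← transU_mul, parU_actU hx, map_smul, smul_smul, ← mul_pow]
  simp

/-- The `g`-supermodule `U*`. -/
def dualRep (K : Type*) [Field K] (n : ℕ) : SuperRep (gAlg K n) (UDual K n) where
  parity := parUDual K n
  parity_sq := parUDual_sq K n
  act := (actUDual K n) ∘ₗ (gAlg K n).carrier.subtype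
  act_parity p x hx := by
    have hx' := parUDual_transU hx
    rw [LinearMap.comp_apply, Submodule.subtype_apply, actUDual_of_homog hx, mul_neg, neg_mul,
      smul_neg, ← mul_assoc, hx', smul_mul_assoc, mul_assoc, mul_assoc, ← pow_succ, ← pow_succ']
  act_br p q x y hx hy := by
    have h1 := actUDual_of_homog hx
    have h2 := actUDual_of_homog hy
    have h3 := actUDual_of_homog ((gAlg K n).homog_br hx hy)
    have h4 : actU K n ((gAlg K n).br x y).1 = _ := actU_br x y hx hy
    have h5 := parUDual_transU hx
    have h6 := parUDual_transU hy
    have hs := parUDual_sq K n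
    simp only [LinearMap.comp_apply, Submodule.subtype_apply]
    rw [h1, h2, h3, h4, map_sub, map_smul, transU_mul, transU_mul]
    generalize transU (actU K n x.1) = X at *
    generalize transU (actU K n y.1) = Y at *
    generalize parUDual K n = E at *
    clear h1 h2 h3 h4
    rcases zmod2_cases p with rfl | rfl <;> rcases zmod2_cases q with rfl | rfl <;>
      simp only [ksign, ZMod.val_zero, ZMod.val_one, pow_zero, pow_one, mul_zero, mul_one,
        one_smul, neg_smul, add_zero, zero_add, sub_neg_eq_add, neg_mul, mul_neg, neg_neg,
        show (1 : ZMod 2) + 1 = 0 from by decide] at h5 h6 ⊢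
    · abel
    · simp only [sub_mul, mul_assoc, h5]
      abel
    · simp only [sub_mul, mul_assoc, h6]
      abel
    · have h5' : ∀ Z, E * (X * Z) = -(X * (E * Z)) := fun Z => by
        rw [← mul_assoc, h5, neg_mul, mul_assoc]
      have h6' : ∀ Z, E * (Y * Z) = -(Y * (E * Z)) := fun Z => by
        rw [← mul_assoc, h6, neg_mul, mul_assoc]
      simp only [mul_assoc, h5', h6', hs, mul_one, mul_neg]
      abel

/-- Matrix units `x_{i,j}`. -/
def unit (K : Type*) [Field K] {N : ℕ} (i j : Idx N) : Mat K N := Matrix.single i j 1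

/-- `e_{r,s} = x_{r,s} + x_{2m+r,2m+s}`, for `r, s ≤ n`. -/
def eMat (K : Type*) [Field K] {n : ℕ} (r s : Fin n) : Mat K (2 * halfUp n) :=
  unit K (embU n (.inl r)) (embU n (.inl s)) + unit K (embU n (.inr r)) (embU n (.inr s))

/-- `e'_{r,s} = x_{r,2m+s} + x_{2m+r,s}`, for `r, s ≤ n`. -/
def eMat' (K : Type*) [Field K] {n : ℕ} (r s : Fin n) : Mat K (2 * halfUp n) :=
  unit K (embU n (.inl r)) (embU n (.inr s)) + unit K (embU n (.inr r)) (embU n (.inl s))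

/-- `f_{r,s} = x_{r,s} - x_{2m+r,2m+s}`, for `r, s ≤ n`. -/
def fMat (K : Type*) [Field K] {n : ℕ} (r s : Fin n) : Mat K (2 * halfUp n) :=
  unit K (embU n (.inl r)) (embU n (.inl s)) - unit K (embU n (.inr r)) (embU n (.inr s))

/-- `f'_{r,s} = x_{r,2m+s} - x_{2m+r,s}`, for `r, s ≤ n`. -/
def fMat' (K : Type*) [Field K] {n : ℕ} (r s : Fin n) : Mat K (2 * halfUp n) :=
  unit K (embU n (.inl r)) (embU n (.inr s)) - unit K (embU n (.inr r)) (embU n (.inl s))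

theorem eMat_mem (K : Type*) [Field K] {n : ℕ} (r s : Fin n) :
    eMat K r s ∈ (gAlg K n).carrier := by
  refine ⟨fun r' s' => ?_, fun r' s' => ?_, fun i j h => ?_⟩
  · simp [eMat, unit, embU, Matrix.single_apply]
  · simp [eMat, unit, embU]
  · by_contra h'
    apply h
    left
    rcases i with i | i <;> rcases j with j | j <;>
      simp [eMat, unit, embU, Matrix.single_apply] at h'
    all_goals
      rw [← h'.1, ← h'.2]
      exact ⟨r.2, s.2⟩

theorem eMat'_mem (K : Type*) [Field K] {n : ℕ} (r s : Fin n) :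
    eMat' K r s ∈ (gAlg K n).carrier := by
  refine ⟨fun r' s' => ?_, fun r' s' => ?_, fun i j h => ?_⟩
  · simp [eMat', unit, embU]
  · simp [eMat', unit, embU, Matrix.single_apply]
  · by_contra h'
    apply h
    left
    rcases i with i | i <;> rcases j with j | j <;>
      simp [eMat', unit, embU, Matrix.single_apply] at h'
    all_goals
      rw [← h'.1, ← h'.2]
      exact ⟨r.2, s.2⟩

/-- `e_{r,s}` as an element of `g`. -/
def eG (K : Type*) [Field K] {n : ℕ} (r s : Fin n) : (gAlg K n).carrier := ⟨_, eMat_mem K r s⟩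

/-- `e'_{r,s}` as an element of `g`. -/
def eG' (K : Type*) [Field K] {n : ℕ} (r s : Fin n) : (gAlg K n).carrier := ⟨_, eMat'_mem K r s⟩

/-- Left multiplication by `ω = ∑ (f_{r,s} ⊗ e_{s,r} - f'_{r,s} ⊗ e'_{s,r})` (sum over
`1 ≤ r, s ≤ n`) on `W ⊗ M`, where `gl(2m|2m)` acts on `W` through `a`, and `W` has parity
involution `ε`; by the sign rule, `(f' ⊗ e')(w ⊗ m) = (-1)^{|w|} f' w ⊗ e' m`. -/
def omegaAct {K : Type*} [Field K] {n : ℕ} {W : Type*} [AddCommGroup W] [Module K W]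
    (a : Mat K (2 * halfUp n) →ₗ[K] Module.End K W) (ε : Module.End K W)
    {M : Type*} [AddCommGroup M] [Module K M] (ρ : SuperRep (gAlg K n) M) :
    Module.End K (W ⊗[K] M) :=
  ∑ r : Fin n, ∑ s : Fin n,
    (TensorProduct.map (a (fMat K r s)) (ρ.act (eG K s r))
      - TensorProduct.map (a (fMat' K r s) * ε) (ρ.act (eG' K s r)))

/-- `sF M = U ⊗ M`. -/
def sF {K : Type*} [Field K] {n : ℕ} {M : Type*} [AddCommGroup M] [Module K M]
    (ρ : SuperRep (gAlg K n) M) : SuperRep (gAlg K n) (USpace K n ⊗[K] M) :=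
  (natRep K n).tensor ρ

/-- `sE M = U* ⊗ M`. -/
def sE {K : Type*} [Field K] {n : ℕ} {M : Type*} [AddCommGroup M] [Module K M]
    (ρ : SuperRep (gAlg K n) M) : SuperRep (gAlg K n) (UDual K n ⊗[K] M) :=
  (dualRep K n).tensor ρ

/-- `x_M`, left multiplication by `ω` on `U ⊗ M`. -/
def xEnd {K : Type*} [Field K] {n : ℕ} {M : Type*} [AddCommGroup M] [Module K M]
    (ρ : SuperRep (gAlg K n) M) : Module.End K (USpace K n ⊗[K] M) :=
  omegaAct (actU K n) (parU K n) ρ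

/-- `x*_M`, left multiplication by `-ω` on `U* ⊗ M`. -/
def xDualEnd {K : Type*} [Field K] {n : ℕ} {M : Type*} [AddCommGroup M] [Module K M]
    (ρ : SuperRep (gAlg K n) M) : Module.End K (UDual K n ⊗[K] M) :=
  -omegaAct (actUDual K n) (parUDual K n) ρ

/-- The space `sF_j M`: the generalized `j`-eigenspace of `x_M`. -/
def sFj {K : Type*} [Field K] {n : ℕ} (j : K) {M : Type*} [AddCommGroup M] [Module K M]
    (ρ : SuperRep (gAlg K n) M) : Submodule K (USpace K n ⊗[K] M) :=
  (xEnd ρ).maxGenEigenspace j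

/-- The space `sE_j M`: the generalized `j`-eigenspace of `x*_M`. -/
def sEj {K : Type*} [Field K] {n : ℕ} (j : K) {M : Type*} [AddCommGroup M] [Module K M]
    (ρ : SuperRep (gAlg K n) M) : Submodule K (UDual K n ⊗[K] M) :=
  (xDualEnd ρ).maxGenEigenspace j

/-! ### Signatures and Verma filtrations -/

/-- The symbols `e`, `f`, `•`. -/
inductive Sig where
  | e
  | f
  | bullet
  deriving DecidableEq

/-- The `t`th entry of the `i`-signature of `b`. -/
def Choices.iSig {K : Type*} [Field K] {n : ℕ} (C : Choices K n) (i : ℤ) (b : Fin n → ℤ)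
    (t : Fin n) : Sig :=
  if (C.sigma t = 1 ∧ b t = i) ∨ (C.sigma t = -1 ∧ b t = i + 1) then Sig.f
  else if (C.sigma t = 1 ∧ b t = i + 1) ∨ (C.sigma t = -1 ∧ b t = i) then Sig.e
  else Sig.bullet

/-- The tuple `σ_t d_t`: its `t`th entry is `σ_t`, and all others are `0`. -/
def Choices.step {K : Type*} [Field K] {n : ℕ} (C : Choices K n) (t : Fin n) : Fin n → ℤ :=
  Pi.single t (C.sigma t : ℤ)

/-- The subspace `F` is a subsupermodule of `ρ` which has a multiplicity-free filtration
`0 = N_0 ⊆ N_1 ⊆ ⋯ ⊆ N_k = F` by subsupermodules, such that, from bottom to top, the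
sections `N_1 / N_0, …, N_k / N_{k-1}` are evenly isomorphic to the Verma supermodules
`M(c_0), …, M(c_{k-1})`. -/
def HasMultFreeVermaFiltration {K : Type*} [Field K] {n : ℕ} (C : Choices K n)
    {M : Type*} [AddCommGroup M] [Module K M] (ρ : SuperRep (gAlg K n) M) (F : Submodule K M)
    {k : ℕ} (c : Fin k → (Fin n → ℤ)) : Prop :=
  (∃ P : Fin (k + 1) → SubSuperRep ρ,
    (P 0).carrier = ⊥ ∧ (P (Fin.last k)).carrier = F ∧
    ∀ l : Fin k, (P l.castSucc).carrier ≤ (P l.succ).carrier ∧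
      EvenlyIso ((P l.castSucc).sec (P l.succ)) (verma C (c l))) ∧
  ∀ l l' : Fin k, l ≠ l' → ¬ EvenlyIso (verma C (c l)) (verma C (c l'))

end

end QSuper

/-!
The enveloping superalgebra `U(g)` has a PBW basis. Ordered monomials span it because reordering
the factors of a monomial changes it by a sign and shorter monomials (`span_good_mon`). They are
independent because `U(g)` has skew derivations, obtained from the coproduct and from matrix
coefficients of the unitization of `gl(N|N)`, that lower the exponents of ordered monomials
(`linearIndependent_good_mon`). Hence the Verma supermodule `M(b)` is free over the monomials in
the strictly lower triangular elements (`TriBasis.coord`), and so is `W ⊗ M(b)` for every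
supermodule `W`, by comparison of leading terms (`TriBasis.eval_tensor_eq_zero`).

The supermodules `U` and `U*` are treated together as a supermodule `W` with a basis that is
permuted by the matrix units of `g` up to signs (`Flag`); for `U*` it is listed in reverse order.
The operator `X`, which is `x` on `U ⊗ M(b)` or `x*` on `U* ⊗ M(b)`, commutes with `g`
(`IsCasimir.comm`) and preserves the filtration by the subsupermodules generated by `w ⊗ v`, for
`w` in the first `k` positions and `v ∈ V(b)`. On the `k`th section, `X²` acts by `λ(λ ± 1)`,
where `λ` is the `k`th entry of the weight in that order (`IsCasimir.sq_fil`). Because `2z ∉ ℤ`,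
this equals `j²` precisely if the signature at this index is `f` for `U`, or `e` for `U*`
(`eigval_eq_iff`). All other sections contribute nothing to the generalized `j`-eigenspace
(`IsCasimir.eigFil_eq`).

At such an index, the vectors `(X + j)(w ⊗ v)`, with `w` the even basis vector, span a copy of
`V(b')` modulo the preceding step, where `b'` is the shifted tuple (`jvec_act`). They give a
homomorphism from `M(b')`, which is injective by freeness (`stepHom_injective`). Its image is that
of `X + j`, that is, the `j`-eigenspace of `X` on the section, as `X² = j²` there with `j ≠ 0`. As
`X` is annihilated by a nonzero polynomial, the eigenvectors lift to generalized eigenvectors, and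
`M(b')` is the section of the filtration of the generalized eigenspace (`IsCasimir.evenlyIso`).

The Verma supermodules that occur are not isomorphic, since the element `-∑ r d_r` has the
eigenvalues `c, c - 1, c - 2, …` at most on a Verma supermodule, with `c` its eigenvalue on the
generators, and different indices give different `c` (`not_evenlyIso_step`).
-/

open scoped TensorProduct

namespace QSuper

noncomputable section

/-! ### The action of the enveloping superalgebra -/

section env
variable {K : Type*} [Field K] {N : ℕ} {L : SubSuperalgebra K N}
  {M : Type*} [AddCommGroup M] [Module K M] {M' : Type*} [AddCommGroup M'] [Module K M']

/-- The action of `U(L)` on a supermodule. -/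
def SuperRep.env (ρ : SuperRep L M) : Env L →ₐ[K] Module.End K M :=
  RingQuot.liftAlgHom K ⟨TensorAlgebra.lift K ρ.act, by
    rintro _ _ ⟨p, q, x, y, hx, hy⟩
    simp only [map_sub, map_mul, map_smul, TensorAlgebra.lift_ι_apply, ρ.act_br p q x y hx hy]⟩

theorem SuperRep.env_ι (ρ : SuperRep L M) (x : L.carrier) : ρ.env (envι L x) = ρ.act x := by
  have h : ρ.env (envι L x) = TensorAlgebra.lift K ρ.act (TensorAlgebra.ι K x) :=
    RingQuot.liftAlgHom_mkAlgHom_apply _ _ _ _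
  rw [h, TensorAlgebra.lift_ι_apply]

/-- `U(L)` is the smallest left `L`-stable subspace of itself that contains `1`. -/
theorem env_submodule_eq_top (S : Submodule K (Env L)) (h1 : (1 : Env L) ∈ S)
    (hmul : ∀ x : L.carrier, ∀ a ∈ S, envι L x * a ∈ S) : S = ⊤ := by
  -- the left stabilizer of `S`
  let A : Subalgebra K (Env L) :=
    { carrier := {a | ∀ s ∈ S, a * s ∈ S}
      mul_mem' := fun {a b} ha hb s hs => by rw [mul_assoc]; exact ha _ (hb _ hs)
      add_mem' := fun {a b} ha hb s hs => by rw [add_mul]; exact S.add_mem (ha _ hs) (hb _ hs)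
      algebraMap_mem' := fun r s hs => by
        rw [← Algebra.smul_def]; exact S.smul_mem _ hs }
  rw [eq_top_iff]
  rintro a -
  obtain ⟨t, rfl⟩ : ∃ t, envMk L t = a := RingQuot.mkAlgHom_surjective K (EnvRel L) a
  have key : envMk L t ∈ A := by
    induction t using TensorAlgebra.induction with
    | algebraMap r => rw [AlgHom.commutes]; exact A.algebraMap_mem r
    | ι x => exact fun s hs => hmul x s hs
    | mul a b ha hb => rw [map_mul]; exact A.mul_mem ha hb
    | add a b ha hb => rw [map_add]; exact A.add_mem ha hb
  simpa using key 1 h1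

theorem env_induction {P : Env L → Prop} (a : Env L) (one : P 1)
    (add : ∀ a b, P a → P b → P (a + b)) (smul : ∀ (c : K) a, P a → P (c • a))
    (mul : ∀ (x : L.carrier) a, P a → P (envι L x * a)) : P a := by
  have h0 : P 0 := by simpa using smul 0 1 one
  let S : Submodule K (Env L) :=
    { carrier := {a | P a}
      add_mem' := fun {a b} ha hb => add a b ha hb
      zero_mem' := h0
      smul_mem' := fun c a ha => smul c a ha }
  have : S = ⊤ := env_submodule_eq_top S one mul
  have ha : a ∈ S := by rw [this]; exact Submodule.mem_top
  exact ha

theorem SuperRep.env_mem (ρ : SuperRep L M) {S : Submodule K M}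
    (hS : ∀ x, ∀ v ∈ S, ρ.act x v ∈ S) (a : Env L) {v : M} (hv : v ∈ S) : ρ.env a v ∈ S := by
  induction a using env_induction with
  | one => simpa using hv
  | add a b ha hb => rw [map_add]; exact S.add_mem ha hb
  | smul c a ha => rw [map_smul]; exact S.smul_mem c ha
  | mul x a ha => rw [map_mul, ρ.env_ι]; exact hS x _ ha

theorem SuperRep.env_comm (ρ : SuperRep L M) (ρ' : SuperRep L M') (φ : M →ₗ[K] M')
    (h : ∀ x v, φ (ρ.act x v) = ρ'.act x (φ v)) (a : Env L) (v : M) :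
    φ (ρ.env a v) = ρ'.env a (φ v) := by
  induction a using env_induction with
  | one => simp
  | add a b ha hb => simp [ha, hb]
  | smul c a ha => simp [ha]
  | mul x a ha => rw [map_mul, map_mul, ρ.env_ι, ρ'.env_ι, Module.End.mul_apply,
      Module.End.mul_apply, h, ha]

theorem SuperRep.parity_env (ρ : SuperRep L M) (a : Env L) (v : M) :
    ρ.parity (ρ.env a v) = ρ.env (envParity L a) (ρ.parity v) := by
  induction a using env_induction with
  | one => simp
  | add a b ha hb => simp [ha, hb]
  | smul c a ha => simp [ha]
  | mul x a ha =>
    have hom : ∀ (p : ZMod 2) (y : L.carrier), Homog p y.1 →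
        ρ.parity (ρ.act y (ρ.env a v)) = ρ.act (parL L y) (ρ.parity (ρ.env a v)) := by
      intro p y hy
      have := LinearMap.congr_fun (ρ.act_parity p y hy) (ρ.env a v)
      rw [parL_of_homog L hy, map_smul]
      exact this
    have hx : x = L.compL 0 x + L.compL 1 x := (Subtype.ext (comp_zero_add_comp_one x.1)).symm
    rw [map_mul, map_mul, map_mul, envParity_ι, ρ.env_ι, ρ.env_ι, Module.End.mul_apply,
      Module.End.mul_apply, ← ha, hx, map_add, map_add, map_add, LinearMap.add_apply,
      LinearMap.add_apply, map_add, hom 0 _ (homog_comp 0 x.1), hom 1 _ (homog_comp 1 x.1)]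

end env

/-! ### Ordered monomials span the enveloping superalgebra -/

section mon
variable {K : Type*} [Field K] {N : ℕ} {L : SubSuperalgebra K N} {ι : Type*}

/-- The monomial `x_{a_1} ⋯ x_{a_r}` in `U(L)`. -/
def mon (x : ι → L.carrier) (l : List ι) : Env L := (l.map fun a => envι L (x a)).prod

@[simp] theorem mon_nil (x : ι → L.carrier) : mon x [] = 1 := rfl

@[simp] theorem mon_cons (x : ι → L.carrier) (a : ι) (l : List ι) :
    mon x (a :: l) = envι L (x a) * mon x l := by simp [mon]

theorem mon_append (x : ι → L.carrier) (l l' : List ι) :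
    mon x (l ++ l') = mon x l * mon x l' := by simp [mon]

/-- The span of the monomials of length less than `r`. -/
def lower (x : ι → L.carrier) (r : ℕ) : Submodule K (Env L) :=
  Submodule.span K (mon x '' {l | l.length < r})

theorem mon_mem_lower (x : ι → L.carrier) {l : List ι} {r : ℕ} (h : l.length < r) :
    mon x l ∈ lower x r := Submodule.subset_span ⟨l, h, rfl⟩

theorem lower_mono (x : ι → L.carrier) {r s : ℕ} (h : r ≤ s) : lower x r ≤ lower x s :=
  Submodule.span_mono (Set.image_mono fun _ hl => lt_of_lt_of_le hl h)

theorem mul_lower (x : ι → L.carrier) (a : ι) {r : ℕ} {u : Env L} (hu : u ∈ lower x r) :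
    envι L (x a) * u ∈ lower x (r + 1) := by
  have : lower x r ≤ (lower x (r + 1)).comap (LinearMap.mulLeft K (envι L (x a))) := by
    rw [lower, Submodule.span_le]
    rintro _ ⟨l, hl, rfl⟩
    change envι L (x a) * mon x l ∈ lower x (r + 1)
    rw [← mon_cons]
    exact mon_mem_lower x (by simpa using hl)
  exact this hu

theorem envι_mul_mon_mem (x : ι → L.carrier) (hspan : Submodule.span K (Set.range x) = ⊤)
    (y : L.carrier) (l : List ι) : envι L y * mon x l ∈ lower x (l.length + 2) := by
  have : Submodule.span K (Set.range x) ≤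
      (lower x (l.length + 2)).comap ((LinearMap.mulRight K (mon x l)) ∘ₗ envι L) := by
    rw [Submodule.span_le]
    rintro _ ⟨a, rfl⟩
    change envι L (x a) * mon x l ∈ lower x (l.length + 2)
    rw [← mon_cons]
    exact mon_mem_lower x (by simp)
  exact this (hspan ▸ Submodule.mem_top)

/-- Lists in which the entries increase weakly, and strictly at odd indices: the exponents of
PBW monomials. -/
def Good [LinearOrder ι] (p : ι → ZMod 2) (l : List ι) : Prop :=
  l.Pairwise fun a b => a < b ∨ (a = b ∧ p a = 0)

theorem Good.sorted [LinearOrder ι] {p : ι → ZMod 2} {l : List ι} (h : Good p l) :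
    l.Pairwise (· ≤ ·) := List.Pairwise.imp (fun h => h.elim le_of_lt fun h => h.1.le) h

theorem Good.eq_of_perm [LinearOrder ι] {p : ι → ZMod 2} {l l' : List ι} (h : Good p l)
    (h' : Good p l') (hp : l.Perm l') : l = l' :=
  hp.eq_of_pairwise' h.sorted h'.sorted

theorem span_mon_lists (x : ι → L.carrier) (hspan : Submodule.span K (Set.range x) = ⊤) :
    Submodule.span K (Set.range (mon x)) = ⊤ := by
  apply env_submodule_eq_top
  · exact Submodule.subset_span ⟨[], rfl⟩
  · intro y u hu
    have : Submodule.span K (Set.range (mon x)) ≤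
        (Submodule.span K (Set.range (mon x))).comap (LinearMap.mulLeft K (envι L y)) := by
      rw [Submodule.span_le]
      rintro _ ⟨l, rfl⟩
      exact (Submodule.span_mono (Set.image_subset_range _ _)) (envι_mul_mon_mem x hspan y l)
    exact this hu

variable {x : ι → L.carrier} {p : ι → ZMod 2}

theorem mon_swap (hx : ∀ a, Homog (p a) (x a).1) (a b : ι) (l : List ι) :
    mon x (a :: b :: l) = ksign K (p a) (p b) • mon x (b :: a :: l)
      + envι L (L.br (x a) (x b)) * mon x l := by
  rw [envι_br L (p a) (p b) _ _ (hx a) (hx b)]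
  simp only [mon_cons, sub_mul, smul_mul_assoc, mul_assoc]
  abel

/-- Permuting the factors of a monomial changes it by a scalar and shorter monomials. -/
theorem mon_perm (hx : ∀ a, Homog (p a) (x a).1)
    (hspan : Submodule.span K (Set.range x) = ⊤) {l l' : List ι} (h : l.Perm l') :
    ∃ c : K, mon x l - c • mon x l' ∈ lower x l.length := by
  induction h with
  | nil => exact ⟨1, by simp⟩
  | cons a h ih =>
    obtain ⟨c, hc⟩ := ih
    refine ⟨c, ?_⟩
    rw [mon_cons, mon_cons, ← mul_smul_comm, ← mul_sub]
    exact mul_lower x a hc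
  | swap a b l =>
    refine ⟨ksign K (p b) (p a), ?_⟩
    rw [mon_swap hx b a l, add_sub_cancel_left]
    exact envι_mul_mon_mem x hspan _ l
  | trans h1 h2 ih1 ih2 =>
    obtain ⟨c, hc⟩ := ih1
    obtain ⟨d, hd⟩ := ih2
    refine ⟨c * d, ?_⟩
    rw [← h1.length_eq] at hd
    convert Submodule.add_mem _ hc (Submodule.smul_mem _ c hd) using 1
    rw [smul_sub, mul_smul]
    abel

/-- The square of an odd element is half its bracket with itself. -/
theorem mon_odd_sq_mem_lower [CharZero K] (hx : ∀ a, Homog (p a) (x a).1)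
    (hspan : Submodule.span K (Set.range x) = ⊤) {a : ι} (ha : p a = 1) (l : List ι) :
    mon x (a :: a :: l) ∈ lower x (l.length + 2) := by
  have h := mon_swap hx a a l
  have hk : ksign K (p a) (p a) = -1 := by rw [ha]; simp [ksign, ZMod.val_one]
  rw [hk] at h
  have h2 : mon x (a :: a :: l) = (2 : K)⁻¹ • (envι L (L.br (x a) (x a)) * mon x l) := by
    rw [eq_inv_smul_iff₀ two_ne_zero, two_smul]
    nth_rewrite 1 [h]
    rw [neg_smul, one_smul]
    abel
  rw [h2]
  exact Submodule.smul_mem _ _ (envι_mul_mon_mem x hspan _ l)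

/-- The spanning half of the PBW theorem. -/
theorem span_good_mon [CharZero K] [LinearOrder ι] (hx : ∀ a, Homog (p a) (x a).1)
    (hspan : Submodule.span K (Set.range x) = ⊤) :
    Submodule.span K (mon x '' {l | Good p l}) = ⊤ := by
  have key : ∀ r, lower x r ≤ Submodule.span K (mon x '' {l | Good p l}) := by
    intro r
    induction r with
    | zero =>
      rw [lower, Submodule.span_le]
      rintro _ ⟨l, hl, rfl⟩
      exact absurd hl (Nat.not_lt_zero _)
    | succ r ih =>
      rw [lower, Submodule.span_le]
      rintro _ ⟨l, hl, rfl⟩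
      have ih' : lower x l.length ≤ _ := (lower_mono x (Nat.lt_succ_iff.1 hl)).trans ih
      have red : ∀ l' : List ι, l.Perm l' →
          mon x l' ∈ Submodule.span K (mon x '' {l | Good p l}) →
          mon x l ∈ Submodule.span K (mon x '' {l | Good p l}) := by
        intro l' hl' hm
        obtain ⟨c, hc⟩ := mon_perm hx hspan hl'
        have := Submodule.add_mem _ (ih' hc) (Submodule.smul_mem _ c hm)
        rwa [sub_add_cancel] at this
      by_cases hodd : ∃ a, p a = 1 ∧ ∃ l'', l.Perm (a :: a :: l'')
      · obtain ⟨a, ha, l'', hl''⟩ := hodd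
        refine red _ hl'' (ih' ?_)
        have hlen : l.length = l''.length + 2 := by simpa using hl''.length_eq
        rw [hlen]
        exact mon_odd_sq_mem_lower hx hspan ha l''
      · refine red (l.insertionSort (· ≤ ·)) (List.perm_insertionSort _ _).symm
          (Submodule.subset_span ⟨_, ?_, rfl⟩)
        have hs : (l.insertionSort (· ≤ ·)).Pairwise (· ≤ ·) := List.pairwise_insertionSort _ _
        have hp : (l.insertionSort (· ≤ ·)).Perm l := List.perm_insertionSort _ _
        change List.Pairwise _ _
        rw [List.pairwise_iff_forall_sublist] at hs ⊢
        intro a b hab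
        rcases (hs hab).lt_or_eq with h | rfl
        · exact Or.inl h
        · right
          refine ⟨rfl, (zmod2_cases (p a)).resolve_right fun ha => hodd ⟨a, ha, ?_⟩⟩
          obtain ⟨l'', hl''⟩ := hab.exists_perm_append
          exact ⟨l'', hp.symm.trans hl''⟩
  rw [eq_top_iff, ← span_mon_lists x hspan, Submodule.span_le]
  rintro _ ⟨l, rfl⟩
  exact key (l.length + 1) (mon_mem_lower x (Nat.lt_succ_self _))

end mon

/-! ### Ordered monomials are linearly independent -/

section pbw
variable {K : Type*} [Field K] {N : ℕ}

/-- The parity involution of `gl(N|N)`. -/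
def parMat : Mat K N →ₗ[K] Mat K N := comp 0 - comp 1

theorem parMat_apply (y : Mat K N) (i j : Idx N) :
    parMat y i j = (-1 : K) ^ (par i + par j).val * y i j := by
  change comp 0 y i j - comp 1 y i j = _
  rw [comp_apply, comp_apply]
  rcases zmod2_cases (par i + par j) with h | h <;> simp [h, ZMod.val_one]

theorem parMat_parMat (y : Mat K N) : parMat (parMat y) = y := by
  ext i j
  rw [parMat_apply, parMat_apply, ← mul_assoc, ← mul_pow]
  simp

theorem parMat_of_homog {p : ZMod 2} {x : Mat K N} (hx : Homog p x) :
    parMat x = ((-1 : K) ^ p.val) • x := by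
  ext i j
  rw [parMat_apply, Matrix.smul_apply, smul_eq_mul]
  by_cases h : par i + par j = p
  · rw [h]
  · rw [hx i j h, mul_zero, mul_zero]

theorem parMat_mul {p : ZMod 2} {x : Mat K N} (hx : Homog p x) (y : Mat K N) :
    parMat (x * y) = ((-1 : K) ^ p.val) • (x * parMat y) := by
  have key : ∀ q : ZMod 2,
      parMat (x * comp q y) = ((-1 : K) ^ p.val) • (x * parMat (comp q y)) := by
    intro q
    rw [parMat_of_homog (homog_mul hx (homog_comp q y)), parMat_of_homog (homog_comp q y),
      mul_smul_comm, smul_smul]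
    congr 1
    rcases zmod2_cases p with rfl | rfl <;> rcases zmod2_cases q with rfl | rfl <;>
      simp [ZMod.val_one, show (1 : ZMod 2) + 1 = 0 from by decide]
  have h := congrArg₂ (· + ·) (key 0) (key 1)
  simp only [← map_add, ← mul_add, ← smul_add, comp_zero_add_comp_one] at h
  exact h

/-- The action of `x ∈ L` on `K ⊕ gl(N|N)`: `x (c, y) = (0, c x + x y)`. -/
def augAct (x : Mat K N) : Module.End K (K × Mat K N) :=
  LinearMap.inr K K (Mat K N) ∘ₗ
    ((LinearMap.fst K K (Mat K N)).smulRight x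
      + LinearMap.mulLeft K x ∘ₗ LinearMap.snd K K (Mat K N))

theorem augAct_apply (x : Mat K N) (v : K × Mat K N) :
    augAct x v = (0, v.1 • x + x * v.2) := rfl

/-- The unitization `K ⊕ gl(N|N)`, on which `L` acts by left multiplication. Since `x ∈ L` sends
`(1, 0)` to `(0, x)`, the matrix coefficients of `(1, 0)` detect the elements of `L`. -/
def augRep (L : SubSuperalgebra K N) : SuperRep L (K × Mat K N) where
  parity := LinearMap.prodMap LinearMap.id parMat
  parity_sq := LinearMap.ext fun v => Prod.ext rfl (parMat_parMat v.2)
  act :=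
    { toFun := fun x => augAct x.1
      map_add' := fun x y => LinearMap.ext fun v => by
        simp [augAct_apply, add_mul]; abel
      map_smul' := fun c x => LinearMap.ext fun v => by
        simp [augAct_apply, smul_comm c] }
  act_parity p x hx := LinearMap.ext fun v => by
    change (((0 : K), parMat (v.1 • x.1 + x.1 * v.2)) : K × Mat K N)
      = ((-1 : K) ^ p.val) • ((0 : K), v.1 • x.1 + x.1 * parMat v.2)
    rw [map_add, map_smul, parMat_of_homog hx, parMat_mul hx, Prod.smul_mk, smul_zero, smul_add,
      smul_comm]
  act_br p q x y hx hy := LinearMap.ext fun v => by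
    change (((0 : K), v.1 • sbr x.1 y.1 + sbr x.1 y.1 * v.2) : K × Mat K N)
      = (0, (0 : K) • x.1 + x.1 * (v.1 • y.1 + y.1 * v.2))
        - ksign K p q • (0, (0 : K) • y.1 + y.1 * (v.1 • x.1 + x.1 * v.2))
    rw [sbr_of_homog hx hy, Prod.smul_mk, Prod.mk_sub_mk]
    simp only [smul_zero, sub_zero, zero_smul, zero_add, mul_add, mul_smul_comm, smul_sub, sub_mul,
      smul_add, smul_mul_assoc, mul_assoc, smul_comm (ksign K p q) v.1]
    congr 1
    abel

/-- `U(L)` as a supermodule over `L`, by left multiplication. -/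
def regRep (L : SubSuperalgebra K N) : SuperRep L (Env L) where
  parity := (envParity L).toLinearMap
  parity_sq := LinearMap.ext fun v => DFunLike.congr_fun (envParity_sq L) v
  act := (Algebra.lmul K (Env L)).toLinearMap ∘ₗ envι L
  act_parity p x hx := LinearMap.ext fun v => by
    change envParity L (envι L x * v) = ((-1 : K) ^ p.val) • (envι L x * envParity L v)
    rw [map_mul, envParity_ι, parL_of_homog L hx, map_smul, smul_mul_assoc]
  act_br p q x y hx hy := LinearMap.ext fun v => by
    change envι L (L.br x y) * v = envι L x * (envι L y * v)
      - ksign K p q • (envι L y * (envι L x * v))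
    rw [envι_br L p q x y hx hy, sub_mul, smul_mul_assoc, mul_assoc, mul_assoc]

variable {L : SubSuperalgebra K N}

/-- `y ↦ y · ((1, 0) ⊗ 1)`. -/
def cop (y : Env L) : (K × Mat K N) ⊗[K] Env L :=
  ((augRep L).tensor (regRep L)).env y (((1 : K), (0 : Mat K N)) ⊗ₜ[K] (1 : Env L))

/-- The skew derivation of `U(L)` obtained from the coproduct by applying a matrix coefficient of
`K ⊕ gl(N|N)` to the first factor. -/
def skewDer (ℓ : Mat K N →ₗ[K] K) : Env L →ₗ[K] Env L :=
  (TensorProduct.lid K (Env L)).toLinearMap ∘ₗ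
    TensorProduct.map (ℓ ∘ₗ LinearMap.snd K K (Mat K N)) LinearMap.id ∘ₗ
    (LinearMap.applyₗ ((((1 : K), (0 : Mat K N)) ⊗ₜ[K] (1 : Env L)))) ∘ₗ
    ((augRep L).tensor (regRep L)).env.toLinearMap

theorem skewDer_eq (ℓ : Mat K N →ₗ[K] K) (y : Env L) : skewDer ℓ y =
    TensorProduct.lid K (Env L) (TensorProduct.map (ℓ ∘ₗ LinearMap.snd K K (Mat K N))
      LinearMap.id (cop y)) := rfl

theorem cop_mul {p : ZMod 2} {x : L.carrier} (hx : Homog p x.1) (y : Env L) :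
    cop (envι L x * y) = TensorProduct.map (augAct x.1) 1 (cop y)
      + TensorProduct.map ((augRep L).parity ^ p.val) ((regRep L).act x) (cop y) := by
  unfold cop
  rw [map_mul, SuperRep.env_ι, Module.End.mul_apply]
  change tensorAct (augRep L) (regRep L) x _ = _
  rw [tensorAct_of_homog _ _ hx]
  rfl

/-- Applying `(c, z) ↦ c` to the first factor recovers `y`. -/
theorem lid_fst_cop (y : Env L) : TensorProduct.lid K (Env L)
    (TensorProduct.map (LinearMap.fst K K (Mat K N)) LinearMap.id (cop y)) = y := by
  induction y using env_induction with
  | one => simp [cop]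
  | add a b ha hb =>
    have : cop (a + b) = cop a + cop b := by simp [cop]
    rw [this, map_add, map_add, ha, hb]
  | smul c a ha =>
    have : cop (c • a) = c • cop a := by simp [cop]
    rw [this, map_smul, map_smul, ha]
  | mul x a ha =>
    have hom : ∀ (p : ZMod 2) (x : L.carrier), Homog p x.1 → TensorProduct.lid K (Env L)
        (TensorProduct.map (LinearMap.fst K K (Mat K N)) LinearMap.id (cop (envι L x * a)))
        = envι L x * a := by
      intro p x hx
      rw [cop_mul hx, map_add, map_add]
      nth_rewrite 3 [← ha]
      induction cop a using TensorProduct.induction_on with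
      | zero => simp
      | add u v hu hv =>
        simp only [map_add, mul_add] at hu hv ⊢
        rw [← hu, ← hv]; abel
      | tmul u v =>
        rcases zmod2_cases p with rfl | rfl <;>
          simp [augAct_apply, augRep, regRep, ZMod.val_one]
    have hx : x = L.compL 0 x + L.compL 1 x := (Subtype.ext (comp_zero_add_comp_one x.1)).symm
    have hadd : ∀ u v : Env L, cop (u + v) = cop u + cop v := fun u v => by simp [cop]
    rw [hx, map_add, add_mul, hadd, map_add, map_add, hom 0 _ (homog_comp 0 x.1),
      hom 1 _ (homog_comp 1 x.1)]

theorem skewDer_one (ℓ : Mat K N →ₗ[K] K) : skewDer ℓ (1 : Env L) = 0 := by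
  simp [skewDer_eq, cop]

/-- The Leibniz rule, with a correction term that comes from the product of `gl(N|N)`. -/
theorem skewDer_mul (ℓ : Mat K N →ₗ[K] K) {p : ZMod 2} {x : L.carrier} (hx : Homog p x.1)
    (y : Env L) : skewDer ℓ (envι L x * y) = ℓ x.1 • y
      + skewDer (ℓ ∘ₗ LinearMap.mulLeft K x.1) y
      + envι L x * skewDer (ℓ ∘ₗ parMat ^ p.val) y := by
  rw [skewDer_eq, skewDer_eq, skewDer_eq, cop_mul hx, map_add, map_add]
  nth_rewrite 3 [← lid_fst_cop y]
  induction cop y using TensorProduct.induction_on with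
  | zero => simp
  | add u v hu hv =>
    simp only [map_add, mul_add, smul_add] at hu hv ⊢
    rw [← sub_eq_zero] at hu hv ⊢
    have h3 := congrArg₂ (· + ·) hu hv
    simp only [add_zero] at h3
    rw [← h3]
    abel
  | tmul u v =>
    rcases zmod2_cases p with rfl | rfl <;>
    · simp [augAct_apply, augRep, regRep, ZMod.val_one, add_smul, mul_smul]
      exact smul_comm _ _ _

variable {ι : Type*} {x : ι → L.carrier} {p : ι → ZMod 2}

theorem skewDer_lower (hx : ∀ a, Homog (p a) (x a).1) (l : List ι) :
    ∀ ℓ : Mat K N →ₗ[K] K, skewDer ℓ (mon x l) ∈ lower x l.length := by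
  induction l with
  | nil => intro ℓ; simp [skewDer_one]
  | cons b l ih =>
    intro ℓ
    rw [mon_cons, skewDer_mul ℓ (hx b)]
    refine Submodule.add_mem _ (Submodule.add_mem _ (Submodule.smul_mem _ _ ?_) ?_) ?_
    · exact mon_mem_lower x (by simp)
    · exact lower_mono x (by simp) (ih _)
    · exact mul_lower x b (ih _)

/-- Functionals on `gl(N|N)` that are homogeneous and dual to the family `x` in `L`. -/
structure DualFunctionals (x : ι → L.carrier) (p : ι → ZMod 2) where
  coord : ι → Mat K N →ₗ[K] K
  coord_self : ∀ a, coord a (x a).1 = 1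
  coord_ne : ∀ a b, a ≠ b → coord a (x b).1 = 0
  coord_par : ∀ a, coord a ∘ₗ parMat = ((-1 : K) ^ (p a).val) • coord a

theorem skewDer_smul (c : K) (ℓ : Mat K N →ₗ[K] K) (y : Env L) :
    skewDer (c • ℓ) y = c • skewDer ℓ y := by
  simp [skewDer_eq, LinearMap.smul_comp, TensorProduct.map_smul_left]

/-- The skew derivations dual to `x` satisfy the Leibniz rule on monomials, up to shorter
monomials. -/
theorem skewDer_coord_mul (D : DualFunctionals x p) (hx : ∀ a, Homog (p a) (x a).1) (a b : ι)
    (l : List ι) : skewDer (D.coord a) (mon x (b :: l)) - (D.coord a (x b).1 • mon x l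
      + ((-1 : K) ^ ((p a).val * (p b).val)) • (envι L (x b) * skewDer (D.coord a) (mon x l)))
      ∈ lower x l.length := by
  have h : D.coord a ∘ₗ parMat ^ (p b).val
      = ((-1 : K) ^ ((p a).val * (p b).val)) • D.coord a := by
    rcases zmod2_cases (p b) with h | h
    · rw [h]
      simp [Module.End.one_eq_id]
    · rw [h, ZMod.val_one, pow_one, mul_one, D.coord_par]
  rw [mon_cons, skewDer_mul _ (hx b), h, skewDer_smul, mul_smul_comm]
  convert skewDer_lower hx l (D.coord a ∘ₗ LinearMap.mulLeft K (x b).1) using 1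
  abel

theorem mul_span_mon (a : ι) {s t : Set (List ι)}
    (h : ∀ l ∈ s, a :: l ∈ t) {u : Env L} (hu : u ∈ Submodule.span K (mon x '' s)) :
    envι L (x a) * u ∈ Submodule.span K (mon x '' t) := by
  have : Submodule.span K (mon x '' s) ≤
      (Submodule.span K (mon x '' t)).comap (LinearMap.mulLeft K (envι L (x a))) := by
    rw [Submodule.span_le]
    rintro _ ⟨l, hl, rfl⟩
    exact Submodule.subset_span ⟨a :: l, h l hl, mon_cons x a l⟩
  exact this hu

/-- Up to terms that are two factors shorter, the skew derivation dual to `x_a` removes one factor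
`x_a` from a monomial. -/
theorem skewDer_coord_mem (D : DualFunctionals x p) (hx : ∀ a, Homog (p a) (x a).1) (a : ι)
    (l : List ι) : skewDer (D.coord a) (mon x l) ∈
      Submodule.span K (mon x '' {l' | l.Perm (a :: l') ∨ l'.length + 1 < l.length}) := by
  induction l with
  | nil => simp [skewDer_one]
  | cons b l ih =>
    have h := skewDer_coord_mul D hx a b l
    have hle : lower x l.length ≤ Submodule.span K
        (mon x '' {l' | (b :: l).Perm (a :: l') ∨ l'.length + 1 < (b :: l).length}) := by
      refine Submodule.span_mono (Set.image_mono fun l' hl' => Or.inr ?_)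
      simpa using hl'
    refine (Submodule.sub_mem_iff_left _ ?_).1 (hle h)
    refine Submodule.add_mem _ ?_ (Submodule.smul_mem _ _ ?_)
    · by_cases hab : a = b
      · subst hab
        exact Submodule.smul_mem _ _ (Submodule.subset_span ⟨l, Or.inl (List.Perm.refl _), rfl⟩)
      · rw [D.coord_ne a b hab, zero_smul]
        exact Submodule.zero_mem _
    · refine mul_span_mon b (fun l' hl' => ?_) ih
      rcases hl' with hl' | hl'
      · exact Or.inl ((hl'.cons b).trans (List.Perm.swap _ _ _))
      · right
        simpa using hl'

theorem mul_skewDer_of_notMem (D : DualFunctionals x p) (hx : ∀ a, Homog (p a) (x a).1) {a : ι}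
    {l : List ι} (ha : a ∉ l) :
    envι L (x a) * skewDer (D.coord a) (mon x l) ∈ lower x l.length := by
  refine mul_span_mon a (fun l' hl' => ?_) (skewDer_coord_mem D hx a l)
  rcases hl' with hl' | hl'
  · exact absurd (hl'.mem_iff.2 List.mem_cons_self) ha
  · simpa using hl'

/-- The skew derivation dual to `x_a` acts on an ordered monomial beginning with `x_a` by removing
this factor and multiplying by its exponent, up to shorter terms. -/
theorem skewDer_coord_good [LinearOrder ι] (D : DualFunctionals x p)
    (hx : ∀ a, Homog (p a) (x a).1) (a : ι) (l : List ι) (h : Good p (a :: l)) :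
    ∃ k : ℕ, k ≠ 0 ∧ skewDer (D.coord a) (mon x (a :: l)) - (k : K) • mon x l
      ∈ lower x l.length := by
  induction l with
  | nil =>
    refine ⟨1, one_ne_zero, ?_⟩
    have h1 := skewDer_coord_mul D hx a a []
    simpa [D.coord_self, skewDer_one] using h1
  | cons b l ih =>
    have h1 := skewDer_coord_mul D hx a a (b :: l)
    rw [D.coord_self, one_smul] at h1
    have hab := List.rel_of_pairwise_cons h (List.mem_cons_self (a := b) (l := l))
    rcases hab with hab | ⟨rfl, hp⟩
    · refine ⟨1, one_ne_zero, ?_⟩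
      have hmem : a ∉ b :: l := by
        intro hm
        rcases List.mem_cons.1 hm with rfl | hm
        · exact lt_irrefl _ hab
        · exact absurd (List.rel_of_pairwise_cons (Good.sorted (List.Pairwise.of_cons h)) hm)
            (not_le.2 hab)
      rw [Nat.cast_one, one_smul]
      have h2 := Submodule.smul_mem _ ((-1 : K) ^ ((p a).val * (p a).val))
        (mul_skewDer_of_notMem D hx hmem)
      convert Submodule.add_mem _ h1 h2 using 1
      abel
    · obtain ⟨k, -, hk⟩ := ih (List.Pairwise.of_cons h)
      refine ⟨k + 1, Nat.succ_ne_zero k, ?_⟩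
      rw [hp, ZMod.val_zero, zero_mul, pow_zero, one_smul] at h1
      have h2 := mul_lower x a hk
      convert Submodule.add_mem _ h1 h2 using 1
      rw [mul_sub, mul_smul_comm, ← mon_cons, Nat.cast_succ, add_smul, one_smul]
      abel

/-- The composite of the skew derivations dual to the entries of a list. -/
def iterDer (D : DualFunctionals x p) : List ι → Env L →ₗ[K] Env L
  | [] => LinearMap.id
  | a :: l => iterDer D l ∘ₗ skewDer (D.coord a)

theorem iterDer_lower (D : DualFunctionals x p) (hx : ∀ a, Homog (p a) (x a).1) (l : List ι) :
    ∀ u ∈ lower x l.length, iterDer D l u = 0 := by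
  induction l with
  | nil =>
    intro u hu
    have : lower x (0 : ℕ) = ⊥ := by simp [lower]
    exact (Submodule.mem_bot K).1 (this ▸ hu)
  | cons a l ih =>
    intro u hu
    refine ih _ ?_
    have : lower x (a :: l).length ≤ (lower x l.length).comap (skewDer (D.coord a)) := by
      conv_lhs => rw [lower]
      rw [Submodule.span_le]
      rintro _ ⟨l', hl', rfl⟩
      refine lower_mono x ?_ (skewDer_lower hx l' (D.coord a))
      have : l'.length < l.length + 1 := hl'
      omega
    exact this hu

theorem iterDer_not_perm (D : DualFunctionals x p) (hx : ∀ a, Homog (p a) (x a).1)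
    (l : List ι) : ∀ l' : List ι, l'.length = l.length → ¬ l'.Perm l →
      iterDer D l (mon x l') = 0 := by
  induction l with
  | nil =>
    intro l' h1 h2
    rw [List.length_nil, List.length_eq_zero_iff] at h1
    exact absurd (h1 ▸ List.Perm.refl _) h2
  | cons a l ih =>
    intro l' h1 h2
    have : Submodule.span K (mon x '' {l'' | l'.Perm (a :: l'') ∨ l''.length + 1 < l'.length})
        ≤ LinearMap.ker (iterDer D l) := by
      rw [Submodule.span_le]
      rintro _ ⟨l'', hl'' | hl'', rfl⟩
      · refine ih l'' ?_ fun h3 => h2 (hl''.trans (h3.cons a))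
        have := hl''.length_eq
        simp only [List.length_cons] at this h1
        omega
      · refine iterDer_lower D hx l _ (mon_mem_lower x ?_)
        simp only [List.length_cons] at h1
        omega
    exact this (skewDer_coord_mem D hx a l')

theorem iterDer_self [LinearOrder ι] (D : DualFunctionals x p)
    (hx : ∀ a, Homog (p a) (x a).1) (l : List ι) (h : Good p l) :
    ∃ k : ℕ, k ≠ 0 ∧ iterDer D l (mon x l) = (k : K) • (1 : Env L) := by
  induction l with
  | nil => exact ⟨1, one_ne_zero, by simp [iterDer]⟩
  | cons a l ih =>
    obtain ⟨k, hk, hk'⟩ := ih (List.Pairwise.of_cons h)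
    obtain ⟨k', hk1, hk2⟩ := skewDer_coord_good D hx a l h
    refine ⟨k' * k, mul_ne_zero hk1 hk, ?_⟩
    have h3 := iterDer_lower D hx l _ hk2
    rw [map_sub, map_smul, hk', sub_eq_zero, smul_smul, ← Nat.cast_mul] at h3
    exact h3

instance : Nontrivial (Env L) := by
  refine ⟨⟨0, 1, fun h => ?_⟩⟩
  have h2 := congrArg (fun a => ((augRep L).env a ((1 : K), (0 : Mat K N))).1) h
  simp at h2

/-- The independence half of the PBW theorem. -/
theorem linearIndependent_good_mon [CharZero K] [LinearOrder ι] (D : DualFunctionals x p)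
    (hx : ∀ a, Homog (p a) (x a).1) :
    LinearIndependent K (fun l : {l : List ι // Good p l} => mon x l.1) := by
  classical
  rw [linearIndependent_iff']
  intro s g hg
  by_contra hne
  push Not at hne
  obtain ⟨i1, hi1, hgi1⟩ := hne
  -- a longest monomial with nonzero coefficient is detected by its iterated derivation
  obtain ⟨i0, hi0, hmax⟩ := Finset.exists_max_image (s.filter fun i => g i ≠ 0)
    (fun i => i.1.length) ⟨i1, Finset.mem_filter.2 ⟨hi1, hgi1⟩⟩
  rw [Finset.mem_filter] at hi0
  have h := congrArg (iterDer D i0.1) hg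
  rw [map_sum, map_zero, Finset.sum_eq_single i0] at h
  · obtain ⟨k, hk, hk'⟩ := iterDer_self D hx i0.1 i0.2
    rw [map_smul, hk', smul_smul, smul_eq_zero] at h
    rcases h with h | h
    · exact (mul_ne_zero hi0.2 (Nat.cast_ne_zero.2 hk)) h
    · exact one_ne_zero h
  · intro i hi hne
    rw [map_smul]
    by_cases hgi : g i = 0
    · rw [hgi, zero_smul]
    · rcases (hmax i (Finset.mem_filter.2 ⟨hi, hgi⟩)).lt_or_eq with hlt | heq
      · rw [iterDer_lower D hx _ _ (mon_mem_lower x hlt), smul_zero]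
      · rw [iterDer_not_perm D hx _ _ heq fun hp => hne (Subtype.ext (i.2.eq_of_perm i0.2 hp)),
          smul_zero]
  · exact fun h => absurd hi0.1 h

end pbw

/-! ### Induced supermodules are free over the complementary monomials -/

section ind
variable {K : Type*} [Field K] {N : ℕ} {g b : SubSuperalgebra K N} {h : b.carrier ≤ g.carrier}
  {V : Type*} [AddCommGroup V] [Module K V] {Q : Type*} [AddCommGroup Q] [Module K Q]

/-- The map `U(b) → U(g)` induced by the inclusion of a Lie subsuperalgebra. -/
def envIncl (h : b.carrier ≤ g.carrier) : Env b →ₐ[K] Env g :=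
  RingQuot.liftAlgHom K ⟨TensorAlgebra.lift K (envι g ∘ₗ Submodule.inclusion h), by
    rintro _ _ ⟨p, q, x, y, hx, hy⟩
    simp only [map_sub, map_mul, map_smul, TensorAlgebra.lift_ι_apply, LinearMap.comp_apply]
    exact (envι_br g p q (Submodule.inclusion h x) (Submodule.inclusion h y) hx hy).symm⟩

theorem envIncl_ι (β : b.carrier) :
    envIncl h (envι b β) = envι g (Submodule.inclusion h β) := by
  have h1 : envIncl h (envι b β) = TensorAlgebra.lift K (envι g ∘ₗ Submodule.inclusion h)
      (TensorAlgebra.ι K β) := RingQuot.liftAlgHom_mkAlgHom_apply _ _ _ _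
  rw [h1, TensorAlgebra.lift_ι_apply, LinearMap.comp_apply]

/-- The canonical map `V → U(g) ⊗_{U(b)} V`. -/
def indGen (h : b.carrier ≤ g.carrier) (τ : SuperRep b V) : V →ₗ[K] Ind h τ :=
  (indRel h τ).mkQ ∘ₗ TensorProduct.mk K (Env g) V 1

theorem indRep_env (τ : SuperRep b V) (a : Env g) : (indRep h τ).env a = indMul h τ a := by
  apply ind_ext
  intro u v
  rw [indMul_mk]
  induction a using env_induction with
  | one => simp
  | add a b ha hb => rw [map_add, LinearMap.add_apply, ha, hb, add_mul, TensorProduct.add_tmul,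
      map_add]
  | smul c a ha => rw [map_smul, LinearMap.smul_apply, ha, smul_mul_assoc,
      ← TensorProduct.smul_tmul', map_smul]
  | mul x a ha =>
    rw [map_mul, SuperRep.env_ι, Module.End.mul_apply, ha]
    change indMul h τ (envι g x) _ = _
    rw [indMul_mk, mul_assoc]

theorem indRep_env_gen (τ : SuperRep b V) (a : Env g) (v : V) :
    (indRep h τ).env a (indGen h τ v) = (indRel h τ).mkQ (a ⊗ₜ[K] v) := by
  rw [indRep_env]
  change indMul h τ a ((indRel h τ).mkQ (1 ⊗ₜ[K] v)) = _
  rw [indMul_mk, mul_one]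

theorem indGen_act (τ : SuperRep b V) (β : b.carrier) (v : V) :
    (indRep h τ).act (Submodule.inclusion h β) (indGen h τ v) = indGen h τ (τ.act β v) := by
  rw [← SuperRep.env_ι, indRep_env_gen, ← sub_eq_zero]
  change (indRel h τ).mkQ _ - (indRel h τ).mkQ _ = 0
  rw [← map_sub, Submodule.mkQ_apply, Submodule.Quotient.mk_eq_zero]
  refine Submodule.subset_span ⟨1, β, v, ?_⟩
  rw [one_mul]
  rfl

theorem indGen_parity (τ : SuperRep b V) (v : V) :
    (indRep h τ).parity (indGen h τ v) = indGen h τ (τ.parity v) := by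
  change indParity h τ ((indRel h τ).mkQ (1 ⊗ₜ[K] v)) = _
  rw [indParity_mk, map_one]
  rfl

theorem ind_induction {τ : SuperRep b V} {P : Ind h τ → Prop} (w : Ind h τ)
    (gen : ∀ a v, P ((indRep h τ).env a (indGen h τ v))) (add : ∀ w w', P w → P w' → P (w + w')) :
    P w := by
  obtain ⟨t, rfl⟩ := Submodule.mkQ_surjective _ w
  induction t using TensorProduct.induction_on with
  | zero => simpa using gen 0 0
  | tmul a v => rw [← indRep_env_gen]; exact gen a v
  | add t t' ht ht' => rw [map_add]; exact add _ _ ht ht'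

/-- Frobenius reciprocity. -/
def indLift (τ : SuperRep b V) (ρ : SuperRep g Q) (f : V →ₗ[K] Q)
    (hf : ∀ β v, f (τ.act β v) = ρ.act (Submodule.inclusion h β) (f v)) : Ind h τ →ₗ[K] Q :=
  (indRel h τ).liftQ (TensorProduct.lift ((LinearMap.llcomp K V Q Q).flip f ∘ₗ
      ρ.env.toLinearMap)) (by
    unfold indRel
    rw [Submodule.span_le]
    rintro _ ⟨u, β, v, rfl⟩
    simp [hf, ρ.env_ι])

theorem indLift_env_gen (τ : SuperRep b V) (ρ : SuperRep g Q) (f : V →ₗ[K] Q)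
    (hf : ∀ β v, f (τ.act β v) = ρ.act (Submodule.inclusion h β) (f v)) (a : Env g) (v : V) :
    indLift τ ρ f hf ((indRep h τ).env a (indGen h τ v)) = ρ.env a (f v) := by
  rw [indRep_env_gen]
  rfl

theorem indLift_act (τ : SuperRep b V) (ρ : SuperRep g Q) (f : V →ₗ[K] Q)
    (hf : ∀ β v, f (τ.act β v) = ρ.act (Submodule.inclusion h β) (f v)) (x : g.carrier)
    (w : Ind h τ) :
    indLift τ ρ f hf ((indRep h τ).act x w) = ρ.act x (indLift τ ρ f hf w) := by
  induction w using ind_induction with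
  | gen a v => rw [← SuperRep.env_ι, ← Module.End.mul_apply, ← map_mul, indLift_env_gen,
      indLift_env_gen, map_mul, SuperRep.env_ι, Module.End.mul_apply]
  | add w w' hw hw' => rw [map_add, map_add, map_add, map_add, hw, hw']

theorem indLift_parity (τ : SuperRep b V) (ρ : SuperRep g Q) (f : V →ₗ[K] Q)
    (hf : ∀ β v, f (τ.act β v) = ρ.act (Submodule.inclusion h β) (f v))
    (hp : ∀ v, f (τ.parity v) = ρ.parity (f v)) (w : Ind h τ) :
    indLift τ ρ f hf ((indRep h τ).parity w) = ρ.parity (indLift τ ρ f hf w) := by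
  induction w using ind_induction with
  | gen a v => rw [SuperRep.parity_env, indGen_parity, indLift_env_gen, indLift_env_gen,
      SuperRep.parity_env, hp]
  | add w w' hw hw' => rw [map_add, map_add, map_add, map_add, hw, hw']

/-- A homogeneous basis of `g` that consists of a basis `xb` of `b` and of a basis `xn` of a
complement, given together with dual functionals. -/
structure TriBasis (h : b.carrier ≤ g.carrier) (ι₁ ι₂ : Type*) where
  xn : ι₁ → g.carrier
  xb : ι₂ → b.carrier
  pn : ι₁ → ZMod 2
  pb : ι₂ → ZMod 2
  homog_n : ∀ a, Homog (pn a) (xn a).1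
  homog_b : ∀ a, Homog (pb a) (xb a).1
  span_b : Submodule.span K (Set.range xb) = ⊤
  span_g : Submodule.span K (Set.range (Sum.elim xn (Submodule.inclusion h ∘ xb))) = ⊤
  dual : DualFunctionals (Sum.elim xn (Submodule.inclusion h ∘ xb)) (Sum.elim pn pb)

/-- The exponents of the PBW monomials in the basis of the complement. -/
abbrev TriBasis.Exp {ι₁ ι₂ : Type*} [LinearOrder ι₁] (B : TriBasis h ι₁ ι₂) :=
  {l : List ι₁ // Good B.pn l}

variable {ι₁ ι₂ : Type*} (B : TriBasis h ι₁ ι₂)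

namespace TriBasis

/-- The list `l₁`, followed by the list `l₂`. -/
def join (l₁ : List ι₁) (l₂ : List ι₂) : List (ι₁ ⊕ₗ ι₂) :=
  l₁.map (fun a => toLex (Sum.inl a)) ++ l₂.map (fun a => toLex (Sum.inr a))

theorem join_injective {l₁ l₁' : List ι₁} {l₂ l₂' : List ι₂} (hj : join l₁ l₂ = join l₁' l₂') :
    l₁ = l₁' ∧ l₂ = l₂' := by
  have hl : ∀ (l₁ : List ι₁) (l₂ : List ι₂),
      (join l₁ l₂).filterMap (fun a => (ofLex a).getLeft?) = l₁ := by
    intro l₁ l₂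
    simp [join, List.filterMap_append, List.filterMap_map, Function.comp_def]
  have hr : ∀ (l₁ : List ι₁) (l₂ : List ι₂),
      (join l₁ l₂).filterMap (fun a => (ofLex a).getRight?) = l₂ := by
    intro l₁ l₂
    simp [join, List.filterMap_append, List.filterMap_map, Function.comp_def]
  exact ⟨by rw [← hl l₁ l₂, hj, hl], by rw [← hr l₁ l₂, hj, hr]⟩

theorem mon_incl (l : List ι₂) :
    mon (Submodule.inclusion h ∘ B.xb) l = envIncl h (mon B.xb l) := by
  induction l with
  | nil => simp
  | cons a l ih => rw [mon_cons, mon_cons, map_mul, ih, envIncl_ι]; rfl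

theorem mon_join (l₁ : List ι₁) (l₂ : List ι₂) :
    mon (Sum.elim B.xn (Submodule.inclusion h ∘ B.xb) ∘ ofLex) (join l₁ l₂)
      = mon B.xn l₁ * envIncl h (mon B.xb l₂) := by
  rw [join, mon_append, ← mon_incl]
  simp [mon, Function.comp_def]

theorem homog (a : ι₁ ⊕ ι₂) : Homog (Sum.elim B.pn B.pb a)
    (Sum.elim B.xn (Submodule.inclusion h ∘ B.xb) a).1 := by
  rcases a with a | a
  · exact B.homog_n a
  · exact B.homog_b a

variable [LinearOrder ι₁] [LinearOrder ι₂]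

theorem good_join {l₁ : List ι₁} {l₂ : List ι₂} :
    Good (Sum.elim B.pn B.pb ∘ ofLex) (join l₁ l₂) ↔ Good B.pn l₁ ∧ Good B.pb l₂ := by
  unfold Good join
  rw [List.pairwise_append, List.pairwise_map, List.pairwise_map]
  constructor
  · rintro ⟨h1, h2, -⟩
    exact ⟨h1.imp (by simp), h2.imp (by simp)⟩
  · rintro ⟨h1, h2⟩
    refine ⟨h1.imp (by simp), h2.imp (by simp), ?_⟩
    intro a ha c hc
    obtain ⟨a', -, rfl⟩ := List.mem_map.1 ha
    obtain ⟨c', -, rfl⟩ := List.mem_map.1 hc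
    exact Or.inl (Sum.Lex.inl_lt_inr _ _)

theorem exists_join {q : ι₁ ⊕ₗ ι₂ → ZMod 2} (l : List (ι₁ ⊕ₗ ι₂)) (hl : Good q l) :
    ∃ l₁ l₂, l = join l₁ l₂ := by
  induction l with
  | nil => exact ⟨[], [], rfl⟩
  | cons a l ih =>
    obtain ⟨l₁, l₂, rfl⟩ := ih (List.Pairwise.of_cons hl)
    obtain ⟨a, rfl⟩ := toLex.surjective a
    rcases a with a | a
    · exact ⟨a :: l₁, l₂, rfl⟩
    · rcases l₁ with _ | ⟨c, l₁⟩
      · exact ⟨[], a :: l₂, rfl⟩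
      · have := List.rel_of_pairwise_cons hl (a' := toLex (Sum.inl c)) (by simp [join])
        rcases this with h | h
        · exact absurd h Sum.Lex.not_inr_lt_inl
        · exact absurd (toLex.injective h.1) (by simp)

theorem linearIndependent [CharZero K] : LinearIndependent K
    (fun l : B.Exp × {l : List ι₂ // Good B.pb l} =>
      mon B.xn l.1.1 * envIncl h (mon B.xb l.2.1)) := by
  have D : DualFunctionals (Sum.elim B.xn (Submodule.inclusion h ∘ B.xb) ∘ ofLex)
      (Sum.elim B.pn B.pb ∘ ofLex) :=
    { coord := fun a => B.dual.coord (ofLex a)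
      coord_self := fun a => B.dual.coord_self _
      coord_ne := fun a c hac => B.dual.coord_ne _ _ fun h => hac (ofLex.injective h)
      coord_par := fun a => B.dual.coord_par _ }
  have h1 := (linearIndependent_good_mon D fun a => B.homog (ofLex a)).comp
    (fun l : B.Exp × {l : List ι₂ // Good B.pb l} =>
      ⟨join l.1.1 l.2.1, B.good_join.2 ⟨l.1.2, l.2.2⟩⟩)
    (fun l l' hl => by
      have := join_injective (congrArg Subtype.val hl)
      exact Prod.ext (Subtype.ext this.1) (Subtype.ext this.2))
  convert h1 using 2 with l
  exact (B.mon_join l.1.1 l.2.1).symm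

theorem span_eq_top [CharZero K] : ⊤ ≤ Submodule.span K (Set.range
    (fun l : B.Exp × {l : List ι₂ // Good B.pb l} =>
      mon B.xn l.1.1 * envIncl h (mon B.xb l.2.1))) := by
  have h2 := B.span_g
  rw [← ofLex.surjective.range_comp] at h2
  rw [← span_good_mon (x := Sum.elim B.xn (Submodule.inclusion h ∘ B.xb) ∘ ofLex)
    (fun a => B.homog (ofLex a)) h2]
  refine Submodule.span_mono ?_
  rintro _ ⟨l, hl, rfl⟩
  obtain ⟨l₁, l₂, rfl⟩ := exists_join l hl
  have hg := B.good_join.1 hl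
  exact ⟨(⟨l₁, hg.1⟩, ⟨l₂, hg.2⟩), (B.mon_join l₁ l₂).symm⟩

/-- The PBW basis of `U(g)`, adapted to `b`. -/
def pbw [CharZero K] :
    Module.Basis (B.Exp × {l : List ι₂ // Good B.pb l}) K (Env g) :=
  Module.Basis.mk B.linearIndependent B.span_eq_top

theorem pbw_apply [CharZero K] (l : B.Exp × {l : List ι₂ // Good B.pb l}) :
    B.pbw l = mon B.xn l.1.1 * envIncl h (mon B.xb l.2.1) := by
  rw [pbw, Module.Basis.mk_apply]

theorem env_triangular_induction [CharZero K] {P : Env g → Prop} (a : Env g)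
    (mul : ∀ (l : B.Exp) y, P (mon B.xn l.1 * envIncl h y)) (add : ∀ u v, P u → P v → P (u + v)) :
    P a := by
  have ha : a ∈ Submodule.span K (Set.range
    (fun l : B.Exp × {l : List ι₂ // Good B.pb l} =>
      mon B.xn l.1.1 * envIncl h (mon B.xb l.2.1))) := B.span_eq_top Submodule.mem_top
  obtain ⟨c, rfl⟩ := (Finsupp.mem_span_range_iff_exists_finsupp).1 ha
  rw [Finsupp.sum]
  induction c.support using Finset.cons_induction with
  | empty => simpa using mul ⟨[], List.Pairwise.nil⟩ 0
  | cons l s hl ih =>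
    rw [Finset.sum_cons]
    refine add _ _ ?_ ih
    rw [← mul_smul_comm, ← map_smul]
    exact mul _ _

/-- `U(g) → Hom(V, ⨁_l V)`, sending the product of the `l`th monomial and of `y ∈ U(b)` to the
action of `y`, with values in the `l`th summand. -/
def coordAux [CharZero K] (τ : SuperRep b V) : Env g →ₗ[K] V →ₗ[K] (B.Exp →₀ V) :=
  B.pbw.constr K fun l => Finsupp.lsingle l.1 ∘ₗ τ.env (mon B.xb l.2.1)

theorem coordAux_mul [CharZero K] (τ : SuperRep b V) (l : B.Exp) (y : Env b) (v : V) :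
    B.coordAux τ (mon B.xn l.1 * envIncl h y) v = Finsupp.single l (τ.env y v) := by
  let S : Submodule K (Env b) := LinearMap.ker
    (B.coordAux τ ∘ₗ LinearMap.mulLeft K (mon B.xn l.1) ∘ₗ (envIncl h).toLinearMap
      - (LinearMap.llcomp K V V (B.Exp →₀ V) (Finsupp.lsingle l)) ∘ₗ τ.env.toLinearMap)
  have hS : (⊤ : Submodule K (Env b)) ≤ S := by
    rw [← span_good_mon B.homog_b B.span_b, Submodule.span_le]
    rintro _ ⟨l₂, hl₂, rfl⟩
    rw [SetLike.mem_coe, LinearMap.mem_ker, LinearMap.sub_apply, sub_eq_zero]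
    have := B.pbw_apply (l, ⟨l₂, hl₂⟩)
    change B.coordAux τ (mon B.xn l.1 * envIncl h (mon B.xb l₂)) = _
    rw [← this, coordAux, Module.Basis.constr_basis]
    rfl
  have hy := hS (Submodule.mem_top (x := y))
  rw [LinearMap.mem_ker, LinearMap.sub_apply, sub_eq_zero] at hy
  exact LinearMap.congr_fun hy v

/-- The coordinates on `U(g) ⊗_{U(b)} V`. -/
def coord [CharZero K] (τ : SuperRep b V) : Ind h τ →ₗ[K] (B.Exp →₀ V) :=
  (indRel h τ).liftQ (TensorProduct.lift (B.coordAux τ)) (by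
    unfold indRel
    rw [Submodule.span_le]
    rintro _ ⟨u, β, v, rfl⟩
    rw [SetLike.mem_coe, LinearMap.mem_ker, map_sub, sub_eq_zero, TensorProduct.lift.tmul,
      TensorProduct.lift.tmul]
    induction u using B.env_triangular_induction with
    | mul l y => rw [mul_assoc, ← envIncl_ι, ← map_mul, coordAux_mul, coordAux_mul, map_mul,
        SuperRep.env_ι, Module.End.mul_apply]
    | add u u' hu hu' => rw [add_mul, map_add, map_add, LinearMap.add_apply, hu, hu',
        LinearMap.add_apply])

theorem coord_mon [CharZero K] (τ : SuperRep b V) (l : B.Exp) (v : V) :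
    B.coord τ ((indRep h τ).env (mon B.xn l.1) (indGen h τ v)) = Finsupp.single l v := by
  rw [indRep_env_gen]
  change B.coordAux τ (mon B.xn l.1) v = _
  have := B.coordAux_mul τ l 1 v
  simpa using this

theorem env_incl_mem {ρ : SuperRep g Q} {Y : Submodule K Q}
    (hY : ∀ β : b.carrier, ∀ y ∈ Y, ρ.act (Submodule.inclusion h β) y ∈ Y) (u : Env b) {y : Q}
    (hy : y ∈ Y) : ρ.env (envIncl h u) y ∈ Y := by
  induction u using env_induction with
  | one => simpa using hy
  | add u v hu hv => rw [map_add, map_add]; exact Y.add_mem hu hv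
  | smul c u hu => rw [map_smul, map_smul]; exact Y.smul_mem c hu
  | mul x u hu =>
    rw [map_mul, map_mul, envIncl_ι, SuperRep.env_ι]
    exact hY x _ hu

theorem ind_mon_induction [CharZero K] {τ : SuperRep b V} {P : Ind h τ → Prop} (w : Ind h τ)
    (gen : ∀ (l : B.Exp) v, P ((indRep h τ).env (mon B.xn l.1) (indGen h τ v)))
    (add : ∀ w w', P w → P w' → P (w + w')) : P w := by
  induction w using ind_induction with
  | gen a v =>
    induction a using B.env_triangular_induction with
    | mul l y =>
      have hmem := env_incl_mem (h := h) (ρ := indRep h τ)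
        (Y := LinearMap.range (indGen h τ)) (by
          rintro β _ ⟨v, rfl⟩
          exact ⟨_, (indGen_act τ β v).symm⟩) y ⟨v, rfl⟩
      obtain ⟨v', hv'⟩ := hmem
      rw [map_mul, Module.End.mul_apply, ← hv']
      exact gen l v'
    | add u u' hu hu' => rw [map_add]; exact add _ _ hu hu'
  | add w w' hw hw' => exact add w w' hw hw'

include B in
theorem indGen_injective [CharZero K] (τ : SuperRep b V) : Function.Injective (indGen h τ) := by
  intro v v' hv
  have h1 := B.coord_mon τ ⟨[], List.Pairwise.nil⟩ v
  have h2 := B.coord_mon τ ⟨[], List.Pairwise.nil⟩ v'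
  rw [mon_nil, map_one, Module.End.one_apply] at h1 h2
  exact Finsupp.single_injective _ (h1.symm.trans ((congrArg _ hv).trans h2))

end TriBasis

end ind

/-! ### Subsupermodules generated by stable subspaces -/

section gen
variable {K : Type*} [Field K] {N : ℕ} {g b : SubSuperalgebra K N} {h : b.carrier ≤ g.carrier}
  {Q : Type*} [AddCommGroup Q] [Module K Q]

/-- The subsupermodule generated by a graded subspace. -/
def SuperRep.gen (ρ : SuperRep g Q) (Y : Submodule K Q) (hY : ∀ y ∈ Y, ρ.parity y ∈ Y) :
    SubSuperRep ρ where
  carrier := Submodule.span K {t | ∃ a, ∃ y ∈ Y, t = ρ.env a y}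
  parity_mem v hv := by
    have : Submodule.span K {t | ∃ a, ∃ y ∈ Y, t = ρ.env a y} ≤
        (Submodule.span K {t | ∃ a, ∃ y ∈ Y, t = ρ.env a y}).comap ρ.parity := by
      rw [Submodule.span_le]
      rintro _ ⟨a, y, hy, rfl⟩
      exact Submodule.subset_span ⟨envParity g a, ρ.parity y, hY y hy, ρ.parity_env a y⟩
    exact this hv
  act_mem x v hv := by
    have : Submodule.span K {t | ∃ a, ∃ y ∈ Y, t = ρ.env a y} ≤
        (Submodule.span K {t | ∃ a, ∃ y ∈ Y, t = ρ.env a y}).comap (ρ.act x) := by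
      rw [Submodule.span_le]
      rintro _ ⟨a, y, hy, rfl⟩
      refine Submodule.subset_span ⟨envι g x * a, y, hy, ?_⟩
      rw [map_mul, ρ.env_ι]
      rfl
    exact this hv

theorem SuperRep.subset_gen (ρ : SuperRep g Q) (Y : Submodule K Q)
    (hY : ∀ y ∈ Y, ρ.parity y ∈ Y) : Y ≤ (ρ.gen Y hY).carrier :=
  fun y hy => Submodule.subset_span ⟨1, y, hy, by simp⟩

theorem SuperRep.gen_le (ρ : SuperRep g Q) {Y : Submodule K Q}
    (hY : ∀ y ∈ Y, ρ.parity y ∈ Y) {S : Submodule K Q} (hS : ∀ x, ∀ v ∈ S, ρ.act x v ∈ S)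
    (h : Y ≤ S) : (ρ.gen Y hY).carrier ≤ S := by
  refine Submodule.span_le.2 ?_
  rintro _ ⟨a, y, hy, rfl⟩
  exact ρ.env_mem hS a (h hy)

variable {ι₁ ι₂ : Type*} [LinearOrder ι₁] (B : TriBasis h ι₁ ι₂)

/-- The element `∑_l f_l y_l` of a supermodule, for PBW monomials `f_l` in the complement
of `b`. -/
def TriBasis.eval (ρ : SuperRep g Q) : (B.Exp →₀ Q) →ₗ[K] Q :=
  Finsupp.lsum K fun l => ρ.env (mon B.xn l.1)

theorem TriBasis.eval_single (ρ : SuperRep g Q) (l : B.Exp) (y : Q) :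
    B.eval ρ (Finsupp.single l y) = ρ.env (mon B.xn l.1) y := by
  simp [TriBasis.eval]

/-- A linear map that commutes with the action is evaluated coefficientwise. -/
theorem TriBasis.map_eval {Q' : Type*} [AddCommGroup Q'] [Module K Q'] (ρ : SuperRep g Q)
    (ρ' : SuperRep g Q') (φ : Q →ₗ[K] Q') (hφ : ∀ x v, φ (ρ.act x v) = ρ'.act x (φ v))
    (f : B.Exp →₀ Q) : φ (B.eval ρ f) = B.eval ρ' (f.mapRange φ (map_zero φ)) := by
  induction f using Finsupp.induction_linear with
  | zero => simp
  | add f f' hf hf' => rw [map_add, map_add, hf, hf', Finsupp.mapRange_add (map_add φ), map_add]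
  | single l y => rw [Finsupp.mapRange_single, eval_single, eval_single, ρ.env_comm ρ' φ hφ]

variable [LinearOrder ι₂]

/-- The subsupermodule generated by a `b`-stable subspace `Y` consists of combinations of PBW
monomials in the complement of `b`, with coefficients in `Y`. -/
theorem TriBasis.exists_eval_of_mem_gen [CharZero K] (ρ : SuperRep g Q) {Y : Submodule K Q}
    (hp : ∀ y ∈ Y, ρ.parity y ∈ Y)
    (hY : ∀ β : b.carrier, ∀ y ∈ Y, ρ.act (Submodule.inclusion h β) y ∈ Y) {t : Q}
    (ht : t ∈ (ρ.gen Y hp).carrier) : ∃ f : B.Exp →₀ Q, (∀ l, f l ∈ Y) ∧ t = B.eval ρ f := by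
  let S : Submodule K Q :=
    { carrier := {t | ∃ f : B.Exp →₀ Q, (∀ l, f l ∈ Y) ∧ t = B.eval ρ f}
      zero_mem' := ⟨0, fun l => Y.zero_mem, by simp⟩
      add_mem' := by
        rintro _ _ ⟨f, hf, rfl⟩ ⟨f', hf', rfl⟩
        exact ⟨f + f', fun l => Y.add_mem (hf l) (hf' l), by rw [map_add]⟩
      smul_mem' := by
        rintro c _ ⟨f, hf, rfl⟩
        exact ⟨c • f, fun l => Y.smul_mem c (hf l), by rw [map_smul]⟩ }
  suffices (ρ.gen Y hp).carrier ≤ S from this ht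
  refine Submodule.span_le.2 ?_
  rintro _ ⟨a, y, hy, rfl⟩
  rw [SetLike.mem_coe]
  induction a using B.env_triangular_induction with
  | mul l u =>
    rw [map_mul, Module.End.mul_apply, ← B.eval_single]
    refine ⟨_, fun l' => ?_, rfl⟩
    classical
    rw [Finsupp.single_apply]
    split_ifs
    · exact TriBasis.env_incl_mem hY u hy
    · exact Y.zero_mem
  | add u v hu hv =>
    rw [map_add]
    exact S.add_mem hu hv

end gen

/-! ### Tensor products with induced supermodules -/

section tensor
variable {K : Type*} [Field K] {N : ℕ} {g b : SubSuperalgebra K N} {h : b.carrier ≤ g.carrier}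
  {V : Type*} [AddCommGroup V] [Module K V] {W : Type*} [AddCommGroup W] [Module K W]

theorem tensor_act_tmul {M : Type*} [AddCommGroup M] [Module K M] (ρ : SuperRep g W)
    (τ : SuperRep g M) {p : ZMod 2} {x : g.carrier} (hx : Homog p x.1) (w : W) (m : M) :
    (ρ.tensor τ).act x (w ⊗ₜ[K] m) = ρ.act x w ⊗ₜ[K] m
      + (ρ.parity ^ p.val) w ⊗ₜ[K] τ.act x m := by
  change tensorAct ρ τ x _ = _
  rw [tensorAct_of_homog ρ τ hx]
  rfl

theorem homog_induction {P : g.carrier → Prop} (x : g.carrier)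
    (hom : ∀ p y, Homog p y.1 → P y) (add : ∀ y z, P y → P z → P (y + z)) : P x := by
  have hx : x = g.compL 0 x + g.compL 1 x := (Subtype.ext (comp_zero_add_comp_one x.1)).symm
  rw [hx]
  exact add _ _ (hom 0 _ (homog_comp 0 x.1)) (hom 1 _ (homog_comp 1 x.1))

theorem parity_pow_mul_self (ρ : SuperRep g W) (k : ℕ) (w : W) :
    (ρ.parity ^ k) ((ρ.parity ^ k) w) = w := by
  rw [← Module.End.mul_apply, ← pow_add, ← two_mul, pow_mul, sq, ρ.parity_sq, one_pow,
    Module.End.one_apply]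

variable {ι₁ ι₂ : Type*} (B : TriBasis h ι₁ ι₂)

/-- The span of the `w ⊗ f v`, for `f` a monomial in some but not all of the factors listed in
`l`. -/
def TriBasis.lowerTensor (W : Type*) [AddCommGroup W] [Module K W] (τ : SuperRep b V)
    (l : List ι₁) : Submodule K (W ⊗[K] Ind h τ) :=
  Submodule.span K {t | ∃ (w : W) (v : V) (l' : List ι₁), l'.Sublist l ∧ l'.length < l.length ∧
    t = w ⊗ₜ[K] (indRep h τ).env (mon B.xn l') (indGen h τ v)}

/-- The sum of the parities of the factors of a monomial. -/
def TriBasis.deg (l : List ι₁) : ℕ := (l.map fun a => (B.pn a).val).sum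

/-- The leading term of `f (w ⊗ v)` is `± w ⊗ f v`. -/
theorem TriBasis.mon_tmul_sub_mem (ρ : SuperRep g W) (τ : SuperRep b V) (l : List ι₁) (w : W)
    (v : V) : (ρ.tensor (indRep h τ)).env (mon B.xn l) (w ⊗ₜ[K] indGen h τ v)
      - (ρ.parity ^ B.deg l) w ⊗ₜ[K] (indRep h τ).env (mon B.xn l) (indGen h τ v)
      ∈ B.lowerTensor W τ l := by
  induction l with
  | nil => simp [TriBasis.deg]
  | cons a l ih =>
    have h1 : B.lowerTensor W τ l ≤ (B.lowerTensor W τ (a :: l)).comap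
        ((ρ.tensor (indRep h τ)).act (B.xn a)) := by
      refine Submodule.span_le.2 ?_
      rintro _ ⟨w, v, l', hl', hlt, rfl⟩
      rw [SetLike.mem_coe, Submodule.mem_comap, tensor_act_tmul _ _ (B.homog_n a)]
      refine Submodule.add_mem _ (Submodule.subset_span ⟨_, v, l', hl'.cons a, ?_, rfl⟩)
        (Submodule.subset_span
          ⟨(ρ.parity ^ (B.pn a).val) w, v, a :: l', hl'.cons_cons a, ?_, ?_⟩)
      · simp only [List.length_cons]; omega
      · simp only [List.length_cons]; omega
      · rw [mon_cons, map_mul, SuperRep.env_ι, Module.End.mul_apply]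
    have h2 := h1 ih
    rw [Submodule.mem_comap, map_sub, tensor_act_tmul _ _ (B.homog_n a)] at h2
    have h3 : ρ.act (B.xn a) ((ρ.parity ^ B.deg l) w) ⊗ₜ[K]
        (indRep h τ).env (mon B.xn l) (indGen h τ v) ∈ B.lowerTensor W τ (a :: l) :=
      Submodule.subset_span ⟨_, v, l, List.sublist_cons_self a l, by simp, rfl⟩
    have h4 := Submodule.add_mem _ h2 h3
    have h5 : (ρ.parity ^ B.deg (a :: l)) w
        = (ρ.parity ^ (B.pn a).val) ((ρ.parity ^ B.deg l) w) := by
      rw [← Module.End.mul_apply, ← pow_add]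
      rfl
    rw [mon_cons, map_mul, map_mul, SuperRep.env_ι, SuperRep.env_ι, Module.End.mul_apply,
      Module.End.mul_apply, h5]
    convert h4 using 1
    abel

/-- The map `W ⊗ V → W ⊗ (U(g) ⊗_{U(b)} V)`. -/
def tensorGen (W : Type*) [AddCommGroup W] [Module K W] (h : b.carrier ≤ g.carrier)
    (τ : SuperRep b V) : W ⊗[K] V →ₗ[K] W ⊗[K] Ind h τ :=
  TensorProduct.map LinearMap.id (indGen h τ)

theorem tensorGen_tmul (τ : SuperRep b V) (w : W) (v : V) :
    tensorGen W h τ (w ⊗ₜ[K] v) = w ⊗ₜ[K] indGen h τ v := rfl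

variable [LinearOrder ι₁] [LinearOrder ι₂]

/-- The coefficient of the monomial `l` in the second factor. -/
def TriBasis.tensorCoord [CharZero K] (W : Type*) [AddCommGroup W] [Module K W]
    (τ : SuperRep b V) (l : B.Exp) : W ⊗[K] Ind h τ →ₗ[K] W ⊗[K] V :=
  TensorProduct.map LinearMap.id (Finsupp.lapply l ∘ₗ B.coord τ)

theorem TriBasis.tensorCoord_lower [CharZero K] (τ : SuperRep b V)
    {l l₀ : B.Exp} (hl : l.1.length ≤ l₀.1.length) {t : W ⊗[K] Ind h τ}
    (ht : t ∈ B.lowerTensor W τ l.1) : B.tensorCoord W τ l₀ t = 0 := by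
  have : B.lowerTensor W τ l.1 ≤ LinearMap.ker (B.tensorCoord W τ l₀) := by
    refine Submodule.span_le.2 ?_
    rintro _ ⟨w, v, l', hl', hlt, rfl⟩
    have h1 := B.coord_mon τ ⟨l', List.Pairwise.sublist hl' l.2⟩ v
    have h2 : (⟨l', List.Pairwise.sublist hl' l.2⟩ : B.Exp) ≠ l₀ := by
      rintro rfl
      exact absurd hlt (not_lt.2 hl)
    change B.tensorCoord W τ l₀ (w ⊗ₜ[K] _) = 0
    rw [tensorCoord, TensorProduct.map_tmul, LinearMap.comp_apply, h1, Finsupp.lapply_apply,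
      Finsupp.single_eq_of_ne h2.symm, TensorProduct.tmul_zero]
  exact this ht

theorem TriBasis.tensorCoord_mon [CharZero K] (ρ : SuperRep g W) (τ : SuperRep b V)
    {l l₀ : B.Exp} (hl : l.1.length ≤ l₀.1.length) (y : W ⊗[K] V) :
    B.tensorCoord W τ l₀ ((ρ.tensor (indRep h τ)).env (mon B.xn l.1) (tensorGen W h τ y))
      = if l = l₀ then TensorProduct.map (ρ.parity ^ B.deg l.1) LinearMap.id y else 0 := by
  induction y using TensorProduct.induction_on with
  | zero => simp
  | add y y' hy hy' =>
    rw [map_add, map_add, map_add, hy, hy', map_add]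
    split_ifs <;> simp
  | tmul w v =>
    have h1 := B.tensorCoord_lower τ hl (B.mon_tmul_sub_mem ρ τ l.1 w v)
    rw [map_sub, sub_eq_zero] at h1
    rw [tensorGen_tmul, h1, tensorCoord, TensorProduct.map_tmul, LinearMap.comp_apply,
      B.coord_mon, Finsupp.lapply_apply]
    split_ifs with hll
    · rw [hll, Finsupp.single_eq_same]
      rfl
    · rw [Finsupp.single_eq_of_ne (Ne.symm hll), TensorProduct.tmul_zero]

/-- `W ⊗ (U(g) ⊗_{U(b)} V)` is free on `W ⊗ V` over the PBW monomials in the complement of `b`. -/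
theorem TriBasis.eval_tensor_eq_zero [CharZero K] (ρ : SuperRep g W) (τ : SuperRep b V)
    {f : B.Exp →₀ W ⊗[K] Ind h τ} (hf : ∀ l, f l ∈ LinearMap.range (tensorGen W h τ))
    (h0 : B.eval (ρ.tensor (indRep h τ)) f = 0) : f = 0 := by
  by_contra hne
  -- compare the coefficients of a longest monomial that occurs
  obtain ⟨l₀, hl₀, hmax⟩ := Finset.exists_max_image f.support (fun l => l.1.length)
    (Finsupp.support_nonempty_iff.2 hne)
  have h1 := congrArg (B.tensorCoord W τ l₀) h0
  rw [TriBasis.eval, Finsupp.lsum_apply, Finsupp.sum, map_sum, map_zero,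
    Finset.sum_eq_single l₀] at h1
  · obtain ⟨y, hy⟩ := hf l₀
    rw [← hy, B.tensorCoord_mon ρ τ le_rfl, if_pos rfl] at h1
    have h2 := congrArg (TensorProduct.map (ρ.parity ^ B.deg l₀.1) LinearMap.id) h1
    rw [map_zero, ← LinearMap.comp_apply, ← TensorProduct.map_comp] at h2
    have h3 : (ρ.parity ^ B.deg l₀.1) ∘ₗ (ρ.parity ^ B.deg l₀.1) = LinearMap.id :=
      LinearMap.ext fun w => parity_pow_mul_self ρ _ w
    rw [h3, LinearMap.id_comp, TensorProduct.map_id, LinearMap.id_apply] at h2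
    rw [Finsupp.mem_support_iff] at hl₀
    exact hl₀ (by rw [← hy, h2, map_zero])
  · intro l hl hll
    obtain ⟨y, hy⟩ := hf l
    rw [← hy, B.tensorCoord_mon ρ τ (hmax l hl), if_neg hll]
  · exact fun h => absurd hl₀ h

/-- `W ⊗ V` generates `W ⊗ (U(g) ⊗_{U(b)} V)`. -/
theorem mem_of_tensorGen_mem (ρ : SuperRep g W) (τ : SuperRep b V)
    {S : Submodule K (W ⊗[K] Ind h τ)} (hS : ∀ x, ∀ t ∈ S, (ρ.tensor (indRep h τ)).act x t ∈ S)
    (hgen : ∀ w v, w ⊗ₜ[K] indGen h τ v ∈ S) (t : W ⊗[K] Ind h τ) : t ∈ S := by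
  have key : ∀ (a : Env g) (v : V) (w : W), w ⊗ₜ[K] (indRep h τ).env a (indGen h τ v) ∈ S := by
    intro a v
    induction a using env_induction with
    | one => intro w; simpa using hgen w v
    | add a c ha hc =>
      intro w
      rw [map_add, LinearMap.add_apply, TensorProduct.tmul_add]
      exact S.add_mem (ha w) (hc w)
    | smul c a ha =>
      intro w
      rw [map_smul, LinearMap.smul_apply, TensorProduct.tmul_smul]
      exact S.smul_mem c (ha w)
    | mul x a ha =>
      intro w
      induction x using homog_induction with
      | hom p y hy =>
        have h1 := hS y _ (ha ((ρ.parity ^ p.val) w))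
        rw [tensor_act_tmul _ _ hy, parity_pow_mul_self] at h1
        rw [map_mul, SuperRep.env_ι, Module.End.mul_apply]
        exact (Submodule.add_mem_iff_right _ (ha _)).1 h1
      | add y z hy hz =>
        rw [map_add, add_mul, map_add, LinearMap.add_apply, TensorProduct.tmul_add]
        exact S.add_mem hy hz
  induction t using TensorProduct.induction_on with
  | zero => exact S.zero_mem
  | add t t' ht ht' => exact S.add_mem ht ht'
  | tmul w m =>
    induction m using ind_induction with
    | gen a v => exact key a v w
    | add m m' hm hm' => rw [TensorProduct.tmul_add]; exact S.add_mem hm hm'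

end tensor

/-! ### The standard basis of `g` -/

section basis
variable {K : Type*} [Field K] {N : ℕ}

/-- The basis vector of `K^{N|N}` of parity `p` in position `s`. -/
def sgl (p : ZMod 2) (s : Fin N) : Idx N := if p = 0 then .inl s else .inr s

@[simp] theorem par_sgl (p : ZMod 2) (s : Fin N) : par (sgl p s) = p := by
  rcases zmod2_cases p with rfl | rfl <;> simp [sgl, par]

@[simp] theorem pos_sgl (p : ZMod 2) (s : Fin N) : pos (sgl p s) = s := by
  rcases zmod2_cases p with rfl | rfl <;> simp [sgl, pos]

theorem idx_ext {i j : Idx N} (h1 : par i = par j) (h2 : pos i = pos j) : i = j := by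
  rcases i with i | i <;> rcases j with j | j <;> simp_all [par, pos]

/-- The elements `e_{r,s}` (for `p = 0`) and `e'_{r,s}` (for `p = 1`), for all `r, s ≤ N`. -/
def qMat (K : Type*) [Field K] (p : ZMod 2) (r s : Fin N) : Mat K N :=
  Matrix.of fun i j => if pos i = r ∧ pos j = s ∧ par i + par j = p then 1 else 0

theorem qMat_apply (p : ZMod 2) (r s : Fin N) (i j : Idx N) :
    qMat K p r s i j = if pos i = r ∧ pos j = s ∧ par i + par j = p then 1 else 0 := rfl

theorem homog_qMat (p : ZMod 2) (r s : Fin N) : Homog p (qMat K p r s) := by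
  intro i j h
  rw [qMat_apply, if_neg fun h' => h h'.2.2]

theorem qMat_mul (p q : ZMod 2) (r s t u : Fin N) :
    qMat K p r s * qMat K q t u = if s = t then qMat K (p + q) r u else 0 := by
  ext i j
  rw [Matrix.mul_apply]
  have key : ∀ k : Idx N, k ≠ sgl (p + par i) s → qMat K p r s i k = 0 := by
    intro k hk
    rw [qMat_apply, if_neg]
    rintro ⟨-, h2, h3⟩
    refine hk (idx_ext ?_ ?_)
    · rw [par_sgl, ← h3, add_right_comm, CharTwo.add_self_eq_zero, zero_add]
    · rw [pos_sgl, h2]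
  rw [Finset.sum_eq_single (sgl (p + par i) s) (fun k _ hk => by rw [key k hk, zero_mul])
    (by simp)]
  have h1 : par i + (p + par i) = p := by
    rw [add_left_comm, CharTwo.add_self_eq_zero, add_zero]
  have h2 : (p + par i + par j = q) ↔ par i + par j = p + q := by
    constructor
    · rintro rfl
      rw [add_assoc, ← add_assoc p p, CharTwo.add_self_eq_zero, zero_add]
    · intro h
      rw [add_assoc, h, ← add_assoc, CharTwo.add_self_eq_zero, zero_add]
  simp only [qMat_apply, pos_sgl, par_sgl, h1, h2]
  by_cases hst : s = t
  · rw [if_pos hst, qMat_apply]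
    by_cases hr : pos i = r <;> simp [hst, hr]
  · simp [hst]

theorem qMat_mem {R : Fin N → Fin N → Prop} (p : ZMod 2) {r s : Fin N} (h : R r s) :
    qMat K p r s ∈ blockSpace K R := by
  refine ⟨fun r' s' => ?_, fun r' s' => ?_, fun i j hij => ?_⟩
  · simp [qMat_apply, pos, par, show (1 : ZMod 2) + 1 = 0 from by decide]
  · simp [qMat_apply, pos, par]
  · rw [qMat_apply, if_neg]
    rintro ⟨h1, h2, -⟩
    rw [h1, h2] at hij
    exact hij h

theorem eq_sum_qMat {R : Fin N → Fin N → Prop} {y : Mat K N} (hy : y ∈ blockSpace K R) :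
    y = ∑ p : ZMod 2, ∑ r, ∑ s, y (.inl r) (sgl p s) • qMat K p r s := by
  ext i j
  simp only [Matrix.sum_apply, Matrix.smul_apply, qMat_apply, smul_eq_mul]
  rw [Finset.sum_eq_single (par i + par j), Finset.sum_eq_single (pos i),
    Finset.sum_eq_single (pos j)]
  · rcases i with i | i <;> rcases j with j | j <;>
      simp [pos, par, sgl, hy.1, hy.2.1, show (1 : ZMod 2) + 1 = 0 from by decide]
  · intro s _ hs
    rw [if_neg fun h => hs h.2.1.symm, mul_zero]
  · simp
  · intro r _ hr
    refine Finset.sum_eq_zero fun s _ => ?_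
    rw [if_neg fun h => hr h.1.symm, mul_zero]
  · simp
  · intro p _ hp
    refine Finset.sum_eq_zero fun r _ => Finset.sum_eq_zero fun s _ => ?_
    rw [if_neg fun h => hp h.2.2.symm, mul_zero]
  · simp

variable (K) in
/-- `e_{r,s}` and `e'_{r,s}` as elements of `g`. -/
def qG {n : ℕ} (p : ZMod 2) (r s : Fin (2 * halfUp n)) (h : gRel n r s) : (gAlg K n).carrier :=
  ⟨qMat K p r s, qMat_mem p h⟩

variable (K) in
/-- `e_{r,s}` and `e'_{r,s}` as elements of `b`, for `r ≤ s`. -/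
def qB {n : ℕ} (p : ZMod 2) (r s : Fin (2 * halfUp n)) (h : gRel n r s ∧ r ≤ s) :
    (bAlg K n).carrier :=
  ⟨qMat K p r s, qMat_mem (R := fun r s => gRel n r s ∧ r ≤ s) p h⟩

theorem span_of_qMat {R : Fin N → Fin N → Prop} {L : SubSuperalgebra K N}
    (hL : L.carrier = blockSpace K R) (S : Submodule K L.carrier)
    (hS : ∀ p r s, ∀ h : R r s, (⟨qMat K p r s, hL ▸ qMat_mem p h⟩ : L.carrier) ∈ S) :
    S = ⊤ := by
  rw [eq_top_iff]
  rintro ⟨y, hy⟩ -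
  have hmem : y ∈ S.map L.carrier.subtype := by
    have hy' : y ∈ blockSpace K R := hL ▸ hy
    rw [eq_sum_qMat hy']
    refine Submodule.sum_mem _ fun p _ => Submodule.sum_mem _ fun r _ =>
      Submodule.sum_mem _ fun s _ => ?_
    by_cases h : R r s
    · exact Submodule.smul_mem _ _ ⟨_, hS p r s h, rfl⟩
    · rw [hy'.2.2 (.inl r) (sgl p s) (by rw [pos_sgl]; exact h), zero_smul]
      exact Submodule.zero_mem _
  obtain ⟨z, hz, rfl⟩ := hmem
  exact hz

theorem gAlg_submodule_eq_top {n : ℕ} (S : Submodule K (gAlg K n).carrier)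
    (hS : ∀ p r s h, qG K p r s h ∈ S) : S = ⊤ := span_of_qMat rfl S hS

theorem bAlg_submodule_eq_top {n : ℕ} (S : Submodule K (bAlg K n).carrier)
    (hS : ∀ p r s h, qB K p r s h ∈ S) : S = ⊤ :=
  span_of_qMat (R := fun r s => gRel n r s ∧ r ≤ s) rfl S hS

/-- The indices of the strictly lower triangular basis elements of `g`. -/
def NegIdx (n : ℕ) :=
  {q : ZMod 2 × Fin (2 * halfUp n) × Fin (2 * halfUp n) // gRel n q.2.1 q.2.2 ∧ q.2.2 < q.2.1}

/-- The indices of the basis elements of `b`. -/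
def BorelIdx (n : ℕ) :=
  {q : ZMod 2 × Fin (2 * halfUp n) × Fin (2 * halfUp n) // gRel n q.2.1 q.2.2 ∧ q.2.1 ≤ q.2.2}

instance (n : ℕ) : Finite (NegIdx n) := Subtype.finite

instance (n : ℕ) : Finite (BorelIdx n) := Subtype.finite

-- The PBW theorem holds for every order on the basis.
instance (n : ℕ) : LinearOrder (NegIdx n) :=
  LinearOrder.lift' (Finite.equivFin (NegIdx n)) (Equiv.injective _)

instance (n : ℕ) : LinearOrder (BorelIdx n) :=
  LinearOrder.lift' (Finite.equivFin (BorelIdx n)) (Equiv.injective _)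

variable (K) in
/-- The standard basis of `g`, adapted to `b`. -/
def stdBasis (n : ℕ) : TriBasis (bAlg_le K n) (NegIdx n) (BorelIdx n) where
  xn a := qG K a.1.1 a.1.2.1 a.1.2.2 a.2.1
  xb a := qB K a.1.1 a.1.2.1 a.1.2.2 a.2
  pn a := a.1.1
  pb a := a.1.1
  homog_n a := homog_qMat _ _ _
  homog_b a := homog_qMat _ _ _
  span_b := bAlg_submodule_eq_top _ fun p r s h => Submodule.subset_span ⟨⟨(p, r, s), h⟩, rfl⟩
  span_g := gAlg_submodule_eq_top _ fun p r s h => by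
    rcases lt_or_ge s r with hsr | hrs
    · exact Submodule.subset_span ⟨Sum.inl ⟨(p, r, s), h, hsr⟩, rfl⟩
    · exact Submodule.subset_span ⟨Sum.inr ⟨(p, r, s), h, hrs⟩, rfl⟩
  dual :=
    { coord := Sum.elim
        (fun a => Matrix.entryLinearMap K K (Sum.inl a.1.2.1) (sgl a.1.1 a.1.2.2))
        (fun a => Matrix.entryLinearMap K K (Sum.inl a.1.2.1) (sgl a.1.1 a.1.2.2))
      coord_self := by
        rintro (a | a)
        all_goals
          change qMat K _ _ _ _ _ = 1
          rw [qMat_apply, if_pos]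
          exact ⟨rfl, pos_sgl _ _, by rw [par_sgl]; exact zero_add _⟩
      coord_ne := by
        have key : ∀ (q q' : ZMod 2 × Fin (2 * halfUp n) × Fin (2 * halfUp n)), q ≠ q' →
            qMat K q'.1 q'.2.1 q'.2.2 (Sum.inl q.2.1) (sgl q.1 q.2.2) = 0 := by
          intro q q' hne
          rw [qMat_apply, if_neg]
          rintro ⟨h1, h2, h3⟩
          rw [pos_sgl] at h2
          rw [par_sgl] at h3
          exact hne (Prod.ext (by rw [← h3]; exact (zero_add _).symm) (Prod.ext h1 h2))
        rintro (a | a) (c | c) hac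
        · exact key _ _ fun h => hac (congrArg Sum.inl (Subtype.ext h))
        · refine key _ _ fun h => ?_
          have := a.2.2
          rw [h] at this
          exact absurd this (not_lt.2 c.2.2)
        · refine key _ _ fun h => ?_
          have := c.2.2
          rw [← h] at this
          exact absurd this (not_lt.2 a.2.2)
        · exact key _ _ fun h => hac (congrArg Sum.inr (Subtype.ext h))
      coord_par := by
        rintro (a | a)
        all_goals
          refine LinearMap.ext fun y => ?_
          change parMat y _ _ = _ * y _ _
          rw [parMat_apply, par_sgl]
          congr 3
          exact zero_add _ }

end basis

/-! ### The action of the Cartan subalgebra -/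

section cartan
variable {K : Type*} [Field K] {n : ℕ}

/-- The action of `d_r` (for `p = 0`) or `d'_r` (for `p = 1`) on `V(b)`. -/
def cartanOp (C : Choices K n) (b : Fin n → ℤ) (p : ZMod 2) (r : Fin (2 * halfUp n)) :
    Module.End K (VSpace K n) :=
  if p = 0 then C.wt b r • 1 else C.wtRoot b r • cliffOp C.imag r

theorem bRep_act_qB (C : Choices K n) (b : Fin n → ℤ) (p : ZMod 2) (r s : Fin (2 * halfUp n))
    (h : gRel n r s ∧ r ≤ s) :
    (bRep C b).act (qB K p r s h) = if r = s then cartanOp C b p r else 0 := by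
  change ∑ t, ((diagMat (qMat K p r s)) (.inl t) (.inl t) • C.wt b t •
      (1 : Module.End K (VSpace K n))
    + (diagMat (qMat K p r s)) (.inl t) (.inr t) • C.wtRoot b t • cliffOp C.imag t) = _
  simp only [diagMat_apply, qMat_apply]
  by_cases hrs : r = s
  · subst hrs
    rw [if_pos rfl, Finset.sum_eq_single r]
    · rcases zmod2_cases p with rfl | rfl <;> simp [pos, par, cartanOp]
    · intro t _ ht
      simp [pos, ht]
    · simp
  · rw [if_neg hrs]
    refine Finset.sum_eq_zero fun t _ => ?_
    have h1 : ∀ P : Prop, ¬ (t = r ∧ t = s ∧ P) := fun P h2 => hrs (h2.1.symm.trans h2.2.1)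
    simp [pos, h1]

theorem cartanOp_zero (C : Choices K n) (b : Fin n → ℤ) (r : Fin (2 * halfUp n)) :
    cartanOp C b 0 r = C.wt b r • 1 := if_pos rfl

theorem cartanOp_one (C : Choices K n) (b : Fin n → ℤ) (r : Fin (2 * halfUp n)) :
    cartanOp C b 1 r = C.wtRoot b r • cliffOp C.imag r := if_neg one_ne_zero

theorem cartanOp_one_sq (C : Choices K n) (b : Fin n → ℤ) (r : Fin (2 * halfUp n)) :
    cartanOp C b 1 r * cartanOp C b 1 r = C.wt b r • 1 := by
  rw [cartanOp_one, smul_mul_smul_comm, cliffOp_sq C.imag_sq, C.wtRoot_sq]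

theorem cartanOp_one_anti (C : Choices K n) (b b' : Fin n → ℤ) {r s : Fin (2 * halfUp n)}
    (h : r ≠ s) : cartanOp C b 1 r * cartanOp C b' 1 s
      = -(cartanOp C b' 1 s * cartanOp C b 1 r) := by
  have h1 : cliffOp (n := n) C.imag r * cliffOp C.imag s
      = -(cliffOp C.imag s * cliffOp C.imag r) := by
    rcases lt_or_gt_of_ne h with h | h
    · rw [cliffOp_anti C.imag h, neg_one_smul]
    · rw [cliffOp_anti C.imag h, neg_one_smul, neg_neg]
  rw [cartanOp_one, cartanOp_one, smul_mul_smul_comm, smul_mul_smul_comm, h1, smul_neg,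
    mul_comm (C.wtRoot b r)]

theorem parity_cartanOp_one (C : Choices K n) (b b' : Fin n → ℤ) (r : Fin (2 * halfUp n))
    (v : VSpace K n) : (bRep C b').parity (cartanOp C b 1 r v)
      = -cartanOp C b 1 r ((bRep C b').parity v) := by
  have h := LinearMap.congr_fun (cliffOp_parity (n := n) C.imag r) v
  rw [cartanOp_one, LinearMap.smul_apply, LinearMap.smul_apply, map_smul, ← smul_neg]
  exact congrArg (C.wtRoot b r • ·) (h.trans (by rw [neg_one_smul]; rfl))

end cartan

/-! ### A common frame for `U` and `U*` -/

section flag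
variable {K : Type*} [Field K] {n : ℕ}

/-- The inclusion `{1, …, n} ⊆ {1, …, 2m}`. -/
def emb (r : Fin n) : Fin (2 * halfUp n) := Fin.castLE (le_two_halfUp n) r

theorem emb_injective : Function.Injective (emb (n := n)) := Fin.castLE_injective (le_two_halfUp n)

theorem gRel_emb (r s : Fin n) : gRel n (emb r) (emb s) := Or.inl ⟨r.2, s.2⟩

/-- The index in position `k`: the indices are listed in increasing order for `U`
(`fl = false`), and in decreasing order for `U*` (`fl = true`). -/
def fpos (fl : Bool) (k : Fin n) : Fin n := if fl then Fin.rev k else k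

/-- The row of the matrix unit `flagE`. -/
def frow (fl : Bool) (a c : Fin n) : Fin n := if fl then Fin.rev c else a

/-- The column of the matrix unit `flagE`. -/
def fcol (fl : Bool) (a c : Fin n) : Fin n := if fl then Fin.rev a else c

variable (K) in
/-- The element of `g` that moves the basis vectors in position `c` of `U` (`fl = false`) or `U*`
(`fl = true`) to position `a`, up to sign. -/
def flagE (fl : Bool) (p : ZMod 2) (a c : Fin n) : (gAlg K n).carrier :=
  qG K p (emb (frow fl a c)) (emb (fcol fl a c)) (gRel_emb _ _)

theorem homog_flagE (fl : Bool) (p : ZMod 2) (a c : Fin n) : Homog p (flagE K fl p a c).1 :=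
  homog_qMat _ _ _

variable (K) in
/-- The scalar by which `flagE p a c` sends the basis vector of parity `q` in position `c` to that
of parity `p + q` in position `a`. It is also a structure constant of the `flagE`. For `p = q = 0`
it is the shift of weights: `1` for `U`, and `-1` for `U*`. -/
def flagCoef (fl : Bool) (p q : ZMod 2) : K := if fl then -ksign K p q else 1

theorem frow_le_fcol {fl : Bool} {a c : Fin n} (h : a ≤ c) : frow fl a c ≤ fcol fl a c := by
  cases fl
  · simpa [frow, fcol] using h
  · simpa [frow, fcol] using h

variable (K) in
/-- The `flagE` that lie in `b`. -/
def flagB (fl : Bool) (p : ZMod 2) (a c : Fin n) (h : a ≤ c) : (bAlg K n).carrier :=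
  qB K p (emb (frow fl a c)) (emb (fcol fl a c)) ⟨gRel_emb _ _, frow_le_fcol h⟩

variable (K) in
/-- The elements `d_r` and `d'_r` of `b`; only `r = 2m` for odd `n` is not among the `flagB`. -/
def restB (p : ZMod 2) (r : Fin (2 * halfUp n)) : (bAlg K n).carrier :=
  qB K p r r ⟨Or.inr rfl, le_rfl⟩

theorem bRep_act_flagB (C : Choices K n) (b : Fin n → ℤ) (fl : Bool) (p : ZMod 2) (a c : Fin n)
    (h : a ≤ c) : (bRep C b).act (flagB K fl p a c h)
      = if a = c then cartanOp C b p (emb (fpos fl a)) else 0 := by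
  rw [flagB, bRep_act_qB]
  by_cases hac : a = c
  · subst hac
    rw [if_pos rfl, if_pos]
    · cases fl <;> rfl
    · cases fl <;> rfl
  · rw [if_neg hac, if_neg]
    intro h1
    have := emb_injective h1
    cases fl
    · exact hac (by simpa [frow, fcol] using this)
    · exact hac (by simpa [frow, fcol] using this.symm)

theorem bRep_act_restB (C : Choices K n) (b : Fin n → ℤ) (p : ZMod 2)
    (r : Fin (2 * halfUp n)) : (bRep C b).act (restB K p r) = cartanOp C b p r := by
  rw [restB, bRep_act_qB, if_pos rfl]

theorem exists_flag_index (fl : Bool) (r s : Fin n) :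
    ∃ a c, frow fl a c = r ∧ fcol fl a c = s := by
  cases fl
  · exact ⟨r, s, rfl, rfl⟩
  · exact ⟨Fin.rev s, Fin.rev r, by simp [frow], by simp [fcol]⟩

theorem exists_emb {r : Fin (2 * halfUp n)} (h : r.1 < n) : ∃ r' : Fin n, emb r' = r :=
  ⟨⟨r.1, h⟩, rfl⟩

theorem gAlg_flag_induction (fl : Bool) (S : Submodule K (gAlg K n).carrier)
    (h1 : ∀ p a c, flagE K fl p a c ∈ S)
    (h2 : ∀ p (r : Fin (2 * halfUp n)), n ≤ r.1 → qG K p r r (Or.inr rfl) ∈ S) : S = ⊤ := by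
  refine gAlg_submodule_eq_top S fun p r s h => ?_
  by_cases hrs : r.1 < n ∧ s.1 < n
  · obtain ⟨r, rfl⟩ := exists_emb hrs.1
    obtain ⟨s, rfl⟩ := exists_emb hrs.2
    obtain ⟨a, c, rfl, rfl⟩ := exists_flag_index fl r s
    exact h1 p a c
  · obtain rfl := h.resolve_left hrs
    exact h2 p r (by omega)

theorem bAlg_flag_induction (fl : Bool) (S : Submodule K (bAlg K n).carrier)
    (h1 : ∀ p a c h, flagB K fl p a c h ∈ S)
    (h2 : ∀ p (r : Fin (2 * halfUp n)), n ≤ r.1 → restB K p r ∈ S) : S = ⊤ := by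
  refine bAlg_submodule_eq_top S fun p r s h => ?_
  by_cases hrs : r.1 < n ∧ s.1 < n
  · obtain ⟨r, rfl⟩ := exists_emb hrs.1
    obtain ⟨s, rfl⟩ := exists_emb hrs.2
    obtain ⟨a, c, rfl, rfl⟩ := exists_flag_index fl r s
    refine h1 p a c ?_
    have h3 : frow fl a c ≤ fcol fl a c := h.2
    cases fl
    · simpa [frow, fcol] using h3
    · simpa [frow, fcol] using h3
  · obtain rfl := h.1.resolve_left hrs
    exact h2 p r (by omega)

section br
variable {M : Type*} [AddCommGroup M] [Module K M] (τ : SuperRep (gAlg K n) M)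

theorem act_qG_mul (p q : ZMod 2) {r s t u : Fin (2 * halfUp n)} (h1 : gRel n r s)
    (h2 : gRel n t u) (h3 : gRel n r u) (h4 : gRel n t s) (m : M) :
    τ.act (qG K p r s h1) (τ.act (qG K q t u h2) m)
      = ksign K p q • τ.act (qG K q t u h2) (τ.act (qG K p r s h1) m)
        + (if s = t then τ.act (qG K (p + q) r u h3) m else 0)
        - (if u = r then ksign K p q • τ.act (qG K (p + q) t s h4) m else 0) := by
  have hbr : (gAlg K n).br (qG K p r s h1) (qG K q t u h2)
      = (if s = t then qG K (p + q) r u h3 else 0)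
        - (if u = r then ksign K p q • qG K (p + q) t s h4 else 0) := by
    refine Subtype.ext ?_
    change sbr (qMat K p r s) (qMat K q t u) = _
    rw [sbr_of_homog (homog_qMat _ _ _) (homog_qMat _ _ _), qMat_mul, qMat_mul, add_comm q p]
    split_ifs <;> simp [qG]
  have h := LinearMap.congr_fun
    (τ.act_br p q (qG K p r s h1) (qG K q t u h2) (homog_qMat _ _ _) (homog_qMat _ _ _)) m
  rw [hbr] at h
  have h5 : τ.act (qG K p r s h1) (τ.act (qG K q t u h2) m)
      - ksign K p q • τ.act (qG K q t u h2) (τ.act (qG K p r s h1) m)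
      = (if s = t then τ.act (qG K (p + q) r u h3) m else 0)
        - (if u = r then ksign K p q • τ.act (qG K (p + q) t s h4) m else 0) := by
    refine Eq.trans h.symm ?_
    split_ifs <;> simp
  rw [add_sub_assoc, ← h5]
  abel

theorem ksign_mul_self (p q : ZMod 2) : ksign K p q * ksign K p q = 1 := by
  rw [ksign, ← mul_pow]; simp

theorem act_flagE_mul (fl : Bool) (p q : ZMod 2) (a c k l : Fin n) (m : M) :
    τ.act (flagE K fl p a c) (τ.act (flagE K fl q k l) m)
      = ksign K p q • τ.act (flagE K fl q k l) (τ.act (flagE K fl p a c) m)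
        + (if c = k then flagCoef K fl p q • τ.act (flagE K fl (p + q) a l) m else 0)
        - (if l = a then (ksign K p q * flagCoef K fl p q) • τ.act (flagE K fl (p + q) k c) m
            else 0) := by
  cases fl
  · rw [flagE, flagE, act_qG_mul τ p q _ _ (gRel_emb _ _) (gRel_emb _ _)]
    simp only [emb_injective.eq_iff]
    simp [frow, fcol, flagCoef, flagE]
  · rw [flagE, flagE, act_qG_mul τ p q _ _ (gRel_emb _ _) (gRel_emb _ _)]
    have h1 : ∀ a c : Fin n, frow true a c = Fin.rev c := fun _ _ => rfl
    have h2 : ∀ a c : Fin n, fcol true a c = Fin.rev a := fun _ _ => rfl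
    have h3 : flagCoef K true p q = -ksign K p q := rfl
    simp only [emb_injective.eq_iff, h1, h2, h3, flagE, Fin.rev_inj, mul_neg,
      ksign_mul_self, neg_smul, one_smul, @eq_comm _ a l, @eq_comm _ k c]
    split_ifs <;> module

/-- The elements `d_{2m}` and `d'_{2m}`, for odd `n`, supercommute with the subalgebra `q_n`. -/
theorem act_rest_comm (fl : Bool) (p q : ZMod 2) {r : Fin (2 * halfUp n)} (hr : n ≤ r.1)
    (k l : Fin n) (m : M) :
    τ.act (qG K p r r (Or.inr rfl)) (τ.act (flagE K fl q k l) m)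
      = ksign K p q • τ.act (flagE K fl q k l) (τ.act (qG K p r r (Or.inr rfl)) m) := by
  have hne : ∀ k : Fin n, emb k ≠ r := fun k h => absurd (h ▸ k.2 : r.1 < n) (not_lt.2 hr)
  have hbr : (gAlg K n).br (qG K p r r (Or.inr rfl)) (flagE K fl q k l) = 0 := by
    refine Subtype.ext ?_
    change sbr (qMat K p r r) (qMat K q _ _) = 0
    rw [sbr_of_homog (homog_qMat _ _ _) (homog_qMat _ _ _), qMat_mul, qMat_mul,
      if_neg (hne _).symm, if_neg (hne _), smul_zero, sub_zero]
  have h := LinearMap.congr_fun (τ.act_br p q (qG K p r r (Or.inr rfl)) (flagE K fl q k l)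
    (homog_qMat _ _ _) (homog_qMat _ _ _)) m
  rw [hbr, map_zero] at h
  exact sub_eq_zero.1 h.symm

end br

/-- A basis of a supermodule on which the `flagE` act like matrix units, up to signs. The basis
vector of parity `q` in position `k` is `w q k`, and `coord k` is the coordinate of `w 0 k`. -/
structure Flag {W : Type*} [AddCommGroup W] [Module K W] (ρ : SuperRep (gAlg K n) W)
    (fl : Bool) where
  w : ZMod 2 → Fin n → W
  span : ∀ S : Submodule K W, (∀ q k, w q k ∈ S) → S = ⊤
  coord : Fin n → W →ₗ[K] K
  coord_w : ∀ k q d, coord k (w q d) = if q = 0 ∧ d = k then 1 else 0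
  parity_w : ∀ q k, ρ.parity (w q k) = ((-1 : K) ^ q.val) • w q k
  act_w : ∀ p q a c d, ρ.act (flagE K fl p a c) (w q d)
    = if c = d then flagCoef K fl p q • w (p + q) a else 0
  act_rest : ∀ p (r : Fin (2 * halfUp n)), n ≤ r.1 → ρ.act (qG K p r r (Or.inr rfl)) = 0

namespace Flag
variable {W : Type*} [AddCommGroup W] [Module K W] {ρ : SuperRep (gAlg K n) W} {fl : Bool}
  (F : Flag ρ fl) {M : Type*} [AddCommGroup M] [Module K M] {τ : SuperRep (gAlg K n) M}

/-- The operator `X` on `W ⊗ M` is given on the basis of `W` by the formula for `x` (on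
`U ⊗ M`) or `x*` (on `U* ⊗ M`). -/
def IsCasimir (τ : SuperRep (gAlg K n) M) (X : Module.End K (W ⊗[K] M)) : Prop :=
  ∀ q k m, X (F.w q k ⊗ₜ[K] m) = ∑ l : Fin n,
    (((-1 : K) ^ q.val) • F.w q l ⊗ₜ[K] τ.act (flagE K fl 0 k l) m
      + flagCoef K fl 1 q • F.w (q + 1) l ⊗ₜ[K] τ.act (flagE K fl 1 k l) m)

theorem tensor_ext {Q : Type*} [AddCommGroup Q] [Module K Q] {f f' : W ⊗[K] M →ₗ[K] Q}
    (h : ∀ q k m, f (F.w q k ⊗ₜ[K] m) = f' (F.w q k ⊗ₜ[K] m)) : f = f' := by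
  refine TensorProduct.ext' fun w m => ?_
  have : (LinearMap.ker ((f - f') ∘ₗ (TensorProduct.mk K W M).flip m)) = ⊤ := by
    refine F.span _ fun q k => ?_
    rw [LinearMap.mem_ker]
    exact sub_eq_zero.2 (h q k m)
  have hw : w ∈ (LinearMap.ker ((f - f') ∘ₗ (TensorProduct.mk K W M).flip m)) := by
    rw [this]; exact Submodule.mem_top
  exact sub_eq_zero.1 (LinearMap.mem_ker.1 hw)

theorem parity_pow_w (p q : ZMod 2) (k : Fin n) :
    (ρ.parity ^ p.val) (F.w q k) = ksign K p q • F.w q k := by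
  rcases zmod2_cases p with rfl | rfl
  · simp [ksign]
  · rw [ZMod.val_one, pow_one, F.parity_w, ksign, ZMod.val_one, one_mul]

theorem act_flagE_tmul (p q : ZMod 2) (a c d : Fin n) (m : M) :
    (ρ.tensor τ).act (flagE K fl p a c) (F.w q d ⊗ₜ[K] m)
      = (if c = d then flagCoef K fl p q • F.w (p + q) a ⊗ₜ[K] m else 0)
        + ksign K p q • F.w q d ⊗ₜ[K] τ.act (flagE K fl p a c) m := by
  rw [tensor_act_tmul _ _ (homog_flagE fl p a c), F.act_w, F.parity_pow_w,
    ← TensorProduct.smul_tmul']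
  split_ifs
  · rw [← TensorProduct.smul_tmul']
  · rw [TensorProduct.zero_tmul]

theorem act_rest_tmul (p q : ZMod 2) {r : Fin (2 * halfUp n)} (hr : n ≤ r.1) (d : Fin n) (m : M) :
    (ρ.tensor τ).act (qG K p r r (Or.inr rfl)) (F.w q d ⊗ₜ[K] m)
      = ksign K p q • F.w q d ⊗ₜ[K] τ.act (qG K p r r (Or.inr rfl)) m := by
  rw [tensor_act_tmul (x := qG K p r r (Or.inr rfl)) _ _ (homog_qMat _ _ _), F.act_rest p r hr,
    F.parity_pow_w, TensorProduct.smul_tmul', LinearMap.zero_apply, TensorProduct.zero_tmul,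
    zero_add]

variable {F} {X : Module.End K (W ⊗[K] M)} (hX : F.IsCasimir τ X)
include hX

theorem IsCasimir.comm_flagE (p : ZMod 2) (a c : Fin n) (t : W ⊗[K] M) :
    X ((ρ.tensor τ).act (flagE K fl p a c) t) = (ρ.tensor τ).act (flagE K fl p a c) (X t) := by
  suffices h : X ∘ₗ (ρ.tensor τ).act (flagE K fl p a c)
      = (ρ.tensor τ).act (flagE K fl p a c) ∘ₗ X from LinearMap.congr_fun h t
  refine F.tensor_ext fun q k m => ?_
  simp only [LinearMap.comp_apply]
  have hX' := hX
  unfold IsCasimir at hX'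
  rw [F.act_flagE_tmul, hX', map_add, map_sum]
  simp only [map_add, map_smul, hX', F.act_flagE_tmul, act_flagE_mul τ fl p, apply_ite (f := X),
    map_zero, TensorProduct.tmul_add, TensorProduct.tmul_sub, TensorProduct.tmul_ite, smul_add,
    smul_sub, smul_ite, smul_zero, TensorProduct.tmul_smul, Finset.sum_add_distrib,
    Finset.sum_sub_distrib, Finset.sum_ite_eq, Finset.sum_ite_eq', Finset.mem_univ, if_true,
    Finset.smul_sum, smul_smul]
  rcases zmod2_cases p with rfl | rfl <;> rcases zmod2_cases q with rfl | rfl <;> cases fl <;>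
    by_cases hck : c = k <;>
    simp only [hck, ksign, flagCoef, ZMod.val_one, ZMod.val_zero, Finset.sum_neg_distrib,
      show (1 : ZMod 2) + 1 = 0 from by decide, add_zero, zero_add, pow_zero, pow_one, mul_one,
      mul_zero, one_smul, neg_smul, mul_neg, neg_neg, if_true, if_false,
      Finset.sum_const_zero, Bool.false_eq_true]
  all_goals abel

theorem IsCasimir.comm_rest (p : ZMod 2) {r : Fin (2 * halfUp n)} (hr : n ≤ r.1)
    (t : W ⊗[K] M) : X ((ρ.tensor τ).act (qG K p r r (Or.inr rfl)) t)
      = (ρ.tensor τ).act (qG K p r r (Or.inr rfl)) (X t) := by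
  suffices h : X ∘ₗ (ρ.tensor τ).act (qG K p r r (Or.inr rfl))
      = (ρ.tensor τ).act (qG K p r r (Or.inr rfl)) ∘ₗ X from LinearMap.congr_fun h t
  refine F.tensor_ext fun q k m => ?_
  have hX' := hX
  unfold IsCasimir at hX'
  simp only [LinearMap.comp_apply, F.act_rest_tmul p _ hr, hX', map_sum, map_add, map_smul,
    act_rest_comm τ fl p _ hr, TensorProduct.tmul_smul, Finset.smul_sum]
  refine Finset.sum_congr rfl fun l _ => ?_
  rcases zmod2_cases p with rfl | rfl <;> rcases zmod2_cases q with rfl | rfl <;>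
    simp [ksign, ZMod.val_one, show (1 : ZMod 2) + 1 = 0 from by decide]

theorem IsCasimir.comm (x : (gAlg K n).carrier) (t : W ⊗[K] M) :
    X ((ρ.tensor τ).act x t) = (ρ.tensor τ).act x (X t) := by
  let S : Submodule K (gAlg K n).carrier := LinearMap.ker
    (LinearMap.llcomp K _ _ _ X ∘ₗ (ρ.tensor τ).act
      - (LinearMap.llcomp K _ _ _).flip X ∘ₗ (ρ.tensor τ).act)
  have hmem : ∀ y, (∀ t, X ((ρ.tensor τ).act y t) = (ρ.tensor τ).act y (X t)) → y ∈ S := by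
    intro y hy
    rw [LinearMap.mem_ker, LinearMap.sub_apply, sub_eq_zero]
    exact LinearMap.ext hy
  have hS : S = ⊤ := gAlg_flag_induction fl S
    (fun p a c => hmem _ (hX.comm_flagE p a c)) (fun p r hr => hmem _ (hX.comm_rest p hr))
  have hx : x ∈ S := hS ▸ Submodule.mem_top
  rw [LinearMap.mem_ker, LinearMap.sub_apply, sub_eq_zero] at hx
  exact LinearMap.congr_fun hx t

theorem IsCasimir.comm_parity (t : W ⊗[K] M) :
    X ((ρ.tensor τ).parity t) = (ρ.tensor τ).parity (X t) := by
  suffices h : X ∘ₗ (ρ.tensor τ).parity = (ρ.tensor τ).parity ∘ₗ X from LinearMap.congr_fun h t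
  refine F.tensor_ext fun q k m => ?_
  have hpar : ∀ p k l m, τ.parity (τ.act (flagE K fl p k l) m)
      = ((-1 : K) ^ p.val) • τ.act (flagE K fl p k l) (τ.parity m) := fun p k l m =>
    LinearMap.congr_fun (τ.act_parity p _ (homog_flagE fl p k l)) m
  have hten : ∀ q k m, (ρ.tensor τ).parity (F.w q k ⊗ₜ[K] m)
      = ((-1 : K) ^ q.val) • F.w q k ⊗ₜ[K] τ.parity m := fun q k m => by
    rw [TensorProduct.smul_tmul', ← F.parity_w]
    rfl
  have hX' := hX
  unfold IsCasimir at hX'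
  simp only [LinearMap.comp_apply, hten, hX', map_sum, map_add, map_smul, hpar, Finset.smul_sum,
    TensorProduct.tmul_smul]
  refine Finset.sum_congr rfl fun l _ => ?_
  rcases zmod2_cases q with rfl | rfl <;>
    simp [ZMod.val_one, show (1 : ZMod 2) + 1 = 0 from by decide]

end Flag

end flag

/-! ### Generalized eigenspaces and filtrations -/

section eigen
variable {K : Type*} [Field K] {T : Type*} [AddCommGroup T] [Module K T] {X : Module.End K T}
  {N N' : Submodule K T} {j c : K}

theorem mem_maxGenEigenspace_iff (t : T) :
    t ∈ X.maxGenEigenspace j ↔ ∃ p : ℕ, ((X - j • 1) ^ p) t = 0 := by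
  rw [Module.End.mem_maxGenEigenspace]

/-- If `X² = c ≠ j²` on `N / N'`, then the generalized `j`-eigenspace of `X` on `N` lies in `N'`. -/
theorem mem_of_maxGenEigenspace_of_ne (hN : ∀ t ∈ N, X t ∈ N)
    (hN' : ∀ t ∈ N', X t ∈ N') (hX : ∀ t ∈ N, X (X t) - c • t ∈ N') (hc : j * j ≠ c) {t : T}
    (ht : t ∈ N) (hF : t ∈ X.maxGenEigenspace j) : t ∈ N' := by
  obtain ⟨p, hp⟩ := (mem_maxGenEigenspace_iff t).1 hF
  clear hF
  induction p generalizing t with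
  | zero => rw [pow_zero, Module.End.one_apply] at hp; rw [hp]; exact N'.zero_mem
  | succ p ih =>
    -- `X² - c = (X + j)(X - j) + (j² - c)`
    have h1 : (X - j • 1) t ∈ N := N.sub_mem (hN t ht) (N.smul_mem j ht)
    rw [pow_succ, Module.End.mul_apply] at hp
    have h2 : X t - j • t ∈ N' := ih h1 hp
    have h3 := N'.add_mem (hN' _ h2) (N'.smul_mem j h2)
    have h4 := N'.sub_mem (hX t ht) h3
    have h5 : X (X t) - c • t - (X (X t - j • t) + j • (X t - j • t)) = (j * j - c) • t := by
      rw [map_sub, map_smul]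
      module
    rw [h5] at h4
    exact (N'.smul_mem_iff (sub_ne_zero.2 hc)).1 h4

/-- If `X² = j²` on `N / N'`, then `X` acts by `j` on the image of the generalized
`j`-eigenspace. -/
theorem sub_smul_mem_of_maxGenEigenspace [CharZero K] (hj : j ≠ 0) (hN : ∀ t ∈ N, X t ∈ N)
    (hX : ∀ t ∈ N, X (X t) - (j * j) • t ∈ N') {t : T}
    (ht : t ∈ N) (hF : t ∈ X.maxGenEigenspace j) : X t - j • t ∈ N' := by
  obtain ⟨p, hp⟩ := (mem_maxGenEigenspace_iff t).1 hF
  clear hF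
  have key : ∀ p : ℕ, ∀ t ∈ N, X t + j • t ∈ N' → ((X - j • 1) ^ p) t = 0 → t ∈ N' := by
    intro p
    induction p with
    | zero =>
      intro t _ _ h0
      rw [pow_zero, Module.End.one_apply] at h0
      rw [h0]
      exact N'.zero_mem
    | succ p ih =>
      intro t ht h1 h0
      rw [pow_succ, Module.End.mul_apply] at h0
      have h2 : X t - j • t ∈ N' := by
        refine ih _ (N.sub_mem (hN t ht) (N.smul_mem j ht)) ?_ h0
        convert hX t ht using 1
        rw [map_sub, map_smul]
        module
      have h3 := N'.sub_mem h1 h2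
      have h4 : X t + j • t - (X t - j • t) = (2 * j) • t := by module
      rw [h4] at h3
      exact (N'.smul_mem_iff (mul_ne_zero two_ne_zero hj)).1 h3
  refine key p _ (N.sub_mem (hN t ht) (N.smul_mem j ht)) ?_ ?_
  · convert hX t ht using 1
    rw [map_sub, map_smul]
    module
  · change ((X - j • 1) ^ p) ((X - j • 1) t) = 0
    rw [← Module.End.mul_apply, ← pow_succ, pow_succ', Module.End.mul_apply, hp, map_zero]

/-- Eigenvectors modulo a stable subspace lift to generalized eigenvectors. -/
theorem exists_lift_maxGenEigenspace {P : Polynomial K} (hP0 : P ≠ 0)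
    (hP : Polynomial.aeval X P = 0) (hN : ∀ t ∈ N, X t ∈ N) (hN' : ∀ t ∈ N', X t ∈ N') {t : T}
    (ht : t ∈ N) (hj : X t - j • t ∈ N') :
    ∃ t' ∈ N, t' ∈ X.maxGenEigenspace j ∧ t - t' ∈ N' := by
  have hstab : ∀ S : Submodule K T, (∀ t ∈ S, X t ∈ S) → ∀ (Q : Polynomial K), ∀ t ∈ S,
      Polynomial.aeval X Q t ∈ S := by
    intro S hS Q t ht
    induction Q using Polynomial.induction_on' with
    | add p q hp hq => rw [map_add]; exact S.add_mem hp hq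
    | monomial k a =>
      rw [Polynomial.aeval_monomial, Module.End.mul_apply, Module.algebraMap_end_apply]
      refine S.smul_mem a ?_
      induction k with
      | zero => simpa using ht
      | succ k ih => rw [pow_succ', Module.End.mul_apply]; exact hS _ ih
  obtain ⟨Q, hQ, hQd⟩ := Polynomial.exists_eq_pow_rootMultiplicity_mul_and_not_dvd P hP0 j
  set p := P.rootMultiplicity j
  have hcop : IsCoprime ((Polynomial.X - Polynomial.C j) ^ (p + 1)) Q := by
    refine IsCoprime.pow_left ?_
    exact (Polynomial.irreducible_X_sub_C j).coprime_iff_not_dvd.2 hQd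
  obtain ⟨A, B, hAB⟩ := hcop
  have hsum := congrArg (fun R => Polynomial.aeval X R t) hAB
  simp only [map_add, map_one, LinearMap.add_apply, Module.End.one_apply] at hsum
  have hXj : Polynomial.aeval X (Polynomial.X - Polynomial.C j) = X - j • 1 := by
    rw [map_sub, Polynomial.aeval_X, Polynomial.aeval_C, Algebra.algebraMap_eq_smul_one]
  refine ⟨Polynomial.aeval X (B * Q) t, hstab N hN _ t ht, ?_, ?_⟩
  · rw [mem_maxGenEigenspace_iff]
    refine ⟨p, ?_⟩
    rw [← hXj, ← map_pow, ← Module.End.mul_apply, ← map_mul]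
    have : (Polynomial.X - Polynomial.C j) ^ p * (B * Q) = B * P := by
      conv_rhs => rw [hQ]
      ring
    rw [this, map_mul, hP, mul_zero, LinearMap.zero_apply]
  · have h1 : t - Polynomial.aeval X (B * Q) t
        = Polynomial.aeval X (A * (Polynomial.X - Polynomial.C j) ^ p) (X t - j • t) := by
      have h2 : X t - j • t = Polynomial.aeval X (Polynomial.X - Polynomial.C j) t := by
        rw [hXj]; rfl
      rw [h2, ← Module.End.mul_apply, ← map_mul, mul_assoc, ← pow_succ, sub_eq_iff_eq_add]
      exact hsum.symm
    rw [h1]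
    exact hstab N' hN' _ _ hj

end eigen

/-! ### Sections of filtrations -/

section sec
variable {K : Type*} [Field K] {N : ℕ} {L : SubSuperalgebra K N}
  {M : Type*} [AddCommGroup M] [Module K M] {ρ : SuperRep L M}
  {M' : Type*} [AddCommGroup M'] [Module K M'] {ρ' : SuperRep L M'}

/-- A criterion for the section `Q / P` to be isomorphic to `M'`: that `M'` embeds into `M / S`
with image that of `Q`, where `P = Q ∩ S`. -/
theorem evenlyIso_sec {P Q S : SubSuperRep ρ} (hP : ∀ y ∈ Q.carrier, y ∈ P.carrier ↔ y ∈ S.carrier)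
    (α : M' →ₗ[K] M ⧸ S.carrier) (hα : Function.Injective α)
    (hpar : ∀ v, α (ρ'.parity v) = (ρ.quot S).parity (α v))
    (hact : ∀ x v, α (ρ'.act x v) = (ρ.quot S).act x (α v))
    (hsurj : ∀ v, ∃ y ∈ Q.carrier, S.carrier.mkQ y = α v)
    (hrange : ∀ y ∈ Q.carrier, ∃ v, α v = S.carrier.mkQ y) : EvenlyIso (P.sec Q) ρ' := by
  let e := LinearEquiv.ofInjective α hα
  let f : Q.carrier →ₗ[K] M' := e.symm.toLinearMap ∘ₗ
    (S.carrier.mkQ ∘ₗ Q.carrier.subtype).codRestrict (LinearMap.range α)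
      fun y => hrange y.1 y.2
  have hf : ∀ y, α (f y) = S.carrier.mkQ y.1 := by
    intro y
    have := LinearEquiv.apply_symm_apply e
      ((S.carrier.mkQ ∘ₗ Q.carrier.subtype).codRestrict (LinearMap.range α)
        (fun y => hrange y.1 y.2) y)
    exact congrArg Subtype.val this
  have hfs : Function.Surjective f := by
    intro v
    obtain ⟨y, hy, hyv⟩ := hsurj v
    exact ⟨⟨y, hy⟩, hα ((hf _).trans hyv)⟩
  have hker : P.carrier.submoduleOf Q.carrier = LinearMap.ker f := by
    ext y
    rw [LinearMap.mem_ker, ← map_eq_zero_iff α hα, hf, Submodule.mkQ_apply,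
      Submodule.Quotient.mk_eq_zero]
    exact hP y.1 y.2
  let φ := (Submodule.quotEquivOfEq _ _ hker).trans (f.quotKerEquivOfSurjective hfs)
  have hφ : ∀ y : Q.carrier, φ ((P.carrier.submoduleOf Q.carrier).mkQ y) = f y := fun y => rfl
  refine ⟨φ, fun v => ?_, fun x v => ?_⟩
  · obtain ⟨y, rfl⟩ := Submodule.mkQ_surjective _ v
    apply hα
    rw [hpar, hφ, hf]
    exact hf _
  · obtain ⟨y, rfl⟩ := Submodule.mkQ_surjective _ v
    apply hα
    rw [hact, hφ, hf]
    exact hf _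

end sec

/-! ### The filtration of `W ⊗ M(b)` -/

namespace Flag

section filtration
variable {K : Type*} [Field K] {n : ℕ} {W : Type*} [AddCommGroup W] [Module K W]
  {ρ : SuperRep (gAlg K n) W} {fl : Bool} (F : Flag ρ fl) (C : Choices K n) (b : Fin n → ℤ)

/-- The generating space `V(b) → M(b)` of a Verma supermodule. -/
abbrev vgen : VSpace K n →ₗ[K] VermaSpace C b := indGen (bAlg_le K n) (bRep C b)

/-- The basis vector of parity `q` in position `k` of `W`, tensored with a generator of `M(b)`. -/
def vec (q : ZMod 2) (k : Fin n) : VSpace K n →ₗ[K] W ⊗[K] VermaSpace C b :=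
  TensorProduct.mk K W (VermaSpace C b) (F.w q k) ∘ₗ vgen C b

theorem vec_apply (q : ZMod 2) (k : Fin n) (v : VSpace K n) :
    F.vec C b q k v = F.w q k ⊗ₜ[K] vgen C b v := rfl

/-- The span of the `w ⊗ v`, for `w` among the basis vectors in the first `k` positions and for
generators `v` of `M(b)`. -/
def base (k : ℕ) : Submodule K (W ⊗[K] VermaSpace C b) :=
  Submodule.span K {t | ∃ q, ∃ l : Fin n, l.1 < k ∧ ∃ v, t = F.vec C b q l v}

theorem vec_mem_base {k : ℕ} (q : ZMod 2) {l : Fin n} (h : l.1 < k) (v : VSpace K n) :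
    F.vec C b q l v ∈ F.base C b k := Submodule.subset_span ⟨q, l, h, v, rfl⟩

theorem base_le {k : ℕ} {S : Submodule K (W ⊗[K] VermaSpace C b)}
    (h : ∀ q (l : Fin n), l.1 < k → ∀ v, F.vec C b q l v ∈ S) : F.base C b k ≤ S := by
  refine Submodule.span_le.2 ?_
  rintro _ ⟨q, l, hl, v, rfl⟩
  exact h q l hl v

theorem parity_vec (q : ZMod 2) (k : Fin n) (v : VSpace K n) :
    (ρ.tensor (verma C b)).parity (F.vec C b q k v)
      = ((-1 : K) ^ q.val) • F.vec C b q k ((bRep C b).parity v) := by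
  change TensorProduct.map ρ.parity (verma C b).parity (F.w q k ⊗ₜ[K] vgen C b v) = _
  rw [TensorProduct.map_tmul, F.parity_w, vec_apply, TensorProduct.smul_tmul']
  congr 1
  exact indGen_parity _ v

theorem base_parity (k : ℕ) :
    ∀ t ∈ F.base C b k, (ρ.tensor (verma C b)).parity t ∈ F.base C b k := by
  change F.base C b k ≤ (F.base C b k).comap (ρ.tensor (verma C b)).parity
  refine F.base_le C b fun q l hl v => ?_
  rw [Submodule.mem_comap, F.parity_vec]
  exact Submodule.smul_mem _ _ (F.vec_mem_base C b q hl _)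

theorem act_flagB_vgen (p : ZMod 2) {a c : Fin n} (h : a ≤ c) (v : VSpace K n) :
    (verma C b).act (flagE K fl p a c) (vgen C b v)
      = if a = c then vgen C b (cartanOp C b p (emb (fpos fl a)) v) else 0 := by
  have h1 := indGen_act (h := bAlg_le K n) (bRep C b) (flagB K fl p a c h) v
  rw [bRep_act_flagB] at h1
  refine Eq.trans h1 ?_
  split_ifs <;> simp

theorem act_rest_vgen (p : ZMod 2) (r : Fin (2 * halfUp n)) (v : VSpace K n) :
    (verma C b).act (qG K p r r (Or.inr rfl)) (vgen C b v)
      = vgen C b (cartanOp C b p r v) := by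
  have h1 := indGen_act (h := bAlg_le K n) (bRep C b) (restB K p r) v
  rw [bRep_act_restB] at h1
  exact h1

theorem act_flagE_vec (p q : ZMod 2) (a c d : Fin n) (v : VSpace K n) :
    (ρ.tensor (verma C b)).act (flagE K fl p a c) (F.vec C b q d v)
      = (if c = d then flagCoef K fl p q • F.vec C b (p + q) a v else 0)
        + ksign K p q • F.w q d ⊗ₜ[K] (verma C b).act (flagE K fl p a c) (vgen C b v) :=
  F.act_flagE_tmul p q a c d _

theorem act_flagB_vec (p q : ZMod 2) {a c : Fin n} (h : a ≤ c) (d : Fin n) (v : VSpace K n) :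
    (ρ.tensor (verma C b)).act (flagE K fl p a c) (F.vec C b q d v)
      = (if c = d then flagCoef K fl p q • F.vec C b (p + q) a v else 0)
        + if a = c then ksign K p q • F.vec C b q d (cartanOp C b p (emb (fpos fl a)) v)
          else 0 := by
  rw [F.act_flagE_vec, act_flagB_vgen C b p h, vec_apply, vec_apply]
  congr 1
  split_ifs
  · rfl
  · rw [TensorProduct.tmul_zero, smul_zero]

theorem act_rest_vec (p q : ZMod 2) {r : Fin (2 * halfUp n)} (hr : n ≤ r.1) (d : Fin n)
    (v : VSpace K n) : (ρ.tensor (verma C b)).act (qG K p r r (Or.inr rfl)) (F.vec C b q d v)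
      = ksign K p q • F.vec C b q d (cartanOp C b p r v) := by
  rw [vec_apply, F.act_rest_tmul p q hr, act_rest_vgen]
  rfl

/-- The subspaces `base` are stable under `b`. -/
theorem base_stable (k : ℕ) (β : (bAlg K n).carrier) : ∀ t ∈ F.base C b k,
    (ρ.tensor (verma C b)).act (Submodule.inclusion (bAlg_le K n) β) t ∈ F.base C b k := by
  let S : Submodule K (bAlg K n).carrier :=
    { carrier := {β | ∀ t ∈ F.base C b k,
        (ρ.tensor (verma C b)).act (Submodule.inclusion (bAlg_le K n) β) t ∈ F.base C b k}
      zero_mem' := fun t _ => by simp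
      add_mem' := fun {β γ} hβ hγ t ht => by
        rw [map_add, map_add]
        exact Submodule.add_mem _ (hβ t ht) (hγ t ht)
      smul_mem' := fun c β hβ t ht => by
        rw [map_smul, map_smul]
        exact Submodule.smul_mem _ c (hβ t ht) }
  suffices h : S = ⊤ by
    have : β ∈ S := h ▸ Submodule.mem_top
    exact this
  refine bAlg_flag_induction fl S (fun p a c hac => ?_) (fun p r hr => ?_)
  · change F.base C b k ≤ (F.base C b k).comap _
    refine F.base_le C b fun q l hl v => ?_
    rw [Submodule.mem_comap]
    change (ρ.tensor (verma C b)).act (flagE K fl p a c) (F.vec C b q l v) ∈ _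
    rw [F.act_flagB_vec C b p q hac]
    refine Submodule.add_mem _ ?_ ?_
    · split_ifs with h
      · exact Submodule.smul_mem _ _
          (F.vec_mem_base C b _ (lt_of_le_of_lt (h ▸ hac : a.1 ≤ l.1) hl) v)
      · exact Submodule.zero_mem _
    · split_ifs
      · exact Submodule.smul_mem _ _ (F.vec_mem_base C b _ hl _)
      · exact Submodule.zero_mem _
  · change F.base C b k ≤ (F.base C b k).comap _
    refine F.base_le C b fun q l hl v => ?_
    rw [Submodule.mem_comap]
    change (ρ.tensor (verma C b)).act (qG K p r r (Or.inr rfl)) (F.vec C b q l v) ∈ _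
    rw [F.act_rest_vec C b p q hr]
    exact Submodule.smul_mem _ _ (F.vec_mem_base C b _ hl _)

/-- The filtration of `W ⊗ M(b)` by the subsupermodules generated by the `base`. -/
def fil (k : ℕ) : SubSuperRep (ρ.tensor (verma C b)) :=
  (ρ.tensor (verma C b)).gen (F.base C b k) (F.base_parity C b k)

theorem base_le_fil (k : ℕ) : F.base C b k ≤ (F.fil C b k).carrier :=
  SuperRep.subset_gen _ _ _

theorem vec_mem_fil {k : ℕ} (q : ZMod 2) {l : Fin n} (h : l.1 < k) (v : VSpace K n) :
    F.vec C b q l v ∈ (F.fil C b k).carrier :=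
  F.base_le_fil C b k (F.vec_mem_base C b q h v)

theorem fil_le {k : ℕ} {S : Submodule K (W ⊗[K] VermaSpace C b)}
    (hS : ∀ x, ∀ t ∈ S, (ρ.tensor (verma C b)).act x t ∈ S)
    (h : ∀ q (l : Fin n), l.1 < k → ∀ v, F.vec C b q l v ∈ S) : (F.fil C b k).carrier ≤ S :=
  SuperRep.gen_le _ _ hS (F.base_le C b h)

theorem fil_mono {k k' : ℕ} (h : k ≤ k') : (F.fil C b k).carrier ≤ (F.fil C b k').carrier :=
  F.fil_le C b (F.fil C b k').act_mem fun q _ hl v => F.vec_mem_fil C b q (lt_of_lt_of_le hl h) v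

theorem fil_zero : (F.fil C b 0).carrier = ⊥ :=
  le_bot_iff.1 (F.fil_le C b (fun x t ht => by
    rw [(Submodule.mem_bot K).1 ht, map_zero]; exact Submodule.zero_mem _)
    fun q l hl => absurd hl (Nat.not_lt_zero _))

theorem fil_last : (F.fil C b n).carrier = ⊤ := by
  rw [eq_top_iff]
  rintro t -
  refine mem_of_tensorGen_mem ρ (bRep C b) (S := (F.fil C b n).carrier)
    (F.fil C b n).act_mem (fun w v => ?_) t
  have : (F.fil C b n).carrier.comap ((TensorProduct.mk K W _).flip (vgen C b v)) = ⊤ :=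
    F.span _ fun q k => F.vec_mem_fil C b q k.2 v
  have hw : w ∈ (F.fil C b n).carrier.comap ((TensorProduct.mk K W _).flip (vgen C b v)) :=
    this ▸ Submodule.mem_top
  exact hw

variable (fl) in
/-- The eigenvalue of `X²` on the `k`th section of the filtration: `λ(λ + 1)` for `U` and
`λ(λ - 1)` for `U*`. -/
def eigval (k : Fin n) : K :=
  C.wt b (emb (fpos fl k)) * (C.wt b (emb (fpos fl k)) + flagCoef K fl 0 0)

/-- Modulo the `k`th step of the filtration, an operator that leads from an earlier position to
position `k` can be moved from the second to the first factor, up to a sign. -/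
theorem lower_tmul_mem (p q : ZMod 2) {l k : Fin n} (h : l < k) (v : VSpace K n) :
    F.w q l ⊗ₜ[K] (verma C b).act (flagE K fl p k l) (vgen C b v)
      + (ksign K p q * flagCoef K fl p q) • F.vec C b (p + q) k v ∈ (F.fil C b k).carrier := by
  have h1 := (F.fil C b k).act_mem (flagE K fl p k l) _ (F.vec_mem_fil C b q h v)
  rw [F.act_flagE_vec, if_pos rfl] at h1
  have h2 := Submodule.smul_mem _ (ksign K p q) h1
  rw [smul_add, smul_smul, smul_smul, ksign_mul_self, one_smul] at h2
  rwa [add_comm]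

variable {F C b} {X : Module.End K (W ⊗[K] VermaSpace C b)} (hX : F.IsCasimir (verma C b) X)
include hX

/-- The action of `X` on the associated graded of the filtration. The contributions of the odd and
of the even lowering operators cancel. -/
theorem IsCasimir.apply_vec (q : ZMod 2) (k : Fin n) (v : VSpace K n) :
    X (F.vec C b q k v)
      - (((-1 : K) ^ q.val * C.wt b (emb (fpos fl k))) • F.vec C b q k v
        + flagCoef K fl 1 q • F.vec C b (q + 1) k (cartanOp C b 1 (emb (fpos fl k)) v))
      ∈ (F.fil C b k).carrier := by
  have h1 := hX q k (vgen C b v)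
  rw [← Finset.add_sum_erase _ _ (Finset.mem_univ k), act_flagB_vgen C b 0 le_rfl,
    act_flagB_vgen C b 1 le_rfl, if_pos rfl, if_pos rfl, cartanOp_zero] at h1
  rw [vec_apply, h1, LinearMap.smul_apply, Module.End.one_apply, map_smul,
    TensorProduct.tmul_smul, smul_smul, vec_apply, add_sub_cancel_left]
  refine Submodule.sum_mem _ fun l hl => ?_
  rcases lt_or_gt_of_ne (Finset.ne_of_mem_erase hl) with hlt | hgt
  · have h2 := Submodule.smul_mem _ ((-1 : K) ^ q.val)
      (F.lower_tmul_mem C b 0 q hlt v)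
    have h3 := Submodule.smul_mem _ (flagCoef K fl 1 q)
      (F.lower_tmul_mem C b 1 (q + 1) hlt v)
    convert Submodule.add_mem _ h2 h3 using 1
    rcases zmod2_cases q with rfl | rfl <;> cases fl <;>
      simp [ksign, flagCoef, ZMod.val_one, show (1 : ZMod 2) + 1 = 0 from by decide] <;> abel
  · rw [act_flagB_vgen C b 0 hgt.le, act_flagB_vgen C b 1 hgt.le, if_neg hgt.ne, if_neg hgt.ne,
      TensorProduct.tmul_zero, TensorProduct.tmul_zero, smul_zero, smul_zero, add_zero]
    exact Submodule.zero_mem _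

theorem IsCasimir.fil_stable (k : ℕ) :
    ∀ t ∈ (F.fil C b k).carrier, X t ∈ (F.fil C b k).carrier := by
  change (F.fil C b k).carrier ≤ (F.fil C b k).carrier.comap X
  refine F.fil_le C b (fun x t ht => ?_) fun q l hl v => ?_
  · rw [Submodule.mem_comap, hX.comm]
    exact (F.fil C b k).act_mem x _ ht
  · have h1 := F.fil_mono C b hl.le (hX.apply_vec q l v)
    rw [Submodule.mem_comap]
    refine (Submodule.sub_mem_iff_left _ ?_).1 h1
    exact Submodule.add_mem _ (Submodule.smul_mem _ _ (F.vec_mem_fil C b _ hl _))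
      (Submodule.smul_mem _ _ (F.vec_mem_fil C b _ hl _))

/-- On the `k`th section, with `λ` the entry of the weight, `d'` the odd element of the Cartan
subalgebra in position `k`, and `κ = ±1`, the operator `X` sends `w ⊗ v` to `λ w ⊗ v + κ w' ⊗ d'v`
and `w' ⊗ v` to `-λ w' ⊗ v + w ⊗ d'v`. As `d'² = λ`, its square is `λ(λ + κ)`. -/
theorem IsCasimir.sq_vec (q : ZMod 2) (k : Fin n) (v : VSpace K n) :
    X (X (F.vec C b q k v)) - eigval fl C b k • F.vec C b q k v ∈ (F.fil C b k).carrier := by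
  have h1 := hX.fil_stable k _ (hX.apply_vec q k v)
  have h2 := Submodule.smul_mem _ ((-1 : K) ^ q.val * C.wt b (emb (fpos fl k)))
    (hX.apply_vec q k v)
  have h3 := Submodule.smul_mem _ (flagCoef K fl 1 q)
    (hX.apply_vec (q + 1) k (cartanOp C b 1 (emb (fpos fl k)) v))
  have hd : cartanOp C b 1 (emb (fpos fl k)) (cartanOp C b 1 (emb (fpos fl k)) v)
      = C.wt b (emb (fpos fl k)) • v := LinearMap.congr_fun (cartanOp_one_sq C b _) v
  rw [hd] at h3
  convert Submodule.add_mem _ h1 (Submodule.add_mem _ h2 h3) using 1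
  rcases zmod2_cases q with rfl | rfl <;> cases fl <;>
    simp only [map_sub, map_add, map_smul, eigval, ksign, flagCoef, ZMod.val_one, ZMod.val_zero,
      show (1 : ZMod 2) + 1 = 0 from by decide, zero_add, if_true, Bool.false_eq_true, if_false,
      mul_zero, mul_one, pow_zero, pow_one] <;> module

theorem IsCasimir.sq_fil (k : Fin n) : ∀ t ∈ (F.fil C b (k + 1)).carrier,
    X (X t) - eigval fl C b k • t ∈ (F.fil C b k).carrier := by
  change (F.fil C b (k + 1)).carrier
    ≤ (F.fil C b k).carrier.comap (X ∘ₗ X - eigval fl C b k • LinearMap.id)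
  refine F.fil_le C b (fun x t ht => ?_) fun q l hl v => ?_
  · have h1 := (F.fil C b k).act_mem x _ ht
    simp only [LinearMap.sub_apply, LinearMap.comp_apply, LinearMap.smul_apply,
      LinearMap.id_apply, map_sub, map_smul] at h1
    rw [← hX.comm, ← hX.comm] at h1
    exact h1
  · rcases (Nat.lt_succ_iff.1 hl).lt_or_eq with h | h
    · have h1 := F.vec_mem_fil C b q h v
      exact Submodule.sub_mem _ (hX.fil_stable k _ (hX.fil_stable k _ h1))
        (Submodule.smul_mem _ _ h1)
    · obtain rfl := Fin.ext h
      exact hX.sq_vec q l v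

/-- `X` satisfies a polynomial equation. -/
theorem IsCasimir.exists_aeval_eq_zero :
    ∃ P : Polynomial K, P ≠ 0 ∧ Polynomial.aeval X P = 0 := by
  have key : ∀ k : ℕ, k ≤ n → ∃ P : Polynomial K, P ≠ 0 ∧
      ∀ t ∈ (F.fil C b k).carrier, Polynomial.aeval X P t = 0 := by
    intro k
    induction k with
    | zero =>
      refine fun _ => ⟨1, one_ne_zero, fun t ht => ?_⟩
      rw [F.fil_zero, Submodule.mem_bot] at ht
      rw [ht, map_zero]
    | succ k ih =>
      intro hk
      obtain ⟨P, hP0, hP⟩ := ih (Nat.le_of_succ_le hk)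
      refine ⟨P * (Polynomial.X ^ 2 - Polynomial.C (eigval fl C b ⟨k, hk⟩)),
        mul_ne_zero hP0 (Polynomial.X_pow_sub_C_ne_zero two_pos _), fun t ht => ?_⟩
      rw [map_mul, Module.End.mul_apply]
      refine hP _ ?_
      rw [map_sub, map_pow, Polynomial.aeval_X, Polynomial.aeval_C,
        Algebra.algebraMap_eq_smul_one, sq]
      exact hX.sq_fil ⟨k, hk⟩ t ht
  obtain ⟨P, hP0, hP⟩ := key n le_rfl
  refine ⟨P, hP0, LinearMap.ext fun t => hP t ?_⟩
  rw [F.fil_last]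
  exact Submodule.mem_top

end filtration

end Flag

/-! ### The sections of the filtration -/

/-- An element of an induced supermodule is recovered from its coordinates. -/
theorem TriBasis.eval_coord {K : Type*} [Field K] [CharZero K] {N : ℕ}
    {g b : SubSuperalgebra K N} {h : b.carrier ≤ g.carrier} {V : Type*} [AddCommGroup V]
    [Module K V] {ι₁ ι₂ : Type*} [LinearOrder ι₁] [LinearOrder ι₂] (B : TriBasis h ι₁ ι₂)
    (τ : SuperRep b V) (w : Ind h τ) :
    B.eval (indRep h τ) ((B.coord τ w).mapRange (indGen h τ) (map_zero _)) = w := by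
  induction w using B.ind_mon_induction with
  | gen l v => rw [B.coord_mon, Finsupp.mapRange_single, TriBasis.eval_single]
  | add w w' hw hw' =>
    rw [map_add, Finsupp.mapRange_add (map_add (indGen h τ)), map_add, hw, hw']

section step
variable {K : Type*} [Field K] {n : ℕ}

/-- The weight of `b'` is obtained from that of `b` by adding `1` (for `U`) or `-1` (for `U*`) to
the entry in position `k`, and the product of the chosen square roots of the old and of the new
entry is `j`. -/
structure IsStep (fl : Bool) (C : Choices K n) (b b' : Fin n → ℤ) (k : Fin n) (j : K) :
    Prop where
  wt_eq : ∀ r, r ≠ emb (fpos fl k) → C.wt b' r = C.wt b r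
  root_eq : ∀ r, r ≠ emb (fpos fl k) → C.wtRoot b' r = C.wtRoot b r
  wt_step : C.wt b' (emb (fpos fl k)) = C.wt b (emb (fpos fl k)) + flagCoef K fl 0 0
  root_mul : C.wtRoot b' (emb (fpos fl k)) * C.wtRoot b (emb (fpos fl k)) = j
  wt_ne : C.wt b (emb (fpos fl k)) ≠ 0
  ne_zero : j ≠ 0

variable {fl : Bool} {C : Choices K n} {b b' : Fin n → ℤ} {k : Fin n} {j : K}

theorem IsStep.cartanOp_eq (h : IsStep fl C b b' k j) (p : ZMod 2) {r : Fin (2 * halfUp n)}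
    (hr : r ≠ emb (fpos fl k)) : cartanOp C b' p r = cartanOp C b p r := by
  rcases zmod2_cases p with rfl | rfl
  · rw [cartanOp_zero, cartanOp_zero, h.wt_eq r hr]
  · rw [cartanOp_one, cartanOp_one, h.root_eq r hr]

theorem IsStep.sq_eq (h : IsStep fl C b b' k j) : j * j = Flag.eigval fl C b k := by
  rw [Flag.eigval, ← h.wt_step, ← C.wtRoot_sq b, ← C.wtRoot_sq b', ← h.root_mul]
  ring

theorem IsStep.add_ne (h : IsStep fl C b b' k j) : C.wt b (emb (fpos fl k)) + j ≠ 0 := by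
  intro h0
  have h1 := h.sq_eq
  rw [Flag.eigval, eq_neg_of_add_eq_zero_right h0] at h1
  have h2 : C.wt b (emb (fpos fl k)) * flagCoef K fl 0 0 = 0 := by linear_combination -h1
  refine mul_ne_zero h.wt_ne ?_ h2
  cases fl <;> simp [flagCoef, ksign]

/-- The identity by which the odd element of the Cartan subalgebra in position `k` acts on
`jvec` as it does on `V(b')`. -/
theorem IsStep.root_add (h : IsStep fl C b b' k j) :
    C.wtRoot b (emb (fpos fl k)) * (C.wt b (emb (fpos fl k)) + j + flagCoef K fl 0 0)
      = (C.wt b (emb (fpos fl k)) + j) * C.wtRoot b' (emb (fpos fl k)) := by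
  have h1 : C.wt b (emb (fpos fl k)) + j + flagCoef K fl 0 0
      = C.wt b' (emb (fpos fl k)) + j := by rw [h.wt_step]; ring
  rw [h1, ← C.wtRoot_sq b, ← C.wtRoot_sq b', ← h.root_mul]
  ring

theorem ksign_cartanOp (C : Choices K n) (b b' : Fin n → ℤ) (p : ZMod 2)
    {r s : Fin (2 * halfUp n)} (hrs : r ≠ s) (v : VSpace K n) :
    ksign K p 1 • cartanOp C b p r (cartanOp C b' 1 s v)
      = cartanOp C b' 1 s (cartanOp C b p r v) := by
  rcases zmod2_cases p with rfl | rfl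
  · simp [cartanOp_zero, ksign]
  · have h := LinearMap.congr_fun (cartanOp_one_anti C b b' hrs) v
    simp only [Module.End.mul_apply, LinearMap.neg_apply] at h
    rw [h]
    simp [ksign, ZMod.val_one]

end step

namespace Flag

section sections
variable {K : Type*} [Field K] {n : ℕ} {W : Type*} [AddCommGroup W] [Module K W]
  {ρ : SuperRep (gAlg K n) W} {fl : Bool} (F : Flag ρ fl) (C : Choices K n) (b : Fin n → ℤ)

/-- The image of a generator under `X + j`, modulo the `k`th step of the filtration. -/
def jvec (k : Fin n) (j : K) : VSpace K n →ₗ[K] W ⊗[K] VermaSpace C b :=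
  (C.wt b (emb (fpos fl k)) + j) • F.vec C b 0 k
    + flagCoef K fl 0 0 • F.vec C b 1 k ∘ₗ cartanOp C b 1 (emb (fpos fl k))

theorem jvec_apply (k : Fin n) (j : K) (v : VSpace K n) :
    F.jvec C b k j v = (C.wt b (emb (fpos fl k)) + j) • F.vec C b 0 k v
      + flagCoef K fl 0 0 • F.vec C b 1 k (cartanOp C b 1 (emb (fpos fl k)) v) := rfl

theorem jvec_mem_fil (k : Fin n) (j : K) (v : VSpace K n) :
    F.jvec C b k j v ∈ (F.fil C b (k + 1)).carrier :=
  Submodule.add_mem _ (Submodule.smul_mem _ _ (F.vec_mem_fil C b 0 k.1.lt_succ_self _))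
    (Submodule.smul_mem _ _ (F.vec_mem_fil C b 1 k.1.lt_succ_self _))

theorem parity_jvec (b' : Fin n → ℤ) (k : Fin n) (j : K) (v : VSpace K n) :
    (ρ.tensor (verma C b)).parity (F.jvec C b k j v)
      = F.jvec C b k j ((bRep C b').parity v) := by
  have h1 : (bRep C b').parity v = (bRep C b).parity v := rfl
  rw [h1, jvec_apply, jvec_apply, map_add, map_smul, map_smul, F.parity_vec, F.parity_vec,
    parity_cartanOp_one C b b]
  simp [ZMod.val_one]

theorem base_le_range (k : ℕ) :
    F.base C b k ≤ LinearMap.range (tensorGen W (bAlg_le K n) (bRep C b)) :=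
  F.base_le C b fun q l _ v => ⟨F.w q l ⊗ₜ[K] v, rfl⟩

variable {C b} {b' : Fin n → ℤ} {k : Fin n} {j : K} (hs : IsStep fl C b b' k j)
include hs

/-- Modulo the `k`th step of the filtration, the vectors `jvec` span a copy of `V(b')`. -/
theorem jvec_act (β : (bAlg K n).carrier) (v : VSpace K n) :
    F.jvec C b k j ((bRep C b').act β v)
      - (ρ.tensor (verma C b)).act (Submodule.inclusion (bAlg_le K n) β) (F.jvec C b k j v)
      ∈ (F.fil C b k).carrier := by
  let S : Submodule K (bAlg K n).carrier :=
    (F.fil C b k).carrier.comap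
      (F.jvec C b k j ∘ₗ LinearMap.applyₗ v ∘ₗ (bRep C b').act
        - LinearMap.applyₗ (F.jvec C b k j v) ∘ₗ (ρ.tensor (verma C b)).act
          ∘ₗ Submodule.inclusion (bAlg_le K n))
  suffices h : S = ⊤ by
    have : β ∈ S := h ▸ Submodule.mem_top
    exact this
  refine bAlg_flag_induction fl S (fun p a c hac => ?_) (fun p r hr => ?_)
  · change F.jvec C b k j ((bRep C b').act (flagB K fl p a c hac) v)
      - (ρ.tensor (verma C b)).act (flagE K fl p a c) (F.jvec C b k j v) ∈ (F.fil C b k).carrier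
    rw [bRep_act_flagB, F.jvec_apply C b k j v, map_add, map_smul, map_smul,
      F.act_flagB_vec C b p 0 hac, F.act_flagB_vec C b p 1 hac]
    rcases hac.lt_or_eq with hlt | rfl
    · rw [if_neg hlt.ne, if_neg hlt.ne, if_neg hlt.ne, LinearMap.zero_apply, map_zero, zero_sub,
        add_zero, add_zero]
      refine Submodule.neg_mem _ ?_
      split_ifs with hck
      · subst hck
        refine Submodule.add_mem _ ?_ ?_ <;>
          exact Submodule.smul_mem _ _ (Submodule.smul_mem _ _ (F.vec_mem_fil C b _ hlt _))
      · simp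
    · rw [if_pos rfl, if_pos rfl, if_pos rfl]
      by_cases hak : a = k
      · subst hak
        rw [if_pos rfl, if_pos rfl]
        convert Submodule.zero_mem _ using 1
        rcases zmod2_cases p with rfl | rfl
        · simp only [cartanOp_zero, hs.wt_step, jvec_apply, LinearMap.smul_apply,
            Module.End.one_apply, map_smul]
          cases fl <;> simp [ksign, flagCoef, ZMod.val_one] <;> module
        · have h1 : cartanOp C b 1 (emb (fpos fl a)) (cartanOp C b 1 (emb (fpos fl a)) v)
              = C.wt b (emb (fpos fl a)) • v := LinearMap.congr_fun (cartanOp_one_sq C b _) v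
          have h2 : cartanOp C b 1 (emb (fpos fl a)) (cartanOp C b' 1 (emb (fpos fl a)) v)
              = j • v := by
            have := LinearMap.congr_fun (cliffOp_sq (n := n) C.imag_sq (emb (fpos fl a))) v
            rw [Module.End.mul_apply, Module.End.one_apply] at this
            rw [cartanOp_one, cartanOp_one, LinearMap.smul_apply, LinearMap.smul_apply, map_smul,
              this, smul_smul, mul_comm, hs.root_mul]
          have h3 : (C.wt b (emb (fpos fl a)) + j) • cartanOp C b' 1 (emb (fpos fl a)) v
              = (C.wt b (emb (fpos fl a)) + j + flagCoef K fl 0 0) •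
                cartanOp C b 1 (emb (fpos fl a)) v := by
            rw [cartanOp_one, cartanOp_one, LinearMap.smul_apply, LinearMap.smul_apply,
              smul_smul, smul_smul, ← hs.root_add, mul_comm]
          rw [jvec_apply, h2, ← map_smul, h3, h1]
          cases fl <;> simp [ksign, flagCoef, ZMod.val_one,
            show (1 : ZMod 2) + 1 = 0 from by decide] <;> module
      · have hne : emb (fpos fl a) ≠ emb (fpos fl k) := by
          intro h
          have := emb_injective h
          cases fl
          · exact hak this
          · exact hak (Fin.rev_injective this)
        rw [if_neg hak, if_neg hak, hs.cartanOp_eq p hne, jvec_apply,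
          ← ksign_cartanOp C b b p hne]
        convert Submodule.zero_mem _ using 1
        simp [ksign]
  · change F.jvec C b k j ((bRep C b').act (restB K p r) v)
      - (ρ.tensor (verma C b)).act (qG K p r r (Or.inr rfl)) (F.jvec C b k j v)
      ∈ (F.fil C b k).carrier
    have hne : r ≠ emb (fpos fl k) := fun h => absurd (h ▸ (fpos fl k).2 : r.1 < n) (not_lt.2 hr)
    rw [bRep_act_restB, F.jvec_apply C b k j v, map_add, map_smul, map_smul,
      F.act_rest_vec C b p 0 hr, F.act_rest_vec C b p 1 hr, hs.cartanOp_eq p hne, jvec_apply,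
      ← ksign_cartanOp C b b p hne]
    convert Submodule.zero_mem _ using 1
    simp [ksign]

/-- The homomorphism from `M(b')` to the quotient by the `k`th step of the filtration. -/
def stepHom : VermaSpace C b' →ₗ[K] (W ⊗[K] VermaSpace C b) ⧸ (F.fil C b k).carrier :=
  indLift (bRep C b') ((ρ.tensor (verma C b)).quot (F.fil C b k))
    ((F.fil C b k).carrier.mkQ ∘ₗ F.jvec C b k j) fun β v =>
      (Submodule.Quotient.eq _).2 (F.jvec_act hs β v)

theorem stepHom_act (x : (gAlg K n).carrier) (m : VermaSpace C b') :
    F.stepHom hs ((verma C b').act x m)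
      = ((ρ.tensor (verma C b)).quot (F.fil C b k)).act x (F.stepHom hs m) :=
  indLift_act _ _ _ _ x m

theorem stepHom_parity (m : VermaSpace C b') : F.stepHom hs ((verma C b').parity m)
    = ((ρ.tensor (verma C b)).quot (F.fil C b k)).parity (F.stepHom hs m) :=
  indLift_parity _ _ _ _ (fun v =>
    congrArg (F.fil C b k).carrier.mkQ (F.parity_jvec C b b' k j v).symm) m

theorem stepHom_gen (v : VSpace K n) : F.stepHom hs (vgen C b' v)
    = (F.fil C b k).carrier.mkQ (F.jvec C b k j v) := by
  have h := indLift_env_gen (bRep C b') ((ρ.tensor (verma C b)).quot (F.fil C b k))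
    ((F.fil C b k).carrier.mkQ ∘ₗ F.jvec C b k j)
    (fun β v => (Submodule.Quotient.eq _).2 (F.jvec_act hs β v)) 1 v
  rw [map_one, map_one] at h
  exact h

theorem stepHom_eval [CharZero K] (m : VermaSpace C b') : F.stepHom hs m
    = (F.fil C b k).carrier.mkQ ((stdBasis K n).eval (ρ.tensor (verma C b))
      (((stdBasis K n).coord (bRep C b') m).mapRange (F.jvec C b k j) (map_zero _))) := by
  conv_lhs => rw [← (stdBasis K n).eval_coord (bRep C b') m]
  refine (TriBasis.map_eval _ _ ((ρ.tensor (verma C b)).quot (F.fil C b k)) _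
    (F.stepHom_act hs) _).trans ?_
  rw [TriBasis.map_eval _ _ ((ρ.tensor (verma C b)).quot (F.fil C b k))
      (F.fil C b k).carrier.mkQ fun x v => rfl]
  congr 1
  ext l
  simp only [Finsupp.mapRange_apply]
  exact F.stepHom_gen hs _

/-- Freeness of `W ⊗ M(b)` over the lowering operators. -/
theorem stepHom_injective [CharZero K] : Function.Injective (F.stepHom hs) := by
  rw [injective_iff_map_eq_zero]
  intro m hm
  rw [F.stepHom_eval hs, Submodule.mkQ_apply, Submodule.Quotient.mk_eq_zero] at hm
  obtain ⟨f, hf, hmf⟩ := (stdBasis K n).exists_eval_of_mem_gen _ _ (F.base_stable C b k) hm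
  rw [← sub_eq_zero, ← map_sub] at hmf
  have hzero := (stdBasis K n).eval_tensor_eq_zero ρ (bRep C b) (fun l => ?_) hmf
  · -- The projection to the coordinate of `w 0 k` kills `base k` but not `jvec`.
    let π : W ⊗[K] VermaSpace C b →ₗ[K] VermaSpace C b :=
      (TensorProduct.lid K _).toLinearMap ∘ₗ (F.coord k).rTensor (VermaSpace C b)
    have hπ : ∀ q d v, π (F.vec C b q d v) = if q = 0 ∧ d = k then vgen C b v else 0 := by
      intro q d v
      change F.coord k (F.w q d) • vgen C b v = _
      rw [F.coord_w]
      split_ifs <;> simp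
    have hbase : F.base C b k ≤ LinearMap.ker π := F.base_le C b fun q l hl v => by
      rw [LinearMap.mem_ker, hπ, if_neg]
      rintro ⟨-, rfl⟩
      exact lt_irrefl _ hl
    have hcoord : (stdBasis K n).coord (bRep C b') m = 0 := by
      ext1 l
      have h1 := DFunLike.congr_fun hzero l
      rw [Finsupp.sub_apply, Finsupp.mapRange_apply, Finsupp.zero_apply, sub_eq_zero] at h1
      have h2 := hbase (hf l)
      rw [← h1, LinearMap.mem_ker, jvec_apply, map_add, map_smul, map_smul, hπ, hπ,
        if_pos ⟨rfl, rfl⟩, if_neg (by simp), smul_zero, add_zero] at h2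
      have h3 := (smul_eq_zero_iff_right hs.add_ne).1 h2
      exact (map_eq_zero_iff _ ((stdBasis K n).indGen_injective (bRep C b))).1 h3
    rw [← (stdBasis K n).eval_coord (bRep C b') m, hcoord, Finsupp.mapRange_zero, map_zero]
  · rw [Finsupp.sub_apply, Finsupp.mapRange_apply]
    refine Submodule.sub_mem _ ?_ (F.base_le_range C b k (hf l))
    have hvec : ∀ q v, F.vec C b q k v
        ∈ LinearMap.range (tensorGen W (bAlg_le K n) (bRep C b)) := fun q v =>
      F.base_le_range C b (k + 1) (F.vec_mem_base C b q k.1.lt_succ_self v)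
    exact Submodule.add_mem _ (Submodule.smul_mem _ _ (hvec _ _))
      (Submodule.smul_mem _ _ (hvec _ _))

end sections

end Flag

/-! ### Generalized eigenspaces of the Casimir operators -/

namespace Flag

section casimir
variable {K : Type*} [Field K] {n : ℕ} {W : Type*} [AddCommGroup W] [Module K W]
  {ρ : SuperRep (gAlg K n) W} {fl : Bool} {F : Flag ρ fl} {C : Choices K n} {b : Fin n → ℤ}
  {X : Module.End K (W ⊗[K] VermaSpace C b)} (hX : F.IsCasimir (verma C b) X)
include hX

/-- The generalized `j`-eigenspace of `X` on the `k`th step of the filtration. -/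
def IsCasimir.eigFil (j : K) (k : ℕ) : SubSuperRep (ρ.tensor (verma C b)) where
  carrier := X.maxGenEigenspace j ⊓ (F.fil C b k).carrier
  parity_mem t ht := ⟨Module.End.mapsTo_maxGenEigenspace_of_comm
    (show Commute X (ρ.tensor (verma C b)).parity from LinearMap.ext hX.comm_parity) j ht.1,
    (F.fil C b k).parity_mem t ht.2⟩
  act_mem x t ht := ⟨Module.End.mapsTo_maxGenEigenspace_of_comm
    (show Commute X ((ρ.tensor (verma C b)).act x) from LinearMap.ext (hX.comm x)) j ht.1,
    (F.fil C b k).act_mem x t ht.2⟩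

theorem IsCasimir.eigFil_mono (j : K) {k k' : ℕ} (h : k ≤ k') :
    (hX.eigFil j k).carrier ≤ (hX.eigFil j k').carrier :=
  inf_le_inf_left _ (F.fil_mono C b h)

theorem IsCasimir.eigFil_zero (j : K) : (hX.eigFil j 0).carrier = ⊥ := by
  change _ ⊓ (F.fil C b 0).carrier = _
  rw [F.fil_zero, inf_bot_eq]

theorem IsCasimir.eigFil_last (j : K) : (hX.eigFil j n).carrier = X.maxGenEigenspace j := by
  change _ ⊓ (F.fil C b n).carrier = _
  rw [F.fil_last, inf_top_eq]

theorem IsCasimir.eigFil_succ (j : K) (k : Fin n) (h : eigval fl C b k ≠ j * j) :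
    (hX.eigFil j (k + 1)).carrier = (hX.eigFil j k).carrier :=
  le_antisymm (fun _ ht => ⟨ht.1, mem_of_maxGenEigenspace_of_ne (hX.fil_stable (k + 1))
    (hX.fil_stable k) (hX.sq_fil k) h.symm ht.2 ht.1⟩) (hX.eigFil_mono j (Nat.le_succ k))

/-- The filtration of the generalized eigenspace is constant over positions at which the
eigenvalue of `X²` is not `j²`. -/
theorem IsCasimir.eigFil_eq (j : K) {k k' : ℕ} (hk : k ≤ k') (hk' : k' ≤ n)
    (h : ∀ l : Fin n, k ≤ l.1 → l.1 < k' → eigval fl C b l ≠ j * j) :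
    hX.eigFil j k' = hX.eigFil j k := by
  induction k', hk using Nat.le_induction with
  | base => rfl
  | succ k' hk ih =>
    rw [← ih (Nat.le_of_succ_le hk') fun l h1 h2 => h l h1 (h2.trans k'.lt_succ_self)]
    have h1 := hX.eigFil_succ j ⟨k', hk'⟩ (h ⟨k', hk'⟩ hk k'.lt_succ_self)
    generalize hX.eigFil j (k' + 1) = P at *
    generalize hX.eigFil j k' = P' at *
    cases P
    cases P'
    congr

variable {b' : Fin n → ℤ} {k : Fin n} {j : K} (hs : IsStep fl C b b' k j)
include hs

theorem IsCasimir.add_vec_zero (v : VSpace K n) :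
    X (F.vec C b 0 k v) + j • F.vec C b 0 k v - F.jvec C b k j v ∈ (F.fil C b k).carrier := by
  convert hX.apply_vec 0 k v using 1
  rw [jvec_apply]
  cases fl <;> simp [flagCoef, ksign] <;> module

theorem IsCasimir.sub_jvec (v : VSpace K n) :
    X (F.jvec C b k j v) - j • F.jvec C b k j v ∈ (F.fil C b k).carrier := by
  have h1 := hX.add_vec_zero hs v
  have h2 := hX.sq_vec 0 k v
  rw [← hs.sq_eq] at h2
  convert Submodule.add_mem _ h2 (Submodule.sub_mem _ (Submodule.smul_mem _ j h1)
    (hX.fil_stable k _ h1)) using 1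
  simp only [map_sub, map_add, map_smul]
  module

/-- Modulo the `k`th step of the filtration, `X + j` maps the next step into the image of
`M(b')`. -/
theorem IsCasimir.add_mem_range (t : W ⊗[K] VermaSpace C b)
    (ht : t ∈ (F.fil C b (k + 1)).carrier) :
    (F.fil C b k).carrier.mkQ (X t + j • t) ∈ LinearMap.range (F.stepHom hs) := by
  have hfil : ∀ {t}, t ∈ (F.fil C b k).carrier →
      (F.fil C b k).carrier.mkQ (X t + j • t) ∈ LinearMap.range (F.stepHom hs) := by
    intro t ht
    have h1 : (F.fil C b k).carrier.mkQ (X t + j • t) = 0 :=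
      (Submodule.Quotient.mk_eq_zero _).2
        (Submodule.add_mem _ (hX.fil_stable k t ht) (Submodule.smul_mem _ j ht))
    rw [h1]
    exact Submodule.zero_mem _
  suffices h : (F.fil C b (k + 1)).carrier ≤ (LinearMap.range (F.stepHom hs)).comap
      ((F.fil C b k).carrier.mkQ ∘ₗ (X + j • LinearMap.id)) from h ht
  refine F.fil_le C b (fun x t ht => ?_) fun q l hl v => ?_
  · obtain ⟨m, hm⟩ := ht
    refine ⟨(verma C b').act x m, ?_⟩
    rw [F.stepHom_act, hm]
    change (F.fil C b k).carrier.mkQ ((ρ.tensor (verma C b)).act x (X t + j • t))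
      = (F.fil C b k).carrier.mkQ (X ((ρ.tensor (verma C b)).act x t)
        + j • (ρ.tensor (verma C b)).act x t)
    rw [hX.comm, map_add, map_smul]
  · change (F.fil C b k).carrier.mkQ (X (F.vec C b q l v) + j • F.vec C b q l v)
      ∈ LinearMap.range (F.stepHom hs)
    rcases (Nat.lt_succ_iff.1 hl).lt_or_eq with h | h
    · exact hfil (F.vec_mem_fil C b q h v)
    obtain rfl := Fin.ext h
    rcases zmod2_cases q with rfl | rfl
    · refine ⟨vgen C b' v, ?_⟩
      rw [F.stepHom_gen]
      exact ((Submodule.Quotient.eq _).2 (hX.add_vec_zero hs v)).symm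
    · -- `(X + j)(w' ⊗ v)` is the image under `X + j` of a multiple of `w ⊗ d' v`.
      refine ⟨vgen C b' ((flagCoef K fl 0 0 * (j - C.wt b (emb (fpos fl l)))
        / C.wt b (emb (fpos fl l))) • cartanOp C b 1 (emb (fpos fl l)) v), ?_⟩
      rw [F.stepHom_gen]
      refine ((Submodule.Quotient.eq _).2 ?_).symm
      convert hX.apply_vec 1 l v using 1
      have h1 : cartanOp C b 1 (emb (fpos fl l)) (cartanOp C b 1 (emb (fpos fl l)) v)
          = C.wt b (emb (fpos fl l)) • v := LinearMap.congr_fun (cartanOp_one_sq C b _) v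
      have h2 := hs.sq_eq
      rw [eigval] at h2
      have h0 := hs.wt_ne
      have hκ : flagCoef K fl 0 0 * flagCoef K fl 0 0 = 1 := by
        cases fl <;> simp [flagCoef, ksign]
      have hc1 : flagCoef K fl 1 1 = 1 := by
        cases fl <;> simp [flagCoef, ksign, ZMod.val_one]
      rw [jvec_apply, map_smul, map_smul, map_smul, h1, hc1, map_smul]
      generalize C.wt b (emb (fpos fl l)) = lam at *
      generalize flagCoef K fl 0 0 = κ at *
      have h3 : κ * (j - lam) / lam * (lam + j) = 1 := by
        field_simp
        linear_combination κ * h2 + lam * hκ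
      have h4 : κ * (κ * (j - lam) / lam) * lam = j - lam := by
        field_simp
        linear_combination (j - lam) * hκ
      rw [smul_smul, smul_smul, smul_smul, mul_comm (lam + j), h3, h4, ZMod.val_one]
      change _ = _ - (_ + (1 : K) • F.vec C b 0 l _)
      module

/-- The image of `M(b')` consists of classes of elements on which `X` acts by `j`, modulo the
`k`th step of the filtration. -/
theorem IsCasimir.range_stepHom (m : VermaSpace C b') : ∃ y ∈ (F.fil C b (k + 1)).carrier,
    X y - j • y ∈ (F.fil C b k).carrier ∧ (F.fil C b k).carrier.mkQ y = F.stepHom hs m := by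
  let Y : Submodule K (W ⊗[K] VermaSpace C b) := (F.fil C b (k + 1)).carrier
    ⊓ (F.fil C b k).carrier.comap (X - j • LinearMap.id)
  have hY : ∀ x, ∀ t ∈ Y, (ρ.tensor (verma C b)).act x t ∈ Y := by
    rintro x t ⟨h1, h2⟩
    refine ⟨(F.fil C b (k + 1)).act_mem x t h1, ?_⟩
    have h3 := (F.fil C b k).act_mem x _ h2
    simp only [LinearMap.sub_apply, LinearMap.smul_apply, LinearMap.id_apply, map_sub, map_smul,
      ← hX.comm] at h3
    exact h3
  suffices h : ∃ y ∈ Y, (F.fil C b k).carrier.mkQ y = F.stepHom hs m by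
    obtain ⟨y, hy, hm⟩ := h
    exact ⟨y, hy.1, hy.2, hm⟩
  induction m using ind_induction with
  | gen a v =>
    refine ⟨(ρ.tensor (verma C b)).env a (F.jvec C b k j v),
      (ρ.tensor (verma C b)).env_mem hY a ⟨F.jvec_mem_fil C b k j v, hX.sub_jvec hs v⟩, ?_⟩
    rw [SuperRep.env_comm _ ((ρ.tensor (verma C b)).quot (F.fil C b k)) _ fun x v => rfl]
    exact (indLift_env_gen (bRep C b') ((ρ.tensor (verma C b)).quot (F.fil C b k))
      ((F.fil C b k).carrier.mkQ ∘ₗ F.jvec C b k j)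
      (fun β v => (Submodule.Quotient.eq _).2 (F.jvec_act hs β v)) a v).symm
  | add m m' hm hm' =>
    obtain ⟨y, hy, hm⟩ := hm
    obtain ⟨y', hy', hm'⟩ := hm'
    exact ⟨y + y', Y.add_mem hy hy', by rw [map_add, map_add, hm, hm']⟩

/-- The sections of the filtration of the generalized eigenspace are Verma supermodules. -/
theorem IsCasimir.evenlyIso [CharZero K] :
    EvenlyIso ((hX.eigFil j k).sec (hX.eigFil j (k + 1))) (verma C b') := by
  refine evenlyIso_sec (S := F.fil C b k) (fun y hy => ⟨fun h => h.2, fun h => ⟨hy.1, h⟩⟩)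
    (F.stepHom hs) (F.stepHom_injective hs) (F.stepHom_parity hs) (F.stepHom_act hs)
    (fun m => ?_) fun y hy => ?_
  · obtain ⟨P, hP0, hP⟩ := hX.exists_aeval_eq_zero
    obtain ⟨y, hy, hyj, hm⟩ := hX.range_stepHom hs m
    obtain ⟨y', hy', hyF, hyy⟩ := exists_lift_maxGenEigenspace hP0 hP (hX.fil_stable (k + 1))
      (hX.fil_stable k) hy hyj
    refine ⟨y', ⟨hyF, hy'⟩, ?_⟩
    rw [← hm]
    exact ((Submodule.Quotient.eq _).2 hyy).symm
  · have h1 : X y - j • y ∈ (F.fil C b k).carrier :=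
      sub_smul_mem_of_maxGenEigenspace hs.ne_zero (hX.fil_stable (k + 1))
        (fun t ht => by rw [hs.sq_eq]; exact hX.sq_fil k t ht) hy.2 hy.1
    have h2 : (F.fil C b k).carrier.mkQ (X y + j • y)
        = (2 * j) • (F.fil C b k).carrier.mkQ y := by
      rw [← map_smul]
      refine (Submodule.Quotient.eq _).2 ?_
      convert h1 using 1
      module
    have h3 := hX.add_mem_range hs y hy.2
    rw [h2] at h3
    exact ((LinearMap.range (F.stepHom hs)).smul_mem_iff
      (mul_ne_zero two_ne_zero hs.ne_zero)).1 h3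

end casimir

section casimir
variable {K : Type*} [Field K] [CharZero K] {n : ℕ} {W : Type*} [AddCommGroup W] [Module K W]
  {ρ : SuperRep (gAlg K n) W} {fl : Bool} {F : Flag ρ fl} {C : Choices K n} {b : Fin n → ℤ}
  {X : Module.End K (W ⊗[K] VermaSpace C b)}

/-- The filtration of the generalized eigenspace of `X`, restricted to the positions `τ l` where
it jumps. -/
theorem IsCasimir.exists_filtration (hX : F.IsCasimir (verma C b) X) {j : K} {m : ℕ}
    (τ : Fin m → Fin n) (hτ : StrictMono τ)
    (hrange : ∀ k, eigval fl C b k = j * j → k ∈ Set.range τ) (c : Fin m → Fin n → ℤ)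
    (hc : ∀ l, IsStep fl C b (c l) (τ l) j) :
    ∃ P : Fin (m + 1) → SubSuperRep (ρ.tensor (verma C b)),
      (P 0).carrier = ⊥ ∧ (P (Fin.last m)).carrier = X.maxGenEigenspace j ∧
      ∀ l : Fin m, (P l.castSucc).carrier ≤ (P l.succ).carrier ∧
        EvenlyIso ((P l.castSucc).sec (P l.succ)) (verma C (c l)) := by
  let q : Fin (m + 1) → ℕ := Fin.cases 0 fun l => (τ l).1 + 1
  have hq : ∀ i l, l.castSucc < i → (τ l).1 < q i := by
    intro i l
    refine Fin.cases (fun h => absurd h (Fin.not_lt_zero _)) (fun i h => ?_) i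
    exact Nat.lt_succ_of_le (hτ.monotone (Fin.castSucc_lt_succ_iff.1 h))
  have hq' : ∀ i l, i ≤ l.castSucc → q i ≤ (τ l).1 := by
    intro i l
    refine Fin.cases (fun _ => Nat.zero_le _) (fun i h => ?_) i
    exact hτ (Fin.succ_le_castSucc_iff.1 h)
  -- the filtration is constant between the positions `q l` and `τ l`
  have hgap : ∀ l : Fin m, hX.eigFil j (τ l) = hX.eigFil j (q l.castSucc) := by
    refine fun l => hX.eigFil_eq j (hq' _ l le_rfl) (τ l).2.le fun k h1 h2 h3 => ?_
    obtain ⟨l', rfl⟩ := hrange k h3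
    have h4 := hτ.lt_iff_lt.1 (show τ l' < τ l from h2)
    exact absurd (hq _ _ (Fin.castSucc_lt_castSucc_iff.2 h4)) (not_lt.2 h1)
  have hlast : hX.eigFil j n = hX.eigFil j (q (Fin.last m)) := by
    refine hX.eigFil_eq j ?_ le_rfl fun k h1 h2 h3 => ?_
    · exact Fin.cases (Nat.zero_le _) (fun l => (τ l).2) (Fin.last m)
    · obtain ⟨l', rfl⟩ := hrange k h3
      exact absurd (hq _ _ l'.castSucc_lt_last) (not_lt.2 h1)
  refine ⟨fun i => hX.eigFil j (q i), hX.eigFil_zero j, ?_, fun l => ⟨?_, ?_⟩⟩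
  · exact (congrArg SubSuperRep.carrier hlast.symm).trans (hX.eigFil_last j)
  · exact hX.eigFil_mono j ((hq' _ l le_rfl).trans (Nat.le_succ _))
  · change EvenlyIso ((hX.eigFil j (q l.castSucc)).sec (hX.eigFil j (τ l + 1))) _
    rw [← hgap]
    exact hX.evenlyIso (hc l)

end casimir

end Flag

/-! ### Verma supermodules with distinct weights are not isomorphic -/

section weights
variable {K : Type*} [Field K] {n : ℕ}

instance : Nontrivial (VSpace K n) := by
  let f : PiTensorProduct K (fun _ : Fin (halfUp n) => Fin 2 → K) →ₗ[K] K :=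
    PiTensorProduct.lift
      ((MultilinearMap.mkPiAlgebra K (Fin (halfUp n)) K).compLinearMap fun _ => LinearMap.proj 0)
  have h1 : f (PiTensorProduct.tprod K fun _ _ => 1) = 1 := by
    rw [PiTensorProduct.lift.tprod]
    simp
  refine ⟨⟨PiTensorProduct.tprod K fun _ _ => 1, 0, fun h => one_ne_zero (α := K) ?_⟩⟩
  rw [← h1]
  exact (congrArg f h).trans (map_zero f)

variable (K n) in
/-- The element `-∑ r d_r` of the Cartan subalgebra. Its adjoint action has negative integral
eigenvalues on the strictly lower triangular elements. -/
def gradElt : (gAlg K n).carrier :=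
  -∑ r : Fin (2 * halfUp n), (r.1 : K) • qG K 0 r r (Or.inr rfl)

theorem gradElt_val :
    (gradElt K n).1 = -∑ r : Fin (2 * halfUp n), (r.1 : K) • qMat K 0 r r := by
  simp [gradElt, qG]

theorem homog_gradElt : Homog (0 : ZMod 2) (gradElt K n).1 := by
  intro i j hij
  rw [gradElt_val, Matrix.neg_apply, Matrix.sum_apply, Finset.sum_eq_zero, neg_zero]
  intro r _
  rw [Matrix.smul_apply, homog_qMat 0 r r i j hij, smul_zero]

theorem gradElt_br (p : ZMod 2) (r s : Fin (2 * halfUp n)) (h : gRel n r s) :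
    (gAlg K n).br (gradElt K n) (qG K p r s h) = ((s.1 : K) - r.1) • qG K p r s h := by
  refine Subtype.ext ?_
  change sbr (gradElt K n).1 (qMat K p r s) = ((s.1 : K) - r.1) • qMat K p r s
  rw [sbr_of_homog homog_gradElt (homog_qMat _ _ _), gradElt_val]
  simp [Finset.sum_mul, Finset.mul_sum, qMat_mul, ksign, Finset.sum_ite_eq', Finset.sum_ite_eq]
  module

/-- The eigenvalue of `gradElt` on the generators of `M(c)`. -/
def gradWt (C : Choices K n) (c : Fin n → ℤ) : K :=
  -∑ r : Fin (2 * halfUp n), (r.1 : K) * C.wt c r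

theorem act_gradElt_gen (C : Choices K n) (c : Fin n → ℤ) (v : VSpace K n) :
    (verma C c).act (gradElt K n) (Flag.vgen C c v) = gradWt C c • Flag.vgen C c v := by
  have h : ∀ r, (verma C c).act (qG K 0 r r (Or.inr rfl)) (Flag.vgen C c v)
      = C.wt c r • Flag.vgen C c v := fun r => by
    rw [Flag.act_rest_vgen, cartanOp_zero, LinearMap.smul_apply, Module.End.one_apply, map_smul]
  rw [gradElt, gradWt, map_neg, map_sum, LinearMap.neg_apply, LinearMap.sum_apply, neg_smul,
    Finset.sum_smul]
  simp only [map_smul, LinearMap.smul_apply, h, smul_smul]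

theorem act_gradElt_mon [CharZero K] (C : Choices K n) (c : Fin n → ℤ) (l : List (NegIdx n))
    (v : VSpace K n) : ∃ N : ℕ,
      (verma C c).act (gradElt K n) ((verma C c).env (mon (stdBasis K n).xn l) (Flag.vgen C c v))
        = (gradWt C c - N) • (verma C c).env (mon (stdBasis K n).xn l) (Flag.vgen C c v) := by
  induction l with
  | nil => exact ⟨0, by simpa using act_gradElt_gen C c v⟩
  | cons a l ih =>
    obtain ⟨N, hN⟩ := ih
    refine ⟨N + (a.1.2.1.1 - a.1.2.2.1), ?_⟩
    rw [mon_cons, map_mul, SuperRep.env_ι, Module.End.mul_apply]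
    generalize (verma C c).env (mon (stdBasis K n).xn l) (Flag.vgen C c v) = m at *
    change (verma C c).act (gradElt K n) ((verma C c).act
      (qG K a.1.1 a.1.2.1 a.1.2.2 a.2.1) m) = _ • (verma C c).act
      (qG K a.1.1 a.1.2.1 a.1.2.2 a.2.1) m
    have h := LinearMap.congr_fun ((verma C c).act_br 0 a.1.1 (gradElt K n)
      (qG K a.1.1 a.1.2.1 a.1.2.2 a.2.1) homog_gradElt (homog_qMat _ _ _)) m
    rw [gradElt_br, map_smul] at h
    simp only [LinearMap.smul_apply, LinearMap.sub_apply, Module.End.mul_apply, hN, map_smul,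
      ksign, ZMod.val_zero, zero_mul, pow_zero, one_smul] at h
    rw [eq_sub_iff_add_eq] at h
    rw [← h, Nat.cast_add, Nat.cast_sub a.2.2.le]
    module

/-- The eigenvalues of `gradElt` on `M(c)` are obtained from that on the generators by subtracting
natural numbers. -/
theorem exists_of_gradElt_eigenvector [CharZero K] (C : Choices K n) (c : Fin n → ℤ) {μ : K}
    {m : VermaSpace C c} (hm : m ≠ 0) (h : (verma C c).act (gradElt K n) m = μ • m) :
    ∃ N : ℕ, μ = gradWt C c - N := by
  by_contra hne
  push Not at hne
  let H := (verma C c).act (gradElt K n)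
  have htop : ⨆ ν, ⨆ _ : ν ≠ μ, Module.End.eigenspace H ν = ⊤ := by
    rw [eq_top_iff]
    rintro w -
    induction w using (stdBasis K n).ind_mon_induction with
    | gen l v =>
      obtain ⟨N, hN⟩ := act_gradElt_mon C c l.1 v
      exact Submodule.mem_iSup_of_mem (gradWt C c - N)
        (Submodule.mem_iSup_of_mem (hne N).symm (Module.End.mem_eigenspace_iff.2 hN))
    | add w w' hw hw' => exact Submodule.add_mem _ hw hw'
  have hd := Module.End.eigenspaces_iSupIndep H μ
  rw [htop, disjoint_top] at hd
  exact hm ((Submodule.eq_bot_iff _).1 hd m (Module.End.mem_eigenspace_iff.2 h))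

theorem gradWt_eq_of_evenlyIso [CharZero K] {C : Choices K n} {c c' : Fin n → ℤ}
    (h : EvenlyIso (verma C c) (verma C c')) : gradWt C c = gradWt C c' := by
  have key : ∀ {c c' : Fin n → ℤ}, EvenlyIso (verma C c) (verma C c') →
      ∃ N : ℕ, gradWt C c = gradWt C c' - N := by
    rintro c c' ⟨φ, -, hφ⟩
    obtain ⟨v, hv⟩ := exists_ne (0 : VSpace K n)
    refine exists_of_gradElt_eigenvector C c' (m := φ (Flag.vgen C c v)) ?_ ?_
    · rw [ne_eq, φ.map_eq_zero_iff,
        map_eq_zero_iff _ ((stdBasis K n).indGen_injective (bRep C c))]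
      exact hv
    · rw [← hφ, act_gradElt_gen, map_smul]
  obtain ⟨N, hN⟩ := key h
  obtain ⟨φ, hp, hφ⟩ := h
  obtain ⟨N', hN'⟩ := key (c := c') (c' := c) ⟨φ.symm, fun v => by
    rw [LinearEquiv.symm_apply_eq, hp, φ.apply_symm_apply], fun x v => by
    rw [LinearEquiv.symm_apply_eq, hφ, φ.apply_symm_apply]⟩
  rw [hN'] at hN
  have h1 : ((N + N' : ℕ) : K) = 0 := by
    push_cast
    linear_combination hN
  have h2 : N' = 0 := by
    have := Nat.cast_eq_zero.1 h1
    omega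
  rw [hN', h2, Nat.cast_zero, sub_zero]

theorem wt_add_smul_step (C : Choices K n) (b : Fin n → ℤ) (a : ℤ) (t : Fin n)
    (r : Fin (2 * halfUp n)) :
    C.wt (b + a • C.step t) r = C.wt b r + if r = emb t then (a : K) else 0 := by
  unfold Choices.wt Choices.step
  split_ifs with h1 h2 h2
  · obtain rfl : (⟨r.1, h1⟩ : Fin n) = t := Fin.ext (show r.1 = (emb t).1 from congrArg Fin.val h2)
    rcases Int.units_eq_one_or (C.sigma ⟨r.1, h1⟩) with h | h <;> simp [h] <;> ring
  · have : (⟨r.1, h1⟩ : Fin n) ≠ t := fun h => h2 (by rw [← h]; rfl)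
    simp [this]
  · exact absurd (h2 ▸ t.2 : r.1 < n) h1
  · simp

theorem not_evenlyIso_step [CharZero K] (C : Choices K n) (b : Fin n → ℤ) {a : ℤ} (ha : a ≠ 0)
    {t t' : Fin n} (h : t ≠ t') :
    ¬ EvenlyIso (verma C (b + a • C.step t)) (verma C (b + a • C.step t')) := by
  intro he
  have key : ∀ t, gradWt C (b + a • C.step t) = gradWt C b - a * (t.1 : K) := by
    intro t
    simp only [gradWt, wt_add_smul_step, mul_add, Finset.sum_add_distrib, mul_ite, mul_zero,
      Finset.sum_ite_eq', Finset.mem_univ, if_true]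
    change _ = _ - (a : K) * ((emb t).1 : K)
    ring
  have h1 := gradWt_eq_of_evenlyIso he
  rw [key, key, sub_right_inj] at h1
  have h2 := mul_left_cancel₀ (Int.cast_ne_zero.2 ha) h1
  exact h (Fin.ext (Nat.cast_injective h2))

end weights

/-! ### The supermodules `U` and `U*` -/

section modules
variable {K : Type*} [Field K] {n : ℕ}

theorem pos_embU (i : Idx n) : pos (embU n i) = emb (pos i) := by
  rcases i with i | i <;> rfl

theorem eq_sgl_iff {N : ℕ} {i : Idx N} {q : ZMod 2} {k : Fin N} :
    i = sgl q k ↔ pos i = k ∧ par i = q :=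
  ⟨fun h => by rw [h, pos_sgl, par_sgl]; exact ⟨rfl, rfl⟩,
    fun h => idx_ext (by rw [par_sgl, h.2]) (by rw [pos_sgl, h.1])⟩

theorem eMat_eq (r s : Fin n) : eMat K r s = qMat K 0 (emb r) (emb s) := by
  ext i j
  have h : (1 : ZMod 2) + 1 = 0 := by decide
  rw [qMat_apply]
  rcases i with i | i <;> rcases j with j | j <;>
    simp [h, eMat, unit, embU, Matrix.single_apply, par, pos, emb, eq_comm]

theorem eMat'_eq (r s : Fin n) : eMat' K r s = qMat K 1 (emb r) (emb s) := by
  ext i j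
  rw [qMat_apply]
  rcases i with i | i <;> rcases j with j | j <;>
    simp [eMat', unit, embU, Matrix.single_apply, par, pos, emb, eq_comm]

theorem eG_eq (r s : Fin n) : eG K r s = qG K 0 (emb r) (emb s) (gRel_emb r s) :=
  Subtype.ext (eMat_eq r s)

theorem eG'_eq (r s : Fin n) : eG' K r s = qG K 1 (emb r) (emb s) (gRel_emb r s) :=
  Subtype.ext (eMat'_eq r s)

/-- The restriction of `x` to `U` maps the `s`th to the `r`th basis vectors, shifts the parity by
`p`, and involves the scalars `c`. -/
def IsUnitLike (x : Mat K (2 * halfUp n)) (p : ZMod 2) (r s : Fin n) (c : ZMod 2 → K) : Prop :=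
  ∀ i j, x (embU n i) (embU n j)
    = if pos i = r ∧ pos j = s ∧ par i = par j + p then c (par i) else 0

theorem isUnitLike_qMat (p : ZMod 2) (r s : Fin n) :
    IsUnitLike (qMat K p (emb r) (emb s)) p r s fun _ => 1 := by
  intro i j
  have h : ∀ a b p : ZMod 2, a + b = p ↔ a = b + p := by decide
  rw [qMat_apply, pos_embU, pos_embU, par_embU, par_embU]
  simp only [emb_injective.eq_iff, h]

theorem isUnitLike_fMat (r s : Fin n) :
    IsUnitLike (fMat K r s) 0 r s fun q => (-1) ^ q.val := by
  intro i j
  have h : Function.Injective (Fin.castLE (le_two_halfUp n)) := emb_injective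
  rcases i with i | i <;> rcases j with j | j <;>
    simp [fMat, unit, embU, Matrix.single_apply, par, pos, eq_comm, ZMod.val_one, h.eq_iff]
  split_ifs <;> simp

theorem isUnitLike_fMat' (r s : Fin n) :
    IsUnitLike (fMat' K r s) 1 r s fun q => (-1) ^ q.val := by
  intro i j
  have h : Function.Injective (Fin.castLE (le_two_halfUp n)) := emb_injective
  rcases i with i | i <;> rcases j with j | j <;>
    simp [fMat', unit, embU, Matrix.single_apply, par, pos, eq_comm, ZMod.val_one, h.eq_iff,
      show (1 : ZMod 2) + 1 = 0 from by decide]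
  split_ifs <;> simp

/-- The standard basis vectors of `U`. -/
def uvec (K : Type*) [Field K] {n : ℕ} (q : ZMod 2) (k : Fin n) : USpace K n :=
  Pi.single (sgl q k) 1

/-- The vectors of the dual basis of `U*`. -/
def udual (K : Type*) [Field K] {n : ℕ} (q : ZMod 2) (k : Fin n) : UDual K n :=
  (LinearMap.proj (sgl q k) : Module.Dual K (USpace K n))

theorem IsUnitLike.actU_uvec {x : Mat K (2 * halfUp n)} {p : ZMod 2} {r s : Fin n}
    {c : ZMod 2 → K} (hx : IsUnitLike x p r s c) (q : ZMod 2) (d : Fin n) :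
    actU K n x (uvec K q d) = if s = d then c (q + p) • uvec K (q + p) r else 0 := by
  change Matrix.toLin' _ (Pi.single _ _) = _
  rw [Matrix.toLin'_apply, Matrix.mulVec_single_one]
  funext i
  change x (embU n i) (embU n (sgl q d)) = _
  rw [hx, pos_sgl, par_sgl, apply_ite (fun u : USpace K n => u i)]
  simp only [uvec, Pi.smul_apply, Pi.single_apply, eq_sgl_iff, Pi.zero_apply]
  by_cases h1 : pos i = r <;> by_cases h2 : d = s <;> by_cases h3 : par i = q + p <;>
    simp [h1, h2, h3]
  all_goals simp [Ne.symm h2]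

/-- Evaluation of linear forms at a standard basis vector. -/
def evalU (j : Idx n) : UDual K n →ₗ[K] K := Module.Dual.eval K (USpace K n) (Pi.single j 1)

theorem udual_ext {φ ψ : UDual K n} (h : ∀ j, evalU j φ = evalU j ψ) : φ = ψ :=
  (Pi.basisFun K (Idx n)).ext fun j => by
    rw [Pi.basisFun_apply]
    exact h j

theorem evalU_udual (j : Idx n) (q : ZMod 2) (k : Fin n) :
    evalU j (udual K q k) = if pos j = k ∧ par j = q then 1 else 0 := by
  change (Pi.single j 1 : USpace K n) (sgl q k) = _
  rw [Pi.single_apply]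
  simp only [@eq_comm _ (sgl q k), eq_sgl_iff]

theorem evalU_transU (j : Idx n) (x : Mat K (2 * halfUp n)) (q : ZMod 2) (k : Fin n) :
    evalU j (transU (actU K n x) (udual K q k)) = x (embU n (sgl q k)) (embU n j) := by
  change (Matrix.toLin' (x.submatrix (embU n) (embU n)) (Pi.single j 1)) (sgl q k) = _
  rw [Matrix.toLin'_apply, Matrix.mulVec_single_one]
  rfl

theorem IsUnitLike.transU_udual {x : Mat K (2 * halfUp n)} {p : ZMod 2} {r s : Fin n}
    {c : ZMod 2 → K} (hx : IsUnitLike x p r s c) (q : ZMod 2) (a : Fin n) :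
    transU (actU K n x) (udual K q a) = if r = a then c q • udual K (q + p) s else 0 := by
  refine udual_ext fun j => ?_
  have h3 : ∀ a b p : ZMod 2, a = b + p ↔ b = a + p := by decide
  rw [evalU_transU, hx, pos_sgl, par_sgl, apply_ite (evalU j), map_smul, evalU_udual,
    map_zero]
  simp only [h3 q]
  by_cases h4 : r = a
  · simp [h4]
  · rw [if_neg h4, if_neg fun h => h4 h.1.symm]

theorem actU_rest (p : ZMod 2) {r : Fin (2 * halfUp n)} (hr : n ≤ r.1) :
    actU K n (qMat K p r r) = 0 := by
  have : (qMat K p r r).submatrix (embU n) (embU n) = 0 := by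
    ext i j
    rw [Matrix.submatrix_apply, qMat_apply, if_neg]
    · rfl
    · rintro ⟨h, -⟩
      exact absurd (h ▸ pos_embU_lt i) (not_lt.2 hr)
  change Matrix.toLin' ((qMat K p r r).submatrix (embU n) (embU n)) = 0
  rw [this, map_zero]

theorem parU_uvec (q : ZMod 2) (k : Fin n) :
    parU K n (uvec K q k) = ((-1 : K) ^ q.val) • uvec K q k := by
  change Matrix.toLin' _ (Pi.single _ _) = _ • Pi.single _ _
  rw [Matrix.toLin'_apply, Matrix.diagonal_mulVec_single, par_sgl, ← Pi.single_smul, smul_eq_mul]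

theorem parUDual_udual (q : ZMod 2) (k : Fin n) :
    parUDual K n (udual K q k) = ((-1 : K) ^ q.val) • udual K q k := by
  refine LinearMap.ext fun u => ?_
  change (Matrix.toLin' _ u) (sgl q k) = (-1 : K) ^ q.val * u (sgl q k)
  rw [Matrix.toLin'_apply, Matrix.mulVec_diagonal, par_sgl]

theorem sgl_par_pos {N : ℕ} (i : Idx N) : sgl (par i) (pos i) = i :=
  (eq_sgl_iff.2 ⟨rfl, rfl⟩).symm

/-- The standard basis of `U`. -/
def natFlag (K : Type*) [Field K] (n : ℕ) : Flag (natRep K n) false where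
  w q k := uvec K q k
  span S hS := by
    refine eq_top_iff.2 ((Pi.basisFun K (Idx n)).span_eq.symm.le.trans (Submodule.span_le.2 ?_))
    rintro _ ⟨i, rfl⟩
    rw [Pi.basisFun_apply, ← sgl_par_pos i]
    exact hS _ _
  coord k := LinearMap.proj (sgl 0 k)
  coord_w k q d := by
    change (Pi.single (sgl q d) 1 : USpace K n) (sgl 0 k) = _
    rw [Pi.single_apply]
    simp only [eq_sgl_iff, pos_sgl, par_sgl]
    congr 1
    exact propext ⟨fun h => ⟨h.2.symm, h.1.symm⟩, fun h => ⟨h.2.symm, h.1.symm⟩⟩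
  parity_w := parU_uvec
  act_w p q a c d := by
    refine ((isUnitLike_qMat p a c).actU_uvec q d).trans ?_
    simp [flagCoef, add_comm]
  act_rest p r hr := actU_rest p hr

/-- The dual basis of `U*`, in reverse order. -/
def dualFlag (K : Type*) [Field K] (n : ℕ) : Flag (dualRep K n) true where
  w q k := udual K q (Fin.rev k)
  span S hS := by
    refine eq_top_iff.2 ((Pi.basisFun K (Idx n)).dualBasis.span_eq.symm.le.trans
      (Submodule.span_le.2 ?_))
    rintro _ ⟨i, rfl⟩
    have h1 : udual K (par i) (Fin.rev (Fin.rev (pos i)))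
        = (Pi.basisFun K (Idx n)).dualBasis i := by
      refine (Pi.basisFun K (Idx n)).ext fun j => ?_
      rw [Module.Basis.dualBasis_apply_self, Fin.rev_rev, udual, sgl_par_pos]
      change (Pi.basisFun K (Idx n) j) i = _
      rw [Pi.basisFun_apply, Pi.single_apply]
      simp only [eq_comm]
    rw [← h1]
    exact hS _ _
  coord k := evalU (sgl 0 (Fin.rev k))
  coord_w k q d := by
    rw [evalU_udual]
    simp only [pos_sgl, par_sgl, Fin.rev_inj]
    congr 1
    exact propext ⟨fun h => ⟨h.2.symm, h.1.symm⟩, fun h => ⟨h.2.symm, h.1.symm⟩⟩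
  parity_w q k := parUDual_udual q _
  act_w p q a c d := by
    change actUDual K n (qMat K p (emb (Fin.rev c)) (emb (Fin.rev a))) _ = _
    rw [actUDual_of_homog (homog_qMat _ _ _), LinearMap.neg_apply, Module.End.mul_apply]
    have h1 : (parUDual K n ^ p.val) (udual K q (Fin.rev d))
        = ksign K p q • udual K q (Fin.rev d) := by
      rcases zmod2_cases p with rfl | rfl
      · simp [ksign]
      · rw [ZMod.val_one, pow_one, parUDual_udual, ksign, ZMod.val_one, one_mul]
    rw [h1, map_smul, (isUnitLike_qMat p (Fin.rev c) (Fin.rev a)).transU_udual]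
    simp only [Fin.rev_inj, one_smul, add_comm q p]
    split_ifs <;> simp [flagCoef]
  act_rest p r hr := by
    change actUDual K n (qMat K p r r) = 0
    rw [actUDual_of_homog (homog_qMat _ _ _), actU_rest p hr, map_zero, zero_mul, neg_zero]

theorem isCasimir_xEnd {M : Type*} [AddCommGroup M] [Module K M] (τ : SuperRep (gAlg K n) M) :
    (natFlag K n).IsCasimir τ (xEnd τ) := by
  intro q k m
  change omegaAct _ _ _ (uvec K q k ⊗ₜ[K] m) = _
  simp only [omegaAct, LinearMap.sum_apply, LinearMap.sub_apply, TensorProduct.map_tmul,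
    Module.End.mul_apply, parU_uvec, map_smul, (isUnitLike_fMat _ _).actU_uvec,
    (isUnitLike_fMat' _ _).actU_uvec, eG_eq, eG'_eq]
  refine Finset.sum_congr rfl fun l _ => ?_
  rw [Finset.sum_eq_single k]
  · rw [if_pos rfl, if_pos rfl, ← TensorProduct.smul_tmul', ← TensorProduct.smul_tmul',
      ← TensorProduct.smul_tmul']
    rcases zmod2_cases q with rfl | rfl <;>
      simp [natFlag, flagCoef, flagE, frow, fcol, ZMod.val_one,
        show (1 : ZMod 2) + 1 = 0 from by decide] <;> module
  · intro s _ hs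
    simp [hs]
  · simp

theorem isCasimir_xDualEnd {M : Type*} [AddCommGroup M] [Module K M]
    (τ : SuperRep (gAlg K n) M) : (dualFlag K n).IsCasimir τ (xDualEnd τ) := by
  intro q k m
  have hf : ∀ r s, Homog (0 : ZMod 2) (fMat K (n := n) r s) := by
    rintro r s (i | i) (j | j) <;> simp [fMat, unit, par, embU, Matrix.single_apply,
      show (1 : ZMod 2) + 1 = 0 from by decide]
  have hf' : ∀ r s, Homog (1 : ZMod 2) (fMat' K (n := n) r s) := by
    rintro r s (i | i) (j | j) <;> simp [fMat', unit, par, embU, Matrix.single_apply,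
      show (1 : ZMod 2) + 1 = 0 from by decide]
  have h1 : ∀ r s, actUDual K n (fMat K r s) = -transU (actU K n (fMat K r s)) := fun r s => by
    rw [actUDual_of_homog (hf r s), ZMod.val_zero, pow_zero, mul_one]
  have h2 : ∀ r s, actUDual K n (fMat' K r s) * parUDual K n
      = -transU (actU K n (fMat' K r s)) := fun r s => by
    rw [actUDual_of_homog (hf' r s), ZMod.val_one, pow_one, neg_mul, mul_assoc, parUDual_sq,
      mul_one]
  change (-omegaAct _ _ _) (udual K q (Fin.rev k) ⊗ₜ[K] m) = _
  simp only [omegaAct, h1, h2, LinearMap.neg_apply, LinearMap.sum_apply, LinearMap.sub_apply,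
    TensorProduct.map_tmul, (isUnitLike_fMat _ _).transU_udual,
    (isUnitLike_fMat' _ _).transU_udual, eG_eq, eG'_eq]
  rw [Finset.sum_eq_single (Fin.rev k)]
  · rw [← Finset.sum_neg_distrib, ← Equiv.sum_comp Fin.revPerm]
    refine Finset.sum_congr rfl fun l _ => ?_
    rw [if_pos rfl, if_pos rfl, TensorProduct.neg_tmul, TensorProduct.neg_tmul,
      ← TensorProduct.smul_tmul', ← TensorProduct.smul_tmul']
    rcases zmod2_cases q with rfl | rfl <;>
      simp [dualFlag, flagCoef, flagE, frow, fcol, ZMod.val_one, ksign,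
        show (1 : ZMod 2) + 1 = 0 from by decide] <;> abel
  · intro r _ hr
    simp [hr]
  · simp

end modules

/-! ### Eigenvalues and signatures -/

section signature
variable {K : Type*} [Field K] {n : ℕ} (C : Choices K n)

theorem wt_emb (b : Fin n → ℤ) (t : Fin n) :
    C.wt b (emb t) = ((C.sigma t : ℤ) : K) * (C.z + (b t : K)) := dif_pos t.2

theorem wtRoot_emb (b : Fin n → ℤ) (t : Fin n) : C.wtRoot b (emb t)
    = if C.sigma t = 1 then C.root (b t) else (-1 : K) ^ (b t) * C.imag * C.root (b t) :=
  dif_pos t.2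

theorem z_add_ne_zero (k : ℤ) : C.z + (k : K) ≠ 0 := fun h =>
  C.two_z (-(2 * k)) (by push_cast; linear_combination 2 * h)

theorem root_ne_zero (k : ℤ) : C.root k ≠ 0 := fun h =>
  z_add_ne_zero C k (by rw [← C.root_sq, h, mul_zero])

/-- This is where `2z ∉ ℤ` is needed: `(z + k)(z + k + 1)` determines `k`. -/
theorem mul_z_add_inj [CharZero K] {k i : ℤ} :
    (C.z + (k : K)) * (C.z + ((k + 1 : ℤ) : K)) = (C.z + (i : K)) * (C.z + ((i + 1 : ℤ) : K))
      ↔ k = i := by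
  refine ⟨fun h => ?_, fun h => by rw [h]⟩
  by_contra hne
  have h1 : ((k - i : ℤ) : K) * (2 * C.z - ((-(k + i + 1) : ℤ) : K)) = 0 := by
    push_cast at h ⊢
    linear_combination h
  rcases mul_eq_zero.1 h1 with h2 | h2
  · exact hne (sub_eq_zero.1 (Int.cast_eq_zero.1 h2))
  · exact C.two_z _ (sub_eq_zero.1 h2)

/-- The symbol that marks the relevant indices: `f` for `U`, and `e` for `U*`. -/
def flagSig (fl : Bool) : Sig := if fl then Sig.e else Sig.f

/-- The sign by which the weights of `U` and of `U*` are shifted. -/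
def flagSign (fl : Bool) : ℤ := if fl then -1 else 1

theorem iSig_eq_iff (fl : Bool) (i : ℤ) (b : Fin n → ℤ) (t : Fin n) :
    C.iSig i b t = flagSig fl ↔ if fl = decide (C.sigma t = 1) then b t = i + 1 else b t = i := by
  rcases Int.units_eq_one_or (C.sigma t) with h | h <;> cases fl <;>
    simp [Choices.iSig, flagSig, h] <;> grind

/-- The signature singles out the sections on which `X²` has the eigenvalue `j²`. -/
theorem eigval_eq_iff [CharZero K] (fl : Bool) (i : ℤ) (b : Fin n → ℤ) (k : Fin n) :
    Flag.eigval fl C b k = C.root i * C.root (i + 1) * (C.root i * C.root (i + 1))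
      ↔ C.iSig i b (fpos fl k) = flagSig fl := by
  have hj : C.root i * C.root (i + 1) * (C.root i * C.root (i + 1))
      = (C.z + (i : K)) * (C.z + ((i + 1 : ℤ) : K)) := by
    rw [← C.root_sq, ← C.root_sq]
    ring
  rw [iSig_eq_iff, hj, Flag.eigval, wt_emb]
  generalize fpos fl k = t
  have key : ∀ x : ℤ, (C.z + (x : K)) * (C.z + (x : K) + 1)
      = (C.z + (i : K)) * (C.z + ((i + 1 : ℤ) : K)) ↔ x = i := fun x => by
    rw [← mul_z_add_inj C, Int.cast_add x, Int.cast_one, add_assoc]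
  have key' : ∀ x : ℤ, (C.z + (x : K)) * (C.z + (x : K) - 1)
      = (C.z + (i : K)) * (C.z + ((i + 1 : ℤ) : K)) ↔ x = i + 1 := fun x => by
    rw [← sub_eq_iff_eq_add, ← key]
    push_cast
    constructor <;> intro h <;> linear_combination h
  rcases Int.units_eq_one_or (C.sigma t) with h | h <;> cases fl <;>
    simp [h, flagCoef, ksign, ← key, ← key']
  all_goals
    rw [← sub_eq_zero, ← sub_eq_zero (a := (C.z + (b t : K)) * _)]
    ring_nf

theorem isStep_of_iSig (fl : Bool) (i : ℤ) (b : Fin n → ℤ) (k : Fin n)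
    (h : C.iSig i b (fpos fl k) = flagSig fl) :
    IsStep fl C b (b + flagSign fl • C.step (fpos fl k)) k (C.root i * C.root (i + 1)) where
  wt_eq r hr := by rw [wt_add_smul_step, if_neg hr, add_zero]
  root_eq r hr := by
    unfold Choices.wtRoot
    have h1 : ∀ hn : r.1 < n, (b + flagSign fl • C.step (fpos fl k)) ⟨r.1, hn⟩ = b ⟨r.1, hn⟩ := by
      intro hn
      have : (⟨r.1, hn⟩ : Fin n) ≠ fpos fl k := fun h => hr (by rw [← h]; rfl)
      simp [Choices.step, this]
    simp only [h1]
  wt_step := by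
    rw [wt_add_smul_step, if_pos rfl]
    cases fl <;> simp [flagSign, flagCoef, ksign]
  root_mul := by
    have him := C.imag_sq
    have hzp : (-1 : K) ^ i * (-1 : K) ^ i = 1 := by rw [← mul_zpow]; simp
    have hz1 : (-1 : K) ^ (i + 1) = -(-1 : K) ^ i := by
      rw [zpow_add_one₀ (by simp)]; ring
    rw [iSig_eq_iff] at h
    rw [wtRoot_emb, wtRoot_emb]
    generalize fpos fl k = t at *
    rcases Int.units_eq_one_or (C.sigma t) with hσ | hσ <;> cases fl <;>
      simp [hσ, Choices.step, flagSign] at h ⊢ <;> rw [h]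
    · exact mul_comm _ _
    · rw [Int.add_neg_cancel_right]
    · rw [Int.add_neg_cancel_right, hz1]
      linear_combination (-(C.imag * C.imag) * C.root i * C.root (i + 1)) * hzp
        - C.root i * C.root (i + 1) * him
    · rw [hz1]
      linear_combination (-(C.imag * C.imag) * C.root i * C.root (i + 1)) * hzp
        - C.root i * C.root (i + 1) * him
  wt_ne := by
    rw [wt_emb]
    refine mul_ne_zero ?_ (z_add_ne_zero C _)
    rcases Int.units_eq_one_or (C.sigma (fpos fl k)) with h | h <;> simp [h]
  ne_zero := mul_ne_zero (root_ne_zero C _) (root_ne_zero C _)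

/-- The filtrations of the generalized eigenspaces on `U ⊗ M(b)` and on `U* ⊗ M(b)`. -/
theorem hasMultFreeVermaFiltration_of_isCasimir [CharZero K] {fl : Bool} {W : Type*}
    [AddCommGroup W] [Module K W] {ρ : SuperRep (gAlg K n) W} {F : Flag ρ fl} {b : Fin n → ℤ}
    {X : Module.End K (W ⊗[K] VermaSpace C b)} (hX : F.IsCasimir (verma C b) X) (i : ℤ) {m : ℕ}
    (τ : Fin m → Fin n) (hτ : StrictMono τ)
    (hrange : ∀ k, k ∈ Set.range τ ↔ C.iSig i b (fpos fl k) = flagSig fl) :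
    HasMultFreeVermaFiltration C (ρ.tensor (verma C b))
      (X.maxGenEigenspace (C.root i * C.root (i + 1)))
      (fun l => b + flagSign fl • C.step (fpos fl (τ l))) := by
  refine ⟨hX.exists_filtration τ hτ (fun k hk => ?_) _ fun l => ?_, fun l l' hll => ?_⟩
  · rw [hrange, ← eigval_eq_iff, hk]
  · exact isStep_of_iSig C fl i b (τ l) ((hrange _).1 ⟨l, rfl⟩)
  · refine not_evenlyIso_step C b (by cases fl <;> simp [flagSign]) fun h => hll ?_
    refine hτ.injective ?_
    cases fl
    · exact h
    · exact Fin.rev_injective h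

end signature

end

end QSuper

/-- The two parts of the theorem: the filtrations of `sF_j M(b)` and of `sE_j M(b)`, where
`j = √(z+i) √(z+i+1)`. The `orderEmbOfFin` list the relevant indices `t` in increasing order. -/
theorem mainTheorem9 {K : Type*} [Field K] [IsAlgClosed K] [CharZero K] (n : ℕ) (hn : 1 ≤ n)
    (C : QSuper.Choices K n) (b : Fin n → ℤ) (i : ℤ) :
    QSuper.HasMultFreeVermaFiltration C (QSuper.sF (QSuper.verma C b))
      (QSuper.sFj (C.root i * C.root (i + 1)) (QSuper.verma C b))
      (fun l => b + C.step
        ((Finset.univ.filter fun t => C.iSig i b t = QSuper.Sig.f).orderEmbOfFin rfl l)) ∧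
    QSuper.HasMultFreeVermaFiltration C (QSuper.sE (QSuper.verma C b))
      (QSuper.sEj (C.root i * C.root (i + 1)) (QSuper.verma C b))
      (fun l => b - C.step
        ((Finset.univ.filter fun t => C.iSig i b t = QSuper.Sig.e).orderEmbOfFin rfl
          (Fin.rev l))) := by
  constructor
  · have h := QSuper.hasMultFreeVermaFiltration_of_isCasimir C
      (QSuper.isCasimir_xEnd (QSuper.verma C b)) i
      ((Finset.univ.filter fun t => C.iSig i b t = QSuper.Sig.f).orderEmbOfFin rfl)
      (OrderEmbedding.strictMono _) fun k => by
        rw [Finset.range_orderEmbOfFin, Finset.mem_coe, Finset.mem_filter_univ]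
        rfl
    simp only [QSuper.flagSign, Bool.false_eq_true, if_false, one_smul] at h
    exact h
  · have h := QSuper.hasMultFreeVermaFiltration_of_isCasimir C
      (QSuper.isCasimir_xDualEnd (QSuper.verma C b)) i
      (fun l => Fin.rev ((Finset.univ.filter fun t =>
        C.iSig i b t = QSuper.Sig.e).orderEmbOfFin rfl (Fin.rev l)))
      (fun l l' hl => Fin.rev_lt_rev.2 (OrderEmbedding.strictMono _ (Fin.rev_lt_rev.2 hl)))
      fun k => by
        have h1 : Fin.rev k ∈ Set.range ((Finset.univ.filter fun t =>
            C.iSig i b t = QSuper.Sig.e).orderEmbOfFin rfl)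
            ↔ C.iSig i b (Fin.rev k) = QSuper.Sig.e := by
          rw [Finset.range_orderEmbOfFin, Finset.mem_coe, Finset.mem_filter_univ]
        refine Iff.trans ⟨?_, ?_⟩ h1
        · rintro ⟨l, rfl⟩
          exact ⟨Fin.rev l, (Fin.rev_rev _).symm⟩
        · rintro ⟨l, hl⟩
          exact ⟨Fin.rev l, by simp only [Fin.rev_rev, hl]⟩
    simp only [QSuper.flagSign, if_true, neg_smul, one_smul, ← sub_eq_add_neg, QSuper.fpos,
      Fin.rev_rev] at h
    exact h
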